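/- Let $k$ be a field. A quasi-Hopf algebra over $k$ is an associative unital $k$-algebra $H$ with unital algebra maps $\Delta:H\to H\otimes H$ and $\varepsilon:H\to k$, an invertible element $\Phi=X^1\otimes X^2\otimes X^3\in H^{\otimes 3}$ with inverse $\Phi^{-1}=x^1\otimes x^2\otimes x^3$ (summation understood), a unital algebra anti-morphism $S:H\to H$ (not assumed bijective) and elements $\alpha,\beta\in H$ such that, for all $h\in H$ and with $\Delta(h)=h_1\otimes h_2$, $$(\mathrm{Id}\otimes\Delta)\Delta(h)=\Phi\,(\Delta\otimes\mathrm{Id})\Delta(h)\,\Phi^{-1},\qquad (\mathrm{Id}\otimes\varepsilon)\Delta(h)=h=(\varepsilon\otimes\mathrm{Id})\Delta(h),$$ $$(1\otimes\Phi)(\mathrm{Id}\otimes\Delta\otimes\mathrm{Id})(\Phi)(\Phi\otimes1)=(\mathrm{Id}\otimes\mathrm{Id}\otimes\Delta)(\Phi)(\Delta\otimes\mathrm{Id}\otimes\mathrm{Id})(\Phi),\qquad(\mathrm{Id}\otimes\varepsilon\otimes\mathrm{Id})(\Phi)=1\otimes1,$$ $$S(h_1)\alpha h_2=\varepsilon(h)\alpha,\quad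 h_1\beta S(h_2)=\varepsilon(h)\beta,\quad X^1\beta S(X^2)\alpha X^3=1,\quad S(x^1)\alpha x^2\beta S(x^3)=1 .$$ It is quasitriangular (QT), with $R$-matrix $R$, if $R=R^1\otimes R^2=r^1\otimes r^2\in H\otimes H$ is invertible and, writing also $\Phi=Y^1\otimes Y^2\otimes Y^3$ and $\Phi^{-1}=y^1\otimes y^2\otimes y^3$ for further copies, $$(\Delta\otimes\mathrm{Id})(R)=X^2R^1x^1Y^1\otimes X^3x^3r^1Y^2\otimes X^1R^2x^2r^2Y^3,$$ $$(\mathrm{Id}\otimes\Delta)(R)=x^3R^1X^2r^1y^1\otimes x^1X^1r^2y^2\otimes x^2R^2X^3y^3,$$ $$\Delta^{\mathrm{cop}}(h)R=R\Delta(h)\quad\text{for all }h\in H.$$ Let $(H,R)$ be a QT quasi-Hopf algebra, put $R_{21}=R^2\otimes R^1$ and $u=S(R^2x^2\beta S(x^3))\,\alpha R^1x^1$, let $H[\theta]$ be the $k$-algebra generated by $H$ and an element $\theta$ subject to $h\theta=\theta h$ for all $h\in H$, and let $$H(\theta)=H[\theta]/\langle\theta^2-uS(u)\rangle .$$ **Proposition.**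 The canonical map $H\to H(\theta)$ is injective, and there is a unique quasi-Hopf algebra structure on $H(\theta)$ with $\Delta|_H=\Delta_H$, $\varepsilon|_H=\varepsilon_H$, $S|_H=S_H$, $$\Delta(\theta)=(\theta\otimes\theta)(R_{21}R)^{-1},\qquad\varepsilon(\theta)=1,\qquad S(\theta)=\theta,$$ and with the same $\Phi$, $\alpha$, $\beta$ as $H$. Furthermore, $(H(\theta),R)$ is QT; $\theta$ is invertible in $H(\theta)$; and $\eta:=\theta^{-1}$ is a ribbon element of $(H(\theta),R)$, that is, $\eta$ is invertible and central, $\Delta(\eta)=(\eta\otimes\eta)R_{21}R$ and $S(\eta)=\eta$. Moreover $\eta_V(v)=\theta^{-1}\cdot v$ defines a ribbon twist on the category of finite dimensional left $H(\theta)$-modules: $\eta=(\eta_V)_V$ is a natural automorphism of the identity functor with $\eta_{V\otimes W}=(\eta_V\otimes\eta_W)\,c_{W,V}\,c_{V,W}$ and $\eta_{V^*}=(\eta_V)^*$ for all $V,W$. Here the tensor product $V\otimes W$ (over $k$) carries the action given by $\Delta$, the unit object is $k$ with the action given by $\varepsilon$, the unit constraints are those of vector spaces, the associativity constraint is $(v\otimes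 w)\otimes z\mapsto X^1v\otimes(X^2w\otimes X^3z)$, the braiding is $c_{V,W}(v\otimes w)=R^2w\otimes R^1v$, and the dual $V^*$ is the dual space with $(h\cdot f)(v)=f(S(h)v)$, evaluation $V^*\otimes V\to k$, $f\otimes v\mapsto f(\alpha v)$, and coevaluation $k\to V\otimes V^*$, $1\mapsto\sum_i\beta v_i\otimes v^i$ for dual bases $(v_i)$, $(v^i)$; $(\eta_V)^*$ is the transpose with respect to this duality. -/

import Mathlib

universe u v

open CategoryTheory MonoidalCategory
open scoped TensorProduct

noncomputable section

/-! ### Linear maps encoding the Sweedler-type expressions -/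

namespace QH

section Sweedler

variable {k : Type u} [Field k] {H : Type v} [Ring H] [Algebra k H]

/-- An algebra anti-morphism `S`, regarded as a `k`-linear endomorphism of `H`. -/
def antiLin (S : H →ₐ[k] Hᵐᵒᵖ) : H →ₗ[k] H :=
  (MulOpposite.opLinearEquiv k).symm.toLinearMap ∘ₗ S.toLinearMap

@[simp] theorem antiLin_apply (S : H →ₐ[k] Hᵐᵒᵖ) (h : H) :
    antiLin S h = MulOpposite.unop (S h) := rfl

/-- `x ⊗ y ↦ S(x) a y`. -/
def leftMap (S : H →ₐ[k] Hᵐᵒᵖ) (a : H) : H ⊗[k] H →ₗ[k] H :=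
  LinearMap.mul' k H ∘ₗ
    TensorProduct.map (LinearMap.mulRight k a ∘ₗ antiLin S) LinearMap.id

@[simp] theorem leftMap_tmul (S : H →ₐ[k] Hᵐᵒᵖ) (a x y : H) :
    leftMap S a (x ⊗ₜ y) = MulOpposite.unop (S x) * a * y := rfl

/-- `x ⊗ y ↦ x b S(y)`. -/
def rightMap (S : H →ₐ[k] Hᵐᵒᵖ) (b : H) : H ⊗[k] H →ₗ[k] H :=
  LinearMap.mul' k H ∘ₗ
    TensorProduct.map (LinearMap.mulRight k b) (antiLin S)

@[simp] theorem rightMap_tmul (S : H →ₐ[k] Hᵐᵒᵖ) (b x y : H) :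
    rightMap S b (x ⊗ₜ y) = x * b * MulOpposite.unop (S y) := rfl

/-- `x ⊗ y ⊗ z ↦ x b S(y) a z`. -/
def zigMap (S : H →ₐ[k] Hᵐᵒᵖ) (a b : H) : H ⊗[k] (H ⊗[k] H) →ₗ[k] H :=
  LinearMap.mul' k H ∘ₗ TensorProduct.map (LinearMap.mulRight k b) (leftMap S a)

@[simp] theorem zigMap_tmul (S : H →ₐ[k] Hᵐᵒᵖ) (a b x y z : H) :
    zigMap S a b (x ⊗ₜ (y ⊗ₜ z)) = x * b * (MulOpposite.unop (S y) * a * z) := rfl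

/-- `x ⊗ y ⊗ z ↦ S(x) a y b S(z)`. -/
def zagMap (S : H →ₐ[k] Hᵐᵒᵖ) (a b : H) : H ⊗[k] (H ⊗[k] H) →ₗ[k] H :=
  leftMap S a ∘ₗ TensorProduct.map LinearMap.id (rightMap S b)

@[simp] theorem zagMap_tmul (S : H →ₐ[k] Hᵐᵒᵖ) (a b x y z : H) :
    zagMap S a b (x ⊗ₜ (y ⊗ₜ z)) =
      MulOpposite.unop (S x) * a * (y * b * MulOpposite.unop (S z)) := rfl

/-- `x ⊗ y ⊗ z ↦ S(y b S(z)) a x`. -/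
def uMap (S : H →ₐ[k] Hᵐᵒᵖ) (a b : H) : H ⊗[k] (H ⊗[k] H) →ₗ[k] H :=
  leftMap S a ∘ₗ (TensorProduct.comm k H H).toLinearMap ∘ₗ
    TensorProduct.map LinearMap.id (rightMap S b)

@[simp] theorem uMap_tmul (S : H →ₐ[k] Hᵐᵒᵖ) (a b x y z : H) :
    uMap S a b (x ⊗ₜ (y ⊗ₜ z)) =
      MulOpposite.unop (S (y * b * MulOpposite.unop (S z))) * a * x := rfl

end Sweedler

/-! ### Tensor legs -/

section Legs

variable (k : Type u) [Field k] (H : Type v) [Ring H] [Algebra k H]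

/-- Rebracketing `(x ⊗ y) ⊗ z ↦ x ⊗ (y ⊗ z)` of `H ⊗ H ⊗ H`. -/
abbrev asc : (H ⊗[k] H) ⊗[k] H ≃ₐ[k] H ⊗[k] (H ⊗[k] H) :=
  Algebra.TensorProduct.assoc k k k H H H

/-- The flip `x ⊗ y ↦ y ⊗ x`. -/
abbrev flip₂ : H ⊗[k] H ≃ₐ[k] H ⊗[k] H := Algebra.TensorProduct.comm k H H

/-- `x ⊗ y ↦ x ⊗ y ⊗ 1`. -/
abbrev leg12 : H ⊗[k] H →ₐ[k] H ⊗[k] (H ⊗[k] H) :=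
  Algebra.TensorProduct.map (AlgHom.id k H) Algebra.TensorProduct.includeLeft

/-- `x ⊗ y ↦ x ⊗ 1 ⊗ y`. -/
abbrev leg13 : H ⊗[k] H →ₐ[k] H ⊗[k] (H ⊗[k] H) :=
  Algebra.TensorProduct.map (AlgHom.id k H) Algebra.TensorProduct.includeRight

/-- `x ⊗ y ↦ 1 ⊗ x ⊗ y`. -/
abbrev leg23 : H ⊗[k] H →ₐ[k] H ⊗[k] (H ⊗[k] H) :=
  Algebra.TensorProduct.includeRight

/-- `x ⊗ y ⊗ z ↦ x ⊗ z ⊗ y`. -/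
abbrev perm132 : H ⊗[k] (H ⊗[k] H) ≃ₐ[k] H ⊗[k] (H ⊗[k] H) :=
  Algebra.TensorProduct.congr AlgEquiv.refl (flip₂ k H)

/-- `x ⊗ y ⊗ z ↦ y ⊗ x ⊗ z`. -/
abbrev perm213 : H ⊗[k] (H ⊗[k] H) ≃ₐ[k] H ⊗[k] (H ⊗[k] H) :=
  Algebra.TensorProduct.leftComm k H H H

/-- `x ⊗ y ⊗ z ↦ y ⊗ z ⊗ x`. -/
abbrev perm312 : H ⊗[k] (H ⊗[k] H) ≃ₐ[k] H ⊗[k] (H ⊗[k] H) :=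
  (Algebra.TensorProduct.comm k H (H ⊗[k] H)).trans (asc k H)

/-- `x ⊗ y ⊗ z ↦ z ⊗ x ⊗ y`. -/
abbrev perm231 : H ⊗[k] (H ⊗[k] H) ≃ₐ[k] H ⊗[k] (H ⊗[k] H) :=
  (asc k H).symm.trans (Algebra.TensorProduct.comm k (H ⊗[k] H) H)

end Legs

end QH

open QH

/-! ### Quasi-bialgebras, quasi-Hopf algebras, R-matrices -/

/-- A quasi-bialgebra structure on the associative unital `k`-algebra `H`. The triple tensor power
is bracketed as `H ⊗ (H ⊗ H)`, the fourfold one as `H ⊗ (H ⊗ (H ⊗ H))`. -/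
@[ext] structure QuasiBialgebra (k : Type u) [Field k] (H : Type v) [Ring H] [Algebra k H] where
  /-- comultiplication -/
  comul : H →ₐ[k] H ⊗[k] H
  /-- counit -/
  counit : H →ₐ[k] k
  /-- reassociator -/
  Φ : (H ⊗[k] (H ⊗[k] H))ˣ
  /-- `(id ⊗ Δ)Δ(h) = Φ (Δ ⊗ id)Δ(h) Φ⁻¹` -/
  quasi_coassoc : ∀ h : H,
    Algebra.TensorProduct.map (AlgHom.id k H) comul (comul h) =
      (Φ : H ⊗[k] (H ⊗[k] H)) *
        asc k H (Algebra.TensorProduct.map comul (AlgHom.id k H) (comul h)) *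
        (↑Φ⁻¹ : H ⊗[k] (H ⊗[k] H))
  /-- `(id ⊗ ε)Δ(h) = h` -/
  counit_right : ∀ h : H,
    Algebra.TensorProduct.rid k k H
      (Algebra.TensorProduct.map (AlgHom.id k H) counit (comul h)) = h
  /-- `(ε ⊗ id)Δ(h) = h` -/
  counit_left : ∀ h : H,
    Algebra.TensorProduct.lid k H
      (Algebra.TensorProduct.map counit (AlgHom.id k H) (comul h)) = h
  /-- `(1 ⊗ Φ) (id ⊗ Δ ⊗ id)(Φ) (Φ ⊗ 1) = (id ⊗ id ⊗ Δ)(Φ) (Δ ⊗ id ⊗ id)(Φ)` -/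
  cocycle :
    (1 : H) ⊗ₜ[k] (Φ : H ⊗[k] (H ⊗[k] H)) *
      Algebra.TensorProduct.map (AlgHom.id k H)
        ((asc k H : (H ⊗[k] H) ⊗[k] H →ₐ[k] H ⊗[k] (H ⊗[k] H)).comp
          (Algebra.TensorProduct.map comul (AlgHom.id k H))) (Φ : H ⊗[k] (H ⊗[k] H)) *
      Algebra.TensorProduct.map (AlgHom.id k H)
        (asc k H : (H ⊗[k] H) ⊗[k] H →ₐ[k] H ⊗[k] (H ⊗[k] H))
        (Algebra.TensorProduct.assoc k k k H (H ⊗[k] H) H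
          ((Φ : H ⊗[k] (H ⊗[k] H)) ⊗ₜ[k] (1 : H))) =
    Algebra.TensorProduct.map (AlgHom.id k H)
        (Algebra.TensorProduct.map (AlgHom.id k H) comul) (Φ : H ⊗[k] (H ⊗[k] H)) *
      Algebra.TensorProduct.assoc k k k H H (H ⊗[k] H)
        (Algebra.TensorProduct.map comul (AlgHom.id k (H ⊗[k] H)) (Φ : H ⊗[k] (H ⊗[k] H)))
  /-- `(id ⊗ ε ⊗ id)(Φ) = 1 ⊗ 1` -/
  counit_Φ :
    Algebra.TensorProduct.map (AlgHom.id k H)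
      ((Algebra.TensorProduct.lid k H : k ⊗[k] H →ₐ[k] H).comp
        (Algebra.TensorProduct.map counit (AlgHom.id k H))) (Φ : H ⊗[k] (H ⊗[k] H)) = 1

/-- A quasi-Hopf algebra structure on `H` (the antipode is not required to be bijective). -/
@[ext] structure QuasiHopfAlgebra (k : Type u) [Field k] (H : Type v) [Ring H] [Algebra k H]
    extends QuasiBialgebra k H where
  /-- the antipode, an algebra anti-morphism -/
  S : H →ₐ[k] Hᵐᵒᵖ
  /-- distinguished element -/
  α : H
  /-- distinguished element -/
  β : H
  /-- `S(h₁) α h₂ = ε(h) α` -/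
  antipode_left : ∀ h : H, leftMap S α (comul h) = counit h • α
  /-- `h₁ β S(h₂) = ε(h) β` -/
  antipode_right : ∀ h : H, rightMap S β (comul h) = counit h • β
  /-- `X¹ β S(X²) α X³ = 1`, where `Φ = X¹ ⊗ X² ⊗ X³` -/
  antipode_Φ : zigMap S α β (Φ : H ⊗[k] (H ⊗[k] H)) = 1
  /-- `S(x¹) α x² β S(x³) = 1`, where `Φ⁻¹ = x¹ ⊗ x² ⊗ x³` -/
  antipode_Φ_inv : zagMap S α β (↑Φ⁻¹ : H ⊗[k] (H ⊗[k] H)) = 1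

/-- A quasitriangular (QT) quasi-Hopf algebra structure on `H`: a quasi-Hopf algebra structure
together with an R-matrix. -/
@[ext] structure QTQuasiHopfAlgebra (k : Type u) [Field k] (H : Type v) [Ring H] [Algebra k H]
    extends QuasiHopfAlgebra k H where
  /-- the R-matrix -/
  R : (H ⊗[k] H)ˣ
  /-- `(Δ ⊗ id)(R) = Φ₃₁₂ R₁₃ Φ₁₃₂⁻¹ R₂₃ Φ`, that is
  `X²R¹x¹Y¹ ⊗ X³x³r¹Y² ⊗ X¹R²x²r²Y³` -/
  comul_left_R :
    asc k H (Algebra.TensorProduct.map comul (AlgHom.id k H) (R : H ⊗[k] H)) =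
      perm312 k H (Φ : H ⊗[k] (H ⊗[k] H)) * leg13 k H (R : H ⊗[k] H) *
        perm132 k H (↑Φ⁻¹ : H ⊗[k] (H ⊗[k] H)) * leg23 k H (R : H ⊗[k] H) *
        (Φ : H ⊗[k] (H ⊗[k] H))
  /-- `(id ⊗ Δ)(R) = Φ₂₃₁⁻¹ R₁₃ Φ₂₁₃ R₁₂ Φ⁻¹`, that is
  `x³R¹X²r¹y¹ ⊗ x¹X¹r²y² ⊗ x²R²X³y³` -/
  comul_right_R :
    Algebra.TensorProduct.map (AlgHom.id k H) comul (R : H ⊗[k] H) =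
      perm231 k H (↑Φ⁻¹ : H ⊗[k] (H ⊗[k] H)) * leg13 k H (R : H ⊗[k] H) *
        perm213 k H (Φ : H ⊗[k] (H ⊗[k] H)) * leg12 k H (R : H ⊗[k] H) *
        (↑Φ⁻¹ : H ⊗[k] (H ⊗[k] H))
  /-- `Δᶜᵒᵖ(h) R = R Δ(h)` -/
  cop_mul_R : ∀ h : H, flip₂ k H (comul h) * (R : H ⊗[k] H) = (R : H ⊗[k] H) * comul h

namespace QTQuasiHopfAlgebra

variable {k : Type u} [Field k] {H : Type v} [Ring H] [Algebra k H]

/-- The invertible element `R₂₁ R` of `H ⊗ H`. -/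
def R21R (T : QTQuasiHopfAlgebra k H) : (H ⊗[k] H)ˣ :=
  Units.map (flip₂ k H : H ⊗[k] H →* H ⊗[k] H) T.R * T.R

/-- The element `u = S(R²x²βS(x³)) α R¹x¹`, where `R = R¹ ⊗ R²` and `Φ⁻¹ = x¹ ⊗ x² ⊗ x³`. -/
def elemU (T : QTQuasiHopfAlgebra k H) : H :=
  uMap T.S T.α T.β (leg12 k H (T.R : H ⊗[k] H) * (↑T.Φ⁻¹ : H ⊗[k] (H ⊗[k] H)))

/-- `η` is a ribbon element: an invertible central element such that
`Δ(η) = (η ⊗ η) R₂₁ R` and `S(η) = η`. -/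
structure IsRibbonElement (T : QTQuasiHopfAlgebra k H) (η : H) : Prop where
  isUnit : IsUnit η
  central : ∀ h : H, h * η = η * h
  comul_eq : T.comul η = (η ⊗ₜ[k] η) * (T.R21R : H ⊗[k] H)
  antipode_eq : MulOpposite.unop (T.S η) = η

/-! ### The algebra `H(θ)` -/

/-- The relation `θ² = u S(u)` on `H[θ]`. Here `H[θ]` is `Polynomial H`, in which the variable
commutes with all the coefficients, although `H` may be noncommutative. -/
inductive ThetaRel (T : QTQuasiHopfAlgebra k H) : Polynomial H → Polynomial H → Prop
  | sq : ThetaRel T (Polynomial.X ^ 2)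
      (Polynomial.C (T.elemU * MulOpposite.unop (T.S T.elemU)))

/-- The algebra `H(θ) = H[θ] / ⟨θ² - u S(u)⟩`. -/
abbrev Htheta (T : QTQuasiHopfAlgebra k H) : Type v := RingQuot (ThetaRel T)

/-- The canonical algebra map `H → H(θ)`. -/
def incl (T : QTQuasiHopfAlgebra k H) : H →ₐ[k] T.Htheta :=
  (RingQuot.mkAlgHom k (ThetaRel T)).comp Polynomial.CAlgHom

/-- The class of `θ` in `H(θ)`. -/
def theta (T : QTQuasiHopfAlgebra k H) : T.Htheta :=
  RingQuot.mkAlgHom k (ThetaRel T) Polynomial.X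

/-- The map `H ⊗ H → H(θ) ⊗ H(θ)` induced by `H → H(θ)`. -/
def incl₂ (T : QTQuasiHopfAlgebra k H) : H ⊗[k] H →ₐ[k] T.Htheta ⊗[k] T.Htheta :=
  Algebra.TensorProduct.map T.incl T.incl

/-- The map `H ⊗ H ⊗ H → H(θ) ⊗ H(θ) ⊗ H(θ)` induced by `H → H(θ)`. -/
def incl₃ (T : QTQuasiHopfAlgebra k H) :
    H ⊗[k] (H ⊗[k] H) →ₐ[k] T.Htheta ⊗[k] (T.Htheta ⊗[k] T.Htheta) :=
  Algebra.TensorProduct.map T.incl T.incl₂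

/-- The quasi-Hopf algebra structure `Q` on `H(θ)` is given by `Δ|_H = Δ_H`, `ε|_H = ε_H`,
`S|_H = S_H`, `Δ(θ) = (θ ⊗ θ)(R₂₁R)⁻¹`, `ε(θ) = 1`, `S(θ) = θ`, and has the same reassociator and
distinguished elements as `H`. -/
structure IsThetaStructure (T : QTQuasiHopfAlgebra k H) (Q : QuasiHopfAlgebra k T.Htheta) :
    Prop where
  comul_incl : ∀ h : H, Q.comul (T.incl h) = T.incl₂ (T.comul h)
  counit_incl : ∀ h : H, Q.counit (T.incl h) = T.counit h
  antipode_incl : ∀ h : H,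
    MulOpposite.unop (Q.S (T.incl h)) = T.incl (MulOpposite.unop (T.S h))
  comul_theta : Q.comul T.theta =
    (T.theta ⊗ₜ[k] T.theta) * T.incl₂ (↑T.R21R⁻¹ : H ⊗[k] H)
  counit_theta : Q.counit T.theta = 1
  antipode_theta : MulOpposite.unop (Q.S T.theta) = T.theta
  Φ_eq : (Q.Φ : T.Htheta ⊗[k] (T.Htheta ⊗[k] T.Htheta)) = T.incl₃ (T.Φ : H ⊗[k] (H ⊗[k] H))
  α_eq : Q.α = T.incl T.α
  β_eq : Q.β = T.incl T.β

end QTQuasiHopfAlgebra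

/-! ### Outer tensor products of representations -/

namespace QH

section Outer

variable {k : Type u} [Field k]
variable {A B C D : Type v} [Ring A] [Algebra k A] [Ring B] [Algebra k B] [Ring C] [Algebra k C]
  [Ring D] [Algebra k D]
variable {U V W U' V' W' : Type u} [AddCommGroup U] [Module k U] [AddCommGroup V] [Module k V]
  [AddCommGroup W] [Module k W] [AddCommGroup U'] [Module k U'] [AddCommGroup V'] [Module k V']
  [AddCommGroup W'] [Module k W']

/-- The action `(a ⊗ b) · (v ⊗ w) = a · v ⊗ b · w` of `A ⊗ B` on `V ⊗ W`. -/
def outer (ρ : A →ₐ[k] Module.End k V) (σ : B →ₐ[k] Module.End k W) :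
    A ⊗[k] B →ₐ[k] Module.End k (V ⊗[k] W) :=
  (Module.endTensorEndAlgHom (R := k) (S := k) (A := k)).comp (Algebra.TensorProduct.map ρ σ)

variable (ρ : A →ₐ[k] Module.End k U) (σ : B →ₐ[k] Module.End k V) (τ : C →ₐ[k] Module.End k W)

@[simp] theorem outer_tmul_tmul (a : A) (b : B) (v : U) (w : V) :
    outer ρ σ (a ⊗ₜ b) (v ⊗ₜ w) = ρ a v ⊗ₜ σ b w := rfl

theorem outer_tmul (a : A) (b : B) :
    outer ρ σ (a ⊗ₜ b) = TensorProduct.map (ρ a) (σ b) := rfl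

theorem outer_comp {A' B' : Type v} [Ring A'] [Algebra k A'] [Ring B'] [Algebra k B']
    (f : A' →ₐ[k] A) (g : B' →ₐ[k] B) (x : A' ⊗[k] B') :
    outer (ρ.comp f) (σ.comp g) x = outer ρ σ (Algebra.TensorProduct.map f g x) := by
  induction x with
  | zero => simp
  | tmul a b => rfl
  | add x y hx hy => simp only [map_add, hx, hy]

theorem outer_comp_left {A' : Type v} [Ring A'] [Algebra k A']
    (f : A' →ₐ[k] A) (x : A' ⊗[k] B) :
    outer (ρ.comp f) σ x = outer ρ σ (Algebra.TensorProduct.map f (AlgHom.id k B) x) :=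
  outer_comp ρ σ f (AlgHom.id k B) x

theorem outer_comp_right {B' : Type v} [Ring B'] [Algebra k B']
    (g : B' →ₐ[k] B) (x : A ⊗[k] B') :
    outer ρ (σ.comp g) x = outer ρ σ (Algebra.TensorProduct.map (AlgHom.id k A) g x) :=
  outer_comp ρ σ (AlgHom.id k A) g x

/-- If `f` and `g` are compatible with the actions along `p` and `q`, so is `f ⊗ g`. -/
theorem outer_map {A' B' : Type v} [Ring A'] [Algebra k A'] [Ring B'] [Algebra k B']
    (ρ' : A' →ₐ[k] Module.End k U') (σ' : B' →ₐ[k] Module.End k V')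
    (p : A →ₐ[k] A') (q : B →ₐ[k] B') (f : U →ₗ[k] U') (g : V →ₗ[k] V')
    (hf : ∀ a v, f (ρ a v) = ρ' (p a) (f v)) (hg : ∀ b v, g (σ b v) = σ' (q b) (g v))
    (x : A ⊗[k] B) (t : U ⊗[k] V) :
    TensorProduct.map f g (outer ρ σ x t) =
      outer ρ' σ' (Algebra.TensorProduct.map p q x) (TensorProduct.map f g t) := by
  induction x with
  | zero => simp
  | add x y hx hy => simp only [map_add, LinearMap.add_apply, hx, hy]
  | tmul a b =>
    induction t with
    | zero => simp
    | add x y hx hy => simp only [map_add, hx, hy]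
    | tmul v w => simp [hf, hg]

theorem outer_map_id (ρ' : A →ₐ[k] Module.End k U') (σ' : B →ₐ[k] Module.End k V')
    (f : U →ₗ[k] U') (g : V →ₗ[k] V')
    (hf : ∀ a v, f (ρ a v) = ρ' a (f v)) (hg : ∀ b v, g (σ b v) = σ' b (g v))
    (x : A ⊗[k] B) (t : U ⊗[k] V) :
    TensorProduct.map f g (outer ρ σ x t) = outer ρ' σ' x (TensorProduct.map f g t) := by
  have := outer_map ρ σ ρ' σ' (AlgHom.id k A) (AlgHom.id k B) f g hf hg x t
  simpa using this

theorem outer_assoc (x : (A ⊗[k] B) ⊗[k] C) (t : (U ⊗[k] V) ⊗[k] W) :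
    TensorProduct.assoc k U V W (outer (outer ρ σ) τ x t) =
      outer ρ (outer σ τ) (Algebra.TensorProduct.assoc k k k A B C x)
        (TensorProduct.assoc k U V W t) := by
  induction x with
  | zero => simp
  | add x y hx hy => simp only [map_add, LinearMap.add_apply, hx, hy]
  | tmul x c =>
    induction x with
    | zero => simp
    | add x y hx hy => simp only [map_add, LinearMap.add_apply, TensorProduct.add_tmul, hx, hy]
    | tmul a b =>
      induction t with
      | zero => simp
      | add x y hx hy => simp only [map_add, hx, hy]
      | tmul t w =>
        induction t with
        | zero => simp
        | add x y hx hy => simp only [map_add, TensorProduct.add_tmul, hx, hy]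
        | tmul v w => simp

theorem outer_comm (x : A ⊗[k] B) (t : U ⊗[k] V) :
    TensorProduct.comm k U V (outer ρ σ x t) =
      outer σ ρ (Algebra.TensorProduct.comm k A B x) (TensorProduct.comm k U V t) := by
  induction x with
  | zero => simp
  | add x y hx hy => simp only [map_add, LinearMap.add_apply, hx, hy]
  | tmul a b =>
    induction t with
    | zero => simp
    | add x y hx hy => simp only [map_add, hx, hy]
    | tmul v w => simp

/-- The invertible operator by which an invertible element acts. -/
def actEquiv (a : Aˣ) : U ≃ₗ[k] U :=
  LinearEquiv.ofLinearMap (ρ (a : A)) (ρ (↑a⁻¹ : A))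
    (by rw [← Module.End.mul_eq_comp, ← map_mul]; simp; rfl)
    (by rw [← Module.End.mul_eq_comp, ← map_mul]; simp; rfl)

@[simp] theorem actEquiv_apply (a : Aˣ) (v : U) : actEquiv ρ a v = ρ (a : A) v := rfl

@[simp] theorem actEquiv_symm_apply (a : Aˣ) (v : U) :
    (actEquiv ρ a).symm v = ρ (↑a⁻¹ : A) v := rfl

/-- The action of an anti-morphism image on the dual space: `(h · f)(v) = f(S(h) · v)`. -/
def dualAct (S : A →ₐ[k] Aᵐᵒᵖ) : A →ₐ[k] Module.End k (Module.Dual k U) where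
  toFun h := (ρ (MulOpposite.unop (S h))).dualMap
  map_one' := by ext f v; simp
  map_mul' x y := by ext f v; simp
  map_zero' := by ext f v; simp
  map_add' x y := by ext f v; simp
  commutes' r := by ext f v; simp [Algebra.algebraMap_eq_smul_one]

@[simp] theorem dualAct_apply (S : A →ₐ[k] Aᵐᵒᵖ) (h : A) (f : Module.Dual k U) (v : U) :
    dualAct ρ S h f v = f (ρ (MulOpposite.unop (S h)) v) := rfl

end Outer

end QH

/-! ### Structure maps on the underlying vector spaces -/

namespace QTQuasiHopfAlgebra

section Raw

variable {k : Type u} [Field k] {H : Type v} [Ring H] [Algebra k H] (T : QTQuasiHopfAlgebra k H)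
variable {U V W Z U' V' W' : Type u} [AddCommGroup U] [Module k U] [AddCommGroup V] [Module k V]
  [AddCommGroup W] [Module k W] [AddCommGroup Z] [Module k Z]
  [AddCommGroup U'] [Module k U'] [AddCommGroup V'] [Module k V']
  [AddCommGroup W'] [Module k W']
variable (ρ : H →ₐ[k] Module.End k U) (σ : H →ₐ[k] Module.End k V) (τ : H →ₐ[k] Module.End k W)
  (υ : H →ₐ[k] Module.End k Z) (ρ' : H →ₐ[k] Module.End k U') (σ' : H →ₐ[k] Module.End k V')
  (τ' : H →ₐ[k] Module.End k W')

/-- The action `h · (v ⊗ w) = h₁ · v ⊗ h₂ · w`. -/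
def tensorAct : H →ₐ[k] Module.End k (U ⊗[k] V) := (outer ρ σ).comp T.comul

/-- The action of `H` on `k` through the counit. -/
def unitAct : H →ₐ[k] Module.End k k := (Algebra.lmul k k).comp T.counit

/-- `(u ⊗ v) ⊗ w ↦ X¹ · u ⊗ (X² · v ⊗ X³ · w)`. -/
def assocEquiv : (U ⊗[k] V) ⊗[k] W ≃ₗ[k] U ⊗[k] (V ⊗[k] W) :=
  (TensorProduct.assoc k U V W).trans (actEquiv (outer ρ (outer σ τ)) T.Φ)

/-- `v ⊗ w ↦ R² · w ⊗ R¹ · v`. -/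
def braidEquiv : U ⊗[k] V ≃ₗ[k] V ⊗[k] U :=
  (actEquiv (outer ρ σ) T.R).trans (TensorProduct.comm k U V)

/-- `f ⊗ v ↦ f(α · v)`. -/
def evMap : Module.Dual k U ⊗[k] U →ₗ[k] k :=
  contractLeft k U ∘ₗ TensorProduct.map LinearMap.id (ρ T.α)

/-- `1 ↦ ∑ β · vᵢ ⊗ vⁱ`, for dual bases `(vᵢ)`, `(vⁱ)`. -/
def coevMap [FiniteDimensional k U] : k →ₗ[k] U ⊗[k] Module.Dual k U :=
  TensorProduct.map (ρ T.β) LinearMap.id ∘ₗ coevaluation k U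

theorem assocEquiv_apply (t : (U ⊗[k] V) ⊗[k] W) :
    T.assocEquiv ρ σ τ t =
      outer ρ (outer σ τ) (T.Φ : H ⊗[k] (H ⊗[k] H)) (TensorProduct.assoc k U V W t) := rfl

theorem assocEquiv_symm_apply (t : U ⊗[k] (V ⊗[k] W)) :
    (T.assocEquiv ρ σ τ).symm t =
      (TensorProduct.assoc k U V W).symm
        (outer ρ (outer σ τ) (↑T.Φ⁻¹ : H ⊗[k] (H ⊗[k] H)) t) := rfl

theorem braidEquiv_apply (t : U ⊗[k] V) :
    T.braidEquiv ρ σ t = TensorProduct.comm k U V (outer ρ σ (T.R : H ⊗[k] H) t) := rfl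

theorem tensorAct_apply (h : H) : T.tensorAct ρ σ h = outer ρ σ (T.comul h) := rfl

theorem outer_tensorAct_right (x : H ⊗[k] H) :
    outer ρ (T.tensorAct σ τ) x = outer ρ (outer σ τ)
      (Algebra.TensorProduct.map (AlgHom.id k H) T.comul x) :=
  outer_comp_right _ _ _ _

theorem outer_tensorAct_left (x : H ⊗[k] H) :
    outer (T.tensorAct ρ σ) τ x = outer (outer ρ σ) τ
      (Algebra.TensorProduct.map T.comul (AlgHom.id k H) x) :=
  outer_comp_left _ _ _ _

theorem assocEquiv_act (h : H) (t : (U ⊗[k] V) ⊗[k] W) :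
    T.assocEquiv ρ σ τ (T.tensorAct (T.tensorAct ρ σ) τ h t) =
      T.tensorAct ρ (T.tensorAct σ τ) h (T.assocEquiv ρ σ τ t) := by
  rw [assocEquiv_apply, assocEquiv_apply, tensorAct_apply, tensorAct_apply,
    outer_tensorAct_left, outer_tensorAct_right, outer_assoc, ← Module.End.mul_apply, ← map_mul,
    ← Module.End.mul_apply, ← map_mul, T.quasi_coassoc, mul_assoc, mul_assoc, Units.inv_mul,
    mul_one]

theorem lid_outer (x : H ⊗[k] H) (t : k ⊗[k] U) :
    TensorProduct.lid k U (outer T.unitAct ρ x t) =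
      ρ (Algebra.TensorProduct.lid k H (Algebra.TensorProduct.map T.counit (AlgHom.id k H) x))
        (TensorProduct.lid k U t) := by
  induction x with
  | zero => simp
  | add x y hx hy => simp only [map_add, LinearMap.add_apply, hx, hy]
  | tmul a b =>
    induction t with
    | zero => simp
    | add x y hx hy => simp only [map_add, hx, hy]
    | tmul c v => simp [unitAct, mul_smul, smul_comm c]

theorem rid_outer (x : H ⊗[k] H) (t : U ⊗[k] k) :
    TensorProduct.rid k U (outer ρ T.unitAct x t) =
      ρ (Algebra.TensorProduct.rid k k H (Algebra.TensorProduct.map (AlgHom.id k H) T.counit x))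
        (TensorProduct.rid k U t) := by
  induction x with
  | zero => simp
  | add x y hx hy => simp only [map_add, LinearMap.add_apply, hx, hy]
  | tmul a b =>
    induction t with
    | zero => simp
    | add x y hx hy => simp only [map_add, hx, hy]
    | tmul v c => simp [unitAct, mul_smul, smul_comm c]

theorem lid_act (h : H) (t : k ⊗[k] U) :
    TensorProduct.lid k U (T.tensorAct T.unitAct ρ h t) = ρ h (TensorProduct.lid k U t) := by
  rw [tensorAct_apply, lid_outer, T.counit_left]

theorem rid_act (h : H) (t : U ⊗[k] k) :
    TensorProduct.rid k U (T.tensorAct ρ T.unitAct h t) = ρ h (TensorProduct.rid k U t) := by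
  rw [tensorAct_apply, rid_outer, T.counit_right]

theorem assocEquiv_natural (f : U →ₗ[k] U') (g : V →ₗ[k] V') (e : W →ₗ[k] W')
    (hf : ∀ h v, f (ρ h v) = ρ' h (f v)) (hg : ∀ h v, g (σ h v) = σ' h (g v))
    (he : ∀ h v, e (τ h v) = τ' h (e v)) (t : (U ⊗[k] V) ⊗[k] W) :
    T.assocEquiv ρ' σ' τ' (TensorProduct.map (TensorProduct.map f g) e t) =
      TensorProduct.map f (TensorProduct.map g e) (T.assocEquiv ρ σ τ t) := by
  rw [assocEquiv_apply, assocEquiv_apply,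
    outer_map_id ρ (outer σ τ) ρ' (outer σ' τ') f (TensorProduct.map g e) hf
      (outer_map_id σ τ σ' τ' g e hg he)]
  congr 1
  induction t with
  | zero => simp
  | add x y hx hy => simp only [map_add, hx, hy]
  | tmul t w =>
    induction t with
    | zero => simp
    | add x y hx hy => simp only [map_add, TensorProduct.add_tmul, hx, hy]
    | tmul v w => simp

theorem assoc_pentagon (t : ((U ⊗[k] V) ⊗[k] W) ⊗[k] Z) :
    TensorProduct.map LinearMap.id (TensorProduct.assoc k V W Z).toLinearMap
      (TensorProduct.assoc k U (V ⊗[k] W) Z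
        (TensorProduct.map (TensorProduct.assoc k U V W).toLinearMap LinearMap.id t)) =
    TensorProduct.assoc k U V (W ⊗[k] Z) (TensorProduct.assoc k (U ⊗[k] V) W Z t) := by
  induction t with
  | zero => simp
  | add x y hx hy => simp only [map_add, hx, hy]
  | tmul t z =>
    induction t with
    | zero => simp
    | add x y hx hy => simp only [map_add, TensorProduct.add_tmul, hx, hy]
    | tmul t w =>
      induction t with
      | zero => simp
      | add x y hx hy => simp only [map_add, TensorProduct.add_tmul, hx, hy]
      | tmul u v => simp

theorem map_outer_id (x : H ⊗[k] H) (f : W →ₗ[k] U ⊗[k] V) (t : W ⊗[k] Z) :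
    TensorProduct.map (outer ρ σ x ∘ₗ f) LinearMap.id t =
      outer (outer ρ σ) υ (x ⊗ₜ 1) (TensorProduct.map f LinearMap.id t) := by
  rw [outer_tmul, map_one, ← LinearMap.comp_apply (TensorProduct.map _ _),
    ← TensorProduct.map_comp]
  rfl

theorem assocEquiv_pentagon (t : ((U ⊗[k] V) ⊗[k] W) ⊗[k] Z) :
    TensorProduct.map LinearMap.id (T.assocEquiv σ τ υ).toLinearMap
      (T.assocEquiv ρ (T.tensorAct σ τ) υ
        (TensorProduct.map (T.assocEquiv ρ σ τ).toLinearMap LinearMap.id t)) =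
    T.assocEquiv ρ σ (T.tensorAct τ υ) (T.assocEquiv (T.tensorAct ρ σ) τ υ t) := by
  have h1 : TensorProduct.map (T.assocEquiv ρ σ τ).toLinearMap LinearMap.id t =
      outer (outer ρ (outer σ τ)) υ ((T.Φ : H ⊗[k] (H ⊗[k] H)) ⊗ₜ 1)
        (TensorProduct.map (TensorProduct.assoc k U V W).toLinearMap LinearMap.id t) := by
    rw [outer_tmul, map_one, ← LinearMap.comp_apply (TensorProduct.map _ _),
      ← TensorProduct.map_comp]
    rfl
  have h2 : outer (T.tensorAct σ τ) υ = (outer (outer σ τ) υ).comp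
      (Algebra.TensorProduct.map T.comul (AlgHom.id k H)) :=
    AlgHom.ext fun x => T.outer_tensorAct_left σ τ υ x
  have h3 : outer σ (T.tensorAct τ υ) = (outer σ (outer τ υ)).comp
      (Algebra.TensorProduct.map (AlgHom.id k H) T.comul) :=
    AlgHom.ext fun x => T.outer_tensorAct_right σ τ υ x
  have h4 : ∀ x : H ⊗[k] (H ⊗[k] H), outer (T.tensorAct ρ σ) (outer τ υ) x =
      outer (outer ρ σ) (outer τ υ)
        (Algebra.TensorProduct.map T.comul (AlgHom.id k (H ⊗[k] H)) x) :=
    fun x => outer_comp_left _ _ _ x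
  have h5 : ∀ s : U ⊗[k] ((V ⊗[k] W) ⊗[k] Z),
      TensorProduct.map LinearMap.id (T.assocEquiv σ τ υ).toLinearMap s =
      outer ρ (outer σ (outer τ υ)) (1 ⊗ₜ (T.Φ : H ⊗[k] (H ⊗[k] H)))
        (TensorProduct.map LinearMap.id (TensorProduct.assoc k V W Z).toLinearMap s) := by
    intro s
    rw [outer_tmul, map_one, ← LinearMap.comp_apply (TensorProduct.map _ _),
      ← TensorProduct.map_comp]
    rfl
  have h6 := outer_map ρ (outer (outer σ τ) υ) ρ (outer σ (outer τ υ)) (AlgHom.id k H)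
    (asc k H : (H ⊗[k] H) ⊗[k] H →ₐ[k] H ⊗[k] (H ⊗[k] H)) LinearMap.id
    (TensorProduct.assoc k V W Z).toLinearMap (fun _ _ => rfl)
    (fun b v => outer_assoc σ τ υ b v)
  rw [h1, assocEquiv_apply, h2, outer_comp_right, outer_assoc, ← Module.End.mul_apply, ← map_mul,
    h5, h6, ← Module.End.mul_apply, ← map_mul, assoc_pentagon, assocEquiv_apply, assocEquiv_apply,
    h3, outer_comp_right, h4, outer_assoc, ← Module.End.mul_apply, ← map_mul, ← T.cocycle,
    map_mul (Algebra.TensorProduct.map (AlgHom.id k H) _), ← mul_assoc]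
  congr 4
  rw [← AlgHom.comp_apply, ← Algebra.TensorProduct.map_comp]
  rfl

theorem assocEquiv_triangle (t : (U ⊗[k] k) ⊗[k] V) :
    TensorProduct.map LinearMap.id (TensorProduct.lid k V).toLinearMap
      (T.assocEquiv ρ T.unitAct σ t) =
    TensorProduct.map (TensorProduct.rid k U).toLinearMap LinearMap.id t := by
  have h := outer_map ρ (outer T.unitAct σ) ρ σ (AlgHom.id k H)
    ((Algebra.TensorProduct.lid k H : k ⊗[k] H →ₐ[k] H).comp
        (Algebra.TensorProduct.map T.counit (AlgHom.id k H))) LinearMap.id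
    (TensorProduct.lid k V).toLinearMap (fun _ _ => rfl) (fun b v => T.lid_outer σ b v)
  rw [assocEquiv_apply, h, T.counit_Φ, map_one, Module.End.one_apply]
  induction t with
  | zero => simp
  | add x y hx hy => simp only [map_add, hx, hy]
  | tmul t w =>
    induction t with
    | zero => simp
    | add x y hx hy => simp only [map_add, TensorProduct.add_tmul, hx, hy]
    | tmul v c => simp [TensorProduct.smul_tmul]

/-! Duality -/

theorem evMap_tmul (f : Module.Dual k U) (v : U) : T.evMap ρ (f ⊗ₜ v) = f (ρ T.α v) := rfl

theorem evMap_outer (x : H ⊗[k] H) (f : Module.Dual k U) (v : U) :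
    T.evMap ρ (outer (dualAct ρ T.S) ρ x (f ⊗ₜ v)) = f (ρ (leftMap T.S T.α x) v) := by
  induction x with
  | zero => simp
  | add x y hx hy => simp only [map_add, LinearMap.add_apply, hx, hy]
  | tmul a b => simp [evMap_tmul]

theorem evMap_act (h : H) (t : Module.Dual k U ⊗[k] U) :
    T.evMap ρ (T.tensorAct (dualAct ρ T.S) ρ h t) = T.unitAct h (T.evMap ρ t) := by
  induction t with
  | zero => simp
  | add x y hx hy => simp only [map_add, hx, hy]
  | tmul f v =>
    rw [tensorAct_apply, evMap_outer, T.antipode_left, evMap_tmul]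
    simp [unitAct]

theorem coevaluation_slide [FiniteDimensional k U] (g : U →ₗ[k] U) :
    TensorProduct.map LinearMap.id g.dualMap (coevaluation k U 1) =
      TensorProduct.map g LinearMap.id (coevaluation k U 1) := by
  rw [coevaluation_apply_one]
  simp only [map_sum, TensorProduct.map_tmul, LinearMap.id_apply]
  set b := Module.Basis.ofVectorSpace k U
  have h1 : ∀ i, g.dualMap (b.coord i) = ∑ j, b.coord i (g (b j)) • b.coord j := by
    intro i
    apply b.ext
    intro j
    simp [LinearMap.sum_apply, b.repr_self]
    rw [Finset.sum_eq_single j] <;> simp +contextual [eq_comm]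
  have h2 : ∀ j, g (b j) = ∑ i, b.coord i (g (b j)) • b i := fun j => (b.sum_repr _).symm
  simp only [h1]
  conv_rhs =>
    enter [2, j]
    rw [h2 j]
  simp only [TensorProduct.tmul_sum, TensorProduct.sum_tmul, TensorProduct.tmul_smul,
    TensorProduct.smul_tmul']
  exact Finset.sum_comm

theorem coev_outer [FiniteDimensional k U] (x : H ⊗[k] H) :
    outer ρ (dualAct ρ T.S) x (T.coevMap ρ 1) =
      TensorProduct.map (ρ (rightMap T.S T.β x)) LinearMap.id (coevaluation k U 1) := by
  induction x with
  | zero => simp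
  | add x y hx hy => simp only [map_add, LinearMap.add_apply, hx, hy, TensorProduct.map_add_left]
  | tmul a b =>
    have h := coevaluation_slide (k := k) (ρ (MulOpposite.unop (T.S b)))
    rw [rightMap_tmul, map_mul, Module.End.mul_eq_comp,
      ← LinearMap.id_comp (LinearMap.id : Module.Dual k U →ₗ[k] _), TensorProduct.map_comp,
      LinearMap.comp_apply, ← h, outer_tmul, coevMap, LinearMap.comp_apply,
      ← LinearMap.comp_apply (TensorProduct.map _ _), ← TensorProduct.map_comp,
      ← LinearMap.comp_apply (TensorProduct.map _ _) (TensorProduct.map LinearMap.id _),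
      ← TensorProduct.map_comp, map_mul]
    rfl

theorem coevMap_act [FiniteDimensional k U] (h : H) (c : k) :
    T.coevMap ρ (T.unitAct h c) = T.tensorAct ρ (dualAct ρ T.S) h (T.coevMap ρ c) := by
  have h1 : T.coevMap ρ (T.unitAct h 1) =
      T.tensorAct ρ (dualAct ρ T.S) h (T.coevMap ρ 1) := by
    rw [tensorAct_apply, coev_outer, T.antipode_right]
    have : T.unitAct h 1 = T.counit h • (1 : k) := by simp [unitAct]
    rw [this, map_smul, map_smul, TensorProduct.map_smul_left]
    rfl
  have h2 : c = c • (1 : k) := by simp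
  rw [h2, map_smul, map_smul, map_smul, map_smul, h1]

theorem coevMap_one [FiniteDimensional k U] :
    T.coevMap ρ 1 = ∑ i, ρ T.β (Module.Basis.ofVectorSpace k U i) ⊗ₜ[k]
      (Module.Basis.ofVectorSpace k U).coord i := by
  rw [coevMap, LinearMap.comp_apply, coevaluation_apply_one]
  simp

theorem zig_aux [FiniteDimensional k U] (x : H ⊗[k] (H ⊗[k] H)) (v : U) :
    TensorProduct.rid k U (TensorProduct.map LinearMap.id (T.evMap ρ)
      (outer ρ (outer (dualAct ρ T.S) ρ) x
        (TensorProduct.assoc k U (Module.Dual k U) U (T.coevMap ρ 1 ⊗ₜ v)))) =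
      ρ (zigMap T.S T.α T.β x) v := by
  rw [coevMap_one, TensorProduct.sum_tmul, map_sum, map_sum, map_sum, map_sum]
  set b := Module.Basis.ofVectorSpace k U
  induction x with
  | zero => simp
  | add x y hx hy =>
    simp only [map_add, LinearMap.add_apply, Finset.sum_add_distrib, hx, hy]
  | tmul a x =>
    induction x with
    | zero => simp
    | add x y hx hy =>
      simp only [map_add, LinearMap.add_apply, TensorProduct.tmul_add, Finset.sum_add_distrib,
        hx, hy]
    | tmul c d =>
      have h := b.sum_repr (ρ (MulOpposite.unop (T.S c)) (ρ T.α (ρ d v)))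
      simp only [TensorProduct.assoc_tmul, outer_tmul_tmul, TensorProduct.map_tmul, evMap_tmul,
        dualAct_apply, LinearMap.id_apply, TensorProduct.rid_tmul, zigMap_tmul, map_mul,
        Module.End.mul_apply, Module.Basis.coord_apply]
      conv_rhs => rw [← h]
      simp only [map_sum, map_smul]

theorem zag_aux [FiniteDimensional k U] (x : H ⊗[k] (H ⊗[k] H)) (f : Module.Dual k U) :
    TensorProduct.lid k (Module.Dual k U) (TensorProduct.map (T.evMap ρ) LinearMap.id
      ((TensorProduct.assoc k (Module.Dual k U) U (Module.Dual k U)).symm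
        (outer (dualAct ρ T.S) (outer ρ (dualAct ρ T.S)) x (f ⊗ₜ T.coevMap ρ 1)))) =
      f ∘ₗ ρ (zagMap T.S T.α T.β x) := by
  rw [coevMap_one, TensorProduct.tmul_sum, map_sum, map_sum, map_sum, map_sum]
  set b := Module.Basis.ofVectorSpace k U
  induction x with
  | zero => simp
  | add x y hx hy =>
    simp only [map_add, LinearMap.add_apply, Finset.sum_add_distrib, hx, hy, LinearMap.comp_add]
  | tmul a x =>
    induction x with
    | zero => simp
    | add x y hx hy =>
      simp only [map_add, LinearMap.add_apply, TensorProduct.tmul_add, Finset.sum_add_distrib,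
        hx, hy, LinearMap.comp_add]
    | tmul c d =>
      ext v
      have h := b.sum_repr (ρ (MulOpposite.unop (T.S d)) v)
      simp only [TensorProduct.assoc_symm_tmul, outer_tmul_tmul, TensorProduct.map_tmul,
        evMap_tmul, dualAct_apply, LinearMap.id_apply, TensorProduct.lid_tmul, zagMap_tmul,
        map_mul, Module.End.mul_apply, LinearMap.sum_apply, LinearMap.smul_apply,
        Module.Basis.coord_apply, LinearMap.comp_apply]
      conv_rhs => rw [← h]
      simp only [map_sum, map_smul, smul_eq_mul, mul_comm]

theorem zig [FiniteDimensional k U] (t : k ⊗[k] U) :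
    TensorProduct.map LinearMap.id (T.evMap ρ) (T.assocEquiv ρ (dualAct ρ T.S) ρ
      (TensorProduct.map (T.coevMap ρ) LinearMap.id t)) =
    (TensorProduct.rid k U).symm (TensorProduct.lid k U t) := by
  rw [LinearEquiv.eq_symm_apply]
  induction t with
  | zero => simp
  | add x y hx hy => simp only [map_add, hx, hy]
  | tmul c v =>
    have h := T.zig_aux ρ (T.Φ : H ⊗[k] (H ⊗[k] H)) (c • v)
    rw [T.antipode_Φ, map_one ρ, Module.End.one_apply] at h
    have h2 : c ⊗ₜ[k] v = (1 : k) ⊗ₜ[k] (c • v) := by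
      rw [TensorProduct.tmul_smul, TensorProduct.smul_tmul']; simp
    rw [h2, TensorProduct.map_tmul, LinearMap.id_apply, assocEquiv_apply]
    simpa using h

theorem zag [FiniteDimensional k U] (t : Module.Dual k U ⊗[k] k) :
    TensorProduct.map (T.evMap ρ) LinearMap.id
      ((T.assocEquiv (dualAct ρ T.S) ρ (dualAct ρ T.S)).symm
        (TensorProduct.map LinearMap.id (T.coevMap ρ) t)) =
    (TensorProduct.lid k (Module.Dual k U)).symm (TensorProduct.rid k (Module.Dual k U) t) := by
  rw [LinearEquiv.eq_symm_apply]
  induction t with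
  | zero => simp
  | add x y hx hy => simp only [map_add, hx, hy]
  | tmul f c =>
    have h := T.zag_aux ρ (↑T.Φ⁻¹ : H ⊗[k] (H ⊗[k] H)) (c • f)
    rw [T.antipode_Φ_inv, map_one ρ, Module.End.one_eq_id, LinearMap.comp_id] at h
    have h2 : f ⊗ₜ[k] c = (c • f) ⊗ₜ[k] (1 : k) := by
      rw [TensorProduct.smul_tmul]; simp
    rw [h2, TensorProduct.map_tmul, LinearMap.id_apply, assocEquiv_symm_apply]
    simpa using h

/-! Braiding -/

theorem braidEquiv_act (h : H) (t : U ⊗[k] V) :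
    T.braidEquiv ρ σ (T.tensorAct ρ σ h t) = T.tensorAct σ ρ h (T.braidEquiv ρ σ t) := by
  rw [braidEquiv_apply, braidEquiv_apply, tensorAct_apply, tensorAct_apply,
    ← Module.End.mul_apply, ← map_mul, ← T.cop_mul_R, map_mul, Module.End.mul_apply, outer_comm]
  congr 2
  generalize T.comul h = x
  induction x with
  | zero => simp
  | add x y hx hy => simp only [map_add, hx, hy]
  | tmul a b => simp

theorem braidEquiv_natural (f : U →ₗ[k] U') (g : V →ₗ[k] V')
    (hf : ∀ h v, f (ρ h v) = ρ' h (f v)) (hg : ∀ h v, g (σ h v) = σ' h (g v)) (t : U ⊗[k] V) :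
    T.braidEquiv ρ' σ' (TensorProduct.map f g t) =
      TensorProduct.map g f (T.braidEquiv ρ σ t) := by
  rw [braidEquiv_apply, braidEquiv_apply, ← outer_map_id ρ σ ρ' σ' f g hf hg]
  exact (TensorProduct.map_comm g f _).symm

theorem outer_312 (x : H ⊗[k] (H ⊗[k] H)) (t : U ⊗[k] (V ⊗[k] W)) :
    TensorProduct.assoc k V W U (TensorProduct.comm k U (V ⊗[k] W)
      (outer ρ (outer σ τ) x t)) =
    outer σ (outer τ ρ) (perm312 k H x)
      (TensorProduct.assoc k V W U (TensorProduct.comm k U (V ⊗[k] W) t)) := by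
  rw [outer_comm, outer_assoc]
  rfl

theorem outer_231 (x : H ⊗[k] (H ⊗[k] H)) (t : U ⊗[k] (V ⊗[k] W)) :
    TensorProduct.comm k (U ⊗[k] V) W ((TensorProduct.assoc k U V W).symm
      (outer ρ (outer σ τ) x t)) =
    outer τ (outer ρ σ) (perm231 k H x)
      (TensorProduct.comm k (U ⊗[k] V) W ((TensorProduct.assoc k U V W).symm t)) := by
  have h := outer_assoc ρ σ τ ((asc k H).symm x) ((TensorProduct.assoc k U V W).symm t)
  rw [LinearEquiv.apply_symm_apply, AlgEquiv.apply_symm_apply] at h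
  rw [← h, LinearEquiv.symm_apply_apply, outer_comm]
  rfl

theorem outer_132 (x : H ⊗[k] (H ⊗[k] H)) (t : U ⊗[k] (V ⊗[k] W)) :
    TensorProduct.map LinearMap.id (TensorProduct.comm k V W).toLinearMap
      (outer ρ (outer σ τ) x t) =
    outer ρ (outer τ σ) (perm132 k H x)
      (TensorProduct.map LinearMap.id (TensorProduct.comm k V W).toLinearMap t) :=
  outer_map ρ (outer σ τ) ρ (outer τ σ) (AlgHom.id k H)
    (flip₂ k H : H ⊗[k] H →ₐ[k] H ⊗[k] H) LinearMap.id _ (fun _ _ => rfl)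
    (fun b v => outer_comm σ τ b v) x t

theorem outer_213 (x : H ⊗[k] (H ⊗[k] H)) (t : U ⊗[k] (V ⊗[k] W)) :
    TensorProduct.leftComm k U V W (outer ρ (outer σ τ) x t) =
    outer σ (outer ρ τ) (perm213 k H x) (TensorProduct.leftComm k U V W t) := by
  induction x with
  | zero => simp
  | add x y hx hy => simp only [map_add, LinearMap.add_apply, hx, hy]
  | tmul a x =>
    induction x with
    | zero => simp
    | add x y hx hy => simp only [map_add, LinearMap.add_apply, TensorProduct.tmul_add, hx, hy]
    | tmul b c =>
      induction t with
      | zero => simp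
      | add x y hx hy => simp only [map_add, hx, hy]
      | tmul u t =>
        induction t with
        | zero => simp
        | add x y hx hy => simp only [map_add, TensorProduct.tmul_add, hx, hy]
        | tmul v w => simp

theorem perm312_perm231 (x : H ⊗[k] (H ⊗[k] H)) : perm312 k H (perm231 k H x) = x := by
  change asc k H ((Algebra.TensorProduct.comm k (H ⊗[k] H) H).symm
    (Algebra.TensorProduct.comm k (H ⊗[k] H) H ((asc k H).symm x))) = x
  simp only [AlgEquiv.symm_apply_apply, AlgEquiv.apply_symm_apply]

theorem perm231_perm312 (x : H ⊗[k] (H ⊗[k] H)) : perm231 k H (perm312 k H x) = x := by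
  change (Algebra.TensorProduct.comm k H (H ⊗[k] H)).symm ((asc k H).symm (asc k H
    (Algebra.TensorProduct.comm k H (H ⊗[k] H) x))) = x
  simp only [AlgEquiv.symm_apply_apply]

theorem perm312_leg13 (x : H ⊗[k] H) :
    perm312 k H (leg13 k H x) = perm132 k H (leg23 k H x) := by
  induction x with
  | zero => simp
  | add x y hx hy => simp only [map_add, hx, hy]
  | tmul a b => simp

theorem perm312_leg12 (x : H ⊗[k] H) :
    perm312 k H (leg12 k H x) = perm132 k H (perm213 k H (leg12 k H x)) := by
  induction x with
  | zero => simp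
  | add x y hx hy => simp only [map_add, hx, hy]
  | tmul a b => simp

theorem perm312_perm213 (x : H ⊗[k] (H ⊗[k] H)) :
    perm312 k H (perm213 k H x) = perm132 k H x := by
  induction x with
  | zero => simp
  | add x y hx hy => simp only [map_add, hx, hy]
  | tmul a x =>
    induction x with
    | zero => simp
    | add x y hx hy => simp only [map_add, TensorProduct.tmul_add, hx, hy]
    | tmul b c => simp

theorem perm231_perm132 (x : H ⊗[k] (H ⊗[k] H)) :
    perm231 k H (perm132 k H x) = perm213 k H x := by
  induction x with
  | zero => simp
  | add x y hx hy => simp only [map_add, hx, hy]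
  | tmul a x =>
    induction x with
    | zero => simp
    | add x y hx hy => simp only [map_add, TensorProduct.tmul_add, hx, hy]
    | tmul b c => simp

theorem perm231_leg13 (x : H ⊗[k] H) :
    perm231 k H (leg13 k H x) = perm213 k H (leg12 k H x) := by
  induction x with
  | zero => simp
  | add x y hx hy => simp only [map_add, hx, hy]
  | tmul a b => simp

theorem perm231_leg23 (x : H ⊗[k] H) :
    perm231 k H (leg23 k H x) = perm213 k H (perm132 k H (leg23 k H x)) := by
  induction x with
  | zero => simp
  | add x y hx hy => simp only [map_add, hx, hy]
  | tmul a b => simp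

theorem asc_tmul_one (x : H ⊗[k] H) : asc k H (x ⊗ₜ 1) = leg12 k H x := by
  induction x with
  | zero => simp
  | add x y hx hy => simp only [map_add, TensorProduct.add_tmul, hx, hy]
  | tmul a b => simp

/-- The braiding of the first two factors, on a right-bracketed triple tensor product. -/
theorem map_braid_left (t : (U ⊗[k] V) ⊗[k] W) :
    TensorProduct.assoc k V U W
      (TensorProduct.map (T.braidEquiv ρ σ).toLinearMap LinearMap.id t) =
    outer σ (outer ρ τ) (perm213 k H (leg12 k H (T.R : H ⊗[k] H)))
      (TensorProduct.leftComm k U V W (TensorProduct.assoc k U V W t)) := by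
  have h1 : TensorProduct.map (T.braidEquiv ρ σ).toLinearMap LinearMap.id t =
      TensorProduct.map (TensorProduct.comm k U V).toLinearMap LinearMap.id
        (outer (outer ρ σ) τ ((T.R : H ⊗[k] H) ⊗ₜ 1) t) := by
    rw [outer_tmul, map_one, ← LinearMap.comp_apply (TensorProduct.map _ _),
      ← TensorProduct.map_comp]
    rfl
  have h2 : ∀ s : (U ⊗[k] V) ⊗[k] W, TensorProduct.assoc k V U W
      (TensorProduct.map (TensorProduct.comm k U V).toLinearMap LinearMap.id s) =
      TensorProduct.leftComm k U V W (TensorProduct.assoc k U V W s) := by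
    intro s
    induction s with
    | zero => simp
    | add x y hx hy => simp only [map_add, hx, hy]
    | tmul s w =>
      induction s with
      | zero => simp
      | add x y hx hy => simp only [map_add, TensorProduct.add_tmul, hx, hy]
      | tmul v w => simp
  rw [h1, h2, outer_assoc, asc_tmul_one, outer_213]

theorem map_braid_right (t : U ⊗[k] (V ⊗[k] W)) :
    TensorProduct.map LinearMap.id (T.braidEquiv σ τ).toLinearMap t =
    outer ρ (outer τ σ) (perm132 k H (leg23 k H (T.R : H ⊗[k] H)))
      (TensorProduct.map LinearMap.id (TensorProduct.comm k V W).toLinearMap t) := by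
  rw [← outer_132]
  rw [leg23, Algebra.TensorProduct.includeRight_apply, outer_tmul, map_one,
    ← LinearMap.comp_apply (TensorProduct.map _ _), ← TensorProduct.map_comp]
  rfl

theorem hexagon₁ (t : (U ⊗[k] V) ⊗[k] W) :
    T.assocEquiv σ τ ρ (T.braidEquiv ρ (T.tensorAct σ τ) (T.assocEquiv ρ σ τ t)) =
    TensorProduct.map LinearMap.id (T.braidEquiv ρ τ).toLinearMap
      (T.assocEquiv σ ρ τ
        (TensorProduct.map (T.braidEquiv ρ σ).toLinearMap LinearMap.id t)) := by
  have h0 : ∀ t : (U ⊗[k] V) ⊗[k] W,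
      TensorProduct.assoc k V W U (TensorProduct.comm k U (V ⊗[k] W)
        (TensorProduct.assoc k U V W t)) =
      TensorProduct.map LinearMap.id (TensorProduct.comm k U W).toLinearMap
        (TensorProduct.leftComm k U V W (TensorProduct.assoc k U V W t)) := by
    intro s
    induction s with
    | zero => simp
    | add x y hx hy => simp only [map_add, hx, hy]
    | tmul s w =>
      induction s with
      | zero => simp
      | add x y hx hy => simp only [map_add, TensorProduct.add_tmul, hx, hy]
      | tmul v w => simp
  rw [assocEquiv_apply, assocEquiv_apply, assocEquiv_apply, braidEquiv_apply,
    outer_tensorAct_right, outer_312, outer_312, map_braid_left T ρ σ τ, map_braid_right T σ ρ τ,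
    outer_132, outer_132, h0]
  simp only [← Module.End.mul_apply, ← map_mul (outer σ (outer τ ρ))]
  congr 2
  rw [T.comul_right_R]
  simp only [map_mul, perm312_perm231, perm312_leg13, perm312_perm213, perm312_leg12]
  have h1 : perm312 k H (↑T.Φ⁻¹ : H ⊗[k] (H ⊗[k] H)) * perm312 k H (T.Φ : H ⊗[k] (H ⊗[k] H)) = 1 := by
    rw [← map_mul, Units.inv_mul, map_one]
  simp only [mul_assoc, h1, mul_one, Units.mul_inv_cancel_left]

theorem hexagon₂ (t : U ⊗[k] (V ⊗[k] W)) :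
    (T.assocEquiv τ ρ σ).symm
      (T.braidEquiv (T.tensorAct ρ σ) τ ((T.assocEquiv ρ σ τ).symm t)) =
    TensorProduct.map (T.braidEquiv ρ τ).toLinearMap LinearMap.id
      ((T.assocEquiv ρ τ σ).symm
        (TensorProduct.map LinearMap.id (T.braidEquiv σ τ).toLinearMap t)) := by
  have h0 : ∀ t : U ⊗[k] (V ⊗[k] W),
      TensorProduct.comm k (U ⊗[k] V) W ((TensorProduct.assoc k U V W).symm t) =
      TensorProduct.leftComm k U W V
        (TensorProduct.map LinearMap.id (TensorProduct.comm k V W).toLinearMap t) := by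
    intro s
    induction s with
    | zero => simp
    | add x y hx hy => simp only [map_add, hx, hy]
    | tmul u s =>
      induction s with
      | zero => simp
      | add x y hx hy => simp only [map_add, TensorProduct.tmul_add, hx, hy]
      | tmul v w => simp
  have h2 : ∀ (x : (H ⊗[k] H) ⊗[k] H) (s : U ⊗[k] (V ⊗[k] W)),
      outer (outer ρ σ) τ x ((TensorProduct.assoc k U V W).symm s) =
      (TensorProduct.assoc k U V W).symm (outer ρ (outer σ τ) (asc k H x) s) := by
    intro x s
    rw [LinearEquiv.eq_symm_apply, outer_assoc, LinearEquiv.apply_symm_apply]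
  apply (TensorProduct.assoc k W U V).injective
  rw [map_braid_left T ρ τ σ, assocEquiv_symm_apply, assocEquiv_symm_apply, assocEquiv_symm_apply,
    LinearEquiv.apply_symm_apply, LinearEquiv.apply_symm_apply, braidEquiv_apply,
    outer_tensorAct_left, h2, outer_231, outer_231, map_braid_right T ρ σ τ, outer_213, outer_213,
    h0]
  simp only [← Module.End.mul_apply, ← map_mul (outer τ (outer ρ σ))]
  congr 2
  rw [T.comul_left_R]
  simp only [map_mul, perm231_perm312, perm231_leg13, perm231_perm132, perm231_leg23]
  have h1 : perm231 k H (T.Φ : H ⊗[k] (H ⊗[k] H)) * perm231 k H (↑T.Φ⁻¹ : H ⊗[k] (H ⊗[k] H)) = 1 := by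
    rw [← map_mul, Units.mul_inv, map_one]
  simp only [mul_assoc, h1, mul_one, Units.inv_mul_cancel_left]

end Raw

end QTQuasiHopfAlgebra

/-! ### The category of finite dimensional left modules -/

namespace QTQuasiHopfAlgebra

variable {k : Type u} [Field k] {H : Type v} [Ring H] [Algebra k H]

/-- A finite dimensional left `H`-module: a finite dimensional `k`-space with an algebra map
`H → End_k(V)`. The structure `T` on `H` is recorded in the type since it determines the monoidal
structure, the duality and the braiding of the category of these modules. -/
structure FdMod (T : QTQuasiHopfAlgebra k H) where
  carrier : Type u
  [addCommGroup : AddCommGroup carrier]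
  [module : Module k carrier]
  [finite : FiniteDimensional k carrier]
  /-- the action of `H` -/
  act : H →ₐ[k] Module.End k carrier

namespace FdMod

attribute [instance] FdMod.addCommGroup FdMod.module FdMod.finite

variable {T : QTQuasiHopfAlgebra k H}

/-- `H`-linear maps. -/
@[ext] structure Hom (V W : FdMod T) where
  /-- the underlying `k`-linear map -/
  lin : V.carrier →ₗ[k] W.carrier
  map_act : ∀ (h : H) (v : V.carrier), lin (V.act h v) = W.act h (lin v)

instance : Category (FdMod T) where
  Hom V W := Hom V W
  id V := ⟨LinearMap.id, fun _ _ => rfl⟩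
  comp f g := ⟨g.lin ∘ₗ f.lin, fun h v => by simp [f.map_act, g.map_act]⟩

@[simp] theorem id_lin (V : FdMod T) : Hom.lin (𝟙 V) = LinearMap.id := rfl

@[simp] theorem comp_lin {U V W : FdMod T} (f : U ⟶ V) (g : V ⟶ W) :
    Hom.lin (f ≫ g) = Hom.lin g ∘ₗ Hom.lin f := rfl

theorem hom_ext {V W : FdMod T} {f g : V ⟶ W}
    (h : ∀ v : V.carrier, Hom.lin f v = Hom.lin g v) : f = g :=
  Hom.ext (LinearMap.ext h)

/-- An `H`-linear bijection is an isomorphism of modules. -/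
def mkIso {V W : FdMod T} (e : V.carrier ≃ₗ[k] W.carrier)
    (he : ∀ (h : H) (v : V.carrier), e (V.act h v) = W.act h (e v)) : V ≅ W where
  hom := ⟨e.toLinearMap, he⟩
  inv := ⟨e.symm.toLinearMap, fun h w => by
    apply e.injective
    simp [he]⟩
  hom_inv_id := hom_ext (fun v => e.symm_apply_apply v)
  inv_hom_id := hom_ext (fun v => e.apply_symm_apply v)

/-- The tensor product of modules. -/
def tensor (V W : FdMod T) : FdMod T where
  carrier := V.carrier ⊗[k] W.carrier
  act := T.tensorAct V.act W.act

/-- The unit object: `k` with the action through the counit. -/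
def unit (T : QTQuasiHopfAlgebra k H) : FdMod T where
  carrier := k
  act := T.unitAct

/-- The dual space, with the action `(h · f)(v) = f(S(h) · v)`. -/
def dual (V : FdMod T) : FdMod T where
  carrier := Module.Dual k V.carrier
  act := dualAct V.act T.S

/-- The tensor product of `H`-linear maps. -/
def tensorMap {U V U' V' : FdMod T} (f : Hom U U') (g : Hom V V') :
    Hom (tensor U V) (tensor U' V') where
  lin := TensorProduct.map f.lin g.lin
  map_act h t := outer_map_id U.act V.act U'.act V'.act f.lin g.lin f.map_act g.map_act
    (T.comul h) t

instance : MonoidalCategoryStruct (FdMod T) where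
  tensorObj := tensor
  whiskerLeft V _ _ f := tensorMap (𝟙 V : V ⟶ V) f
  whiskerRight f W := tensorMap f (𝟙 W : W ⟶ W)
  tensorHom f g := tensorMap f g
  tensorUnit := unit T
  associator U V W := mkIso (V := tensor (tensor U V) W) (W := tensor U (tensor V W))
    (T.assocEquiv U.act V.act W.act) (T.assocEquiv_act U.act V.act W.act)
  leftUnitor V := mkIso (V := tensor (unit T) V) (W := V)
    (TensorProduct.lid k V.carrier) (T.lid_act V.act)
  rightUnitor V := mkIso (V := tensor V (unit T)) (W := V)
    (TensorProduct.rid k V.carrier) (T.rid_act V.act)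

theorem tensorMap_comp {U V U' V' U'' V'' : FdMod T} (f : U ⟶ U') (g : V ⟶ V')
    (f' : U' ⟶ U'') (g' : V' ⟶ V'') :
    (tensorMap (f ≫ f') (g ≫ g') : Hom _ _) =
      ((tensorMap f g : tensor U V ⟶ tensor U' V') ≫
        (tensorMap f' g' : tensor U' V' ⟶ tensor U'' V'') : tensor U V ⟶ tensor U'' V'') :=
  Hom.ext (TensorProduct.map_comp (Hom.lin f') (Hom.lin g') (Hom.lin f) (Hom.lin g))

theorem tensorMap_id (U V : FdMod T) :
    (tensorMap (𝟙 U : U ⟶ U) (𝟙 V : V ⟶ V) : Hom _ _) = 𝟙 (tensor U V) :=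
  Hom.ext TensorProduct.map_id

/-- The monoidal category of finite dimensional `H`-modules, with associativity constraint
`(u ⊗ v) ⊗ w ↦ X¹ · u ⊗ (X² · v ⊗ X³ · w)`. -/
instance : MonoidalCategory (FdMod T) where
  tensorHom_def f g := by
    have h := tensorMap_comp f (𝟙 _) (𝟙 _) g
    rw [Category.comp_id, Category.id_comp] at h
    exact h
  id_tensorHom_id X Y := tensorMap_id X Y
  tensorHom_comp_tensorHom f₁ f₂ g₁ g₂ := (tensorMap_comp f₁ f₂ g₁ g₂).symm
  whiskerLeft_id X Y := tensorMap_id X Y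
  id_whiskerRight X Y := tensorMap_id X Y
  associator_naturality f₁ f₂ f₃ := hom_ext fun t =>
    T.assocEquiv_natural _ _ _ _ _ _ (Hom.lin f₁) (Hom.lin f₂) (Hom.lin f₃)
      (Hom.map_act f₁) (Hom.map_act f₂) (Hom.map_act f₃) t
  leftUnitor_naturality {X Y} f := Hom.ext (by
    apply TensorProduct.ext'
    intro (c : k) (v : X.carrier)
    exact (map_smul (Hom.lin f) c v).symm)
  rightUnitor_naturality {X Y} f := Hom.ext (by
    apply TensorProduct.ext'
    intro (v : X.carrier) (c : k)
    exact (map_smul (Hom.lin f) c v).symm)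
  pentagon W X Y Z := hom_ext fun t => T.assocEquiv_pentagon W.act X.act Y.act Z.act t
  triangle X Y := hom_ext fun t => T.assocEquiv_triangle X.act Y.act t

/-- The braiding `v ⊗ w ↦ R² · w ⊗ R¹ · v`. -/
instance : BraidedCategory (FdMod T) where
  braiding V W := mkIso (V := tensor V W) (W := tensor W V)
    (T.braidEquiv V.act W.act) (T.braidEquiv_act V.act W.act)
  braiding_naturality_right X Y Z f := hom_ext fun t =>
    T.braidEquiv_natural X.act Y.act X.act Z.act LinearMap.id (Hom.lin f) (fun _ _ => rfl)
      (Hom.map_act f) t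
  braiding_naturality_left {X Y} f Z := hom_ext fun t =>
    T.braidEquiv_natural X.act Z.act Y.act Z.act (Hom.lin f) LinearMap.id (Hom.map_act f)
      (fun _ _ => rfl) t
  hexagon_forward X Y Z := hom_ext fun t => T.hexagon₁ X.act Y.act Z.act t
  hexagon_reverse X Y Z := hom_ext fun t => T.hexagon₂ X.act Y.act Z.act t

/-- The dual space `V*` with evaluation `f ⊗ v ↦ f(α · v)` and coevaluation
`1 ↦ ∑ β · vᵢ ⊗ vⁱ`. -/
instance (V : FdMod T) : ExactPairing V (dual V) where
  evaluation' := ⟨T.evMap V.act, T.evMap_act V.act⟩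
  coevaluation' := ⟨T.coevMap V.act, T.coevMap_act V.act⟩
  coevaluation_evaluation' := hom_ext fun t => T.zag V.act t
  evaluation_coevaluation' := hom_ext fun t => T.zig V.act t

/-- Every module has a dual `V*`, with `V* ⊗ V → 𝟙` and `𝟙 → V ⊗ V*`. Such a dual is called a
*right* dual in Mathlib; it is called a *left* dual by many authors. -/
instance : RightRigidCategory (FdMod T) where
  rightDual V := { rightDual := dual V }

end FdMod

end QTQuasiHopfAlgebra

/-- A ribbon twist on a braided category with duals `(V*, ev : V* ⊗ V → 𝟙, coev : 𝟙 → V ⊗ V*)`: a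
natural automorphism `η` of the identity functor such that `η_{V ⊗ W} = (η_V ⊗ η_W) c_{W,V} c_{V,W}`
(compositions are written in diagrammatic order below) and `η_{V*} = (η_V)*`. -/
structure IsRibbonTwist {C : Type*} [Category C] [MonoidalCategory C] [BraidedCategory C]
    [RightRigidCategory C] (η : 𝟭 C ≅ 𝟭 C) : Prop where
  tensor : ∀ V W : C, η.hom.app (V ⊗ W) =
    (β_ V W).hom ≫ (β_ W V).hom ≫ ((η.hom.app V : V ⟶ V) ⊗ₘ (η.hom.app W : W ⟶ W))
  dual : ∀ V : C, η.hom.app (HasRightDual.rightDual V) = rightAdjointMate (η.hom.app V : V ⟶ V)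

end

/-!
Write `M = R₂₁R` for the monodromy element and `z = uS(u)`. The algebra `H(θ)` contains `H`
because it acts on `H ⊕ θH` (`incl_injective`). Its structure maps exist as soon as they respect
`θ² = z`, and every axiom, being multiplicative, need only be checked at `θ`. This comes down to
identities in `H`:

* `z` is invertible and central with `S(z) = z` and `ε(z) = 1` (`isUnit_zU`, `zU_central`, `S_zU`,
  `counit_zU`), which yields `S` and `ε` on `H(θ)`;
* `Δ(z) = (z ⊗ z) M⁻²` (`comul_zU`), which yields `Δ` on `H(θ)`;
* `(id ⊗ Δ)(M) M₂₃ = Φ (Δ ⊗ id)(M) M₁₂ Φ⁻¹` (`fullTwist_eq`), the coassociativity at `θ`;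
* `z S(m¹) α m² = α` and `z m¹ β S(m²) = β` for `M⁻¹ = m¹ ⊗ m²` (`zU_mul_leftMap_R21R_inv`,
  `zU_mul_rightMap_R21R_inv`), the antipode axioms at `θ`.

All of them come from the graphical calculus of the braided rigid category of modules, carried out
with elements of tensor powers of `H`. The main tool is `QuasiBialgebra.cap_factor`: the pentagon
axiom shows that a linear map on `B ⊗ A`, invariant under `Δ(H)`, factors through an evaluation of a
dual of `A`. Applied to the evaluation `S(R²) α R¹` obtained from the braiding, it gives
`S²(h) u = u h`, and with the zigzag identity `relZig_evR_coevR`, a consequence of the Yang–Baxter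
equation, it gives the invertibility of `u`, whence `S` is bijective and `z` is central. Computing
`S(M¹) α M² = z α` (`leftMap_R21R`) then shows that a monodromy under any cap acts by `z`
(`cap_mul_eq`).

The braidings `b₁` and `b₂` of neighbouring strands on `H ⊗ H ⊗ H` satisfy the braid relation. The
two expressions of the full twist on three strands give `fullTwist_eq`. Under the cap
`a ⊗ y ↦ Δ(S(a) α) y`, the monodromy of one strand around the other two becomes the action of `Δ(z)`
on strands 2 and 3, of `z` on strand 2, or of `z` on strand 3, for the first, second and third
strand respectively; as the full twist combines these monodromies, it also gives `comul_zU`.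
The statement for `β` follows as a coevaluation is determined by its zigzag with the evaluation
(`QuasiHopfAlgebra.eq_β_mul_zagMap`).

Finally `θ⁻¹` is a ribbon element, and a ribbon element always acts as a ribbon twist
(`QTQuasiHopfAlgebra.IsRibbonElement.isRibbonTwist`): the double braiding is the action of `R₂₁R`,
and the transpose is computed by comparing with the coevaluation.
-/

open QH

namespace QH

/-! ### Rings on tensor powers, and induction on tensors -/

section Instances

variable {k : Type u} [Field k] {H : Type v} [Ring H] [Algebra k H]

/-! Unassisted instance search fails to find the following instances on triple and fourfold tensor
powers, or finds them only slowly. -/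

noncomputable instance ring₃ : Ring (H ⊗[k] (H ⊗[k] H)) := Algebra.TensorProduct.instRing
noncomputable instance semiring₃ : Semiring (H ⊗[k] (H ⊗[k] H)) := ring₃.toSemiring
noncomputable instance distrib₃ : Distrib (H ⊗[k] (H ⊗[k] H)) := semiring₃.toDistrib
noncomputable instance monoid₃ : Monoid (H ⊗[k] (H ⊗[k] H)) :=
  semiring₃.toMonoidWithZero.toMonoid
noncomputable instance semigroup₃ : Semigroup (H ⊗[k] (H ⊗[k] H)) := monoid₃.toSemigroup
noncomputable instance ring₄ : Ring (H ⊗[k] (H ⊗[k] (H ⊗[k] H))) :=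
  Algebra.TensorProduct.instRing
noncomputable instance semiring₄ : Semiring (H ⊗[k] (H ⊗[k] (H ⊗[k] H))) := ring₄.toSemiring
noncomputable instance distrib₄ : Distrib (H ⊗[k] (H ⊗[k] (H ⊗[k] H))) := semiring₄.toDistrib
noncomputable instance monoid₄ : Monoid (H ⊗[k] (H ⊗[k] (H ⊗[k] H))) :=
  semiring₄.toMonoidWithZero.toMonoid
noncomputable instance semigroup₄ : Semigroup (H ⊗[k] (H ⊗[k] (H ⊗[k] H))) :=
  monoid₄.toSemigroup

end Instances

section Induction

variable {k : Type*} [Field k] {A B C D : Type*} [AddCommGroup A] [Module k A] [AddCommGroup B]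
  [Module k B] [AddCommGroup C] [Module k C] [AddCommGroup D] [Module k D]

theorem induction₂ {p : A ⊗[k] B → Prop} (add : ∀ x y, p x → p y → p (x + y))
    (tmul : ∀ a b, p (a ⊗ₜ b)) (x : A ⊗[k] B) : p x := by
  induction x with
  | zero => simpa using tmul 0 0
  | add x y hx hy => exact add x y hx hy
  | tmul a b => exact tmul a b

theorem induction₃ {p : A ⊗[k] (B ⊗[k] C) → Prop} (add : ∀ x y, p x → p y → p (x + y))
    (tmul : ∀ a b c, p (a ⊗ₜ (b ⊗ₜ c))) (x : A ⊗[k] (B ⊗[k] C)) : p x :=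
  induction₂ add (fun a y => induction₂ (p := fun y => p (a ⊗ₜ y))
    (fun x y hx hy => by rw [TensorProduct.tmul_add]; exact add _ _ hx hy) (tmul a) y) x

theorem induction₄ {p : A ⊗[k] (B ⊗[k] (C ⊗[k] D)) → Prop}
    (add : ∀ x y, p x → p y → p (x + y))
    (tmul : ∀ a b c d, p (a ⊗ₜ (b ⊗ₜ (c ⊗ₜ d)))) (x : A ⊗[k] (B ⊗[k] (C ⊗[k] D))) : p x :=
  induction₃ add (fun a b y => induction₂ (p := fun y => p (a ⊗ₜ (b ⊗ₜ y)))
    (fun x y hx hy => by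
      rw [TensorProduct.tmul_add, TensorProduct.tmul_add]; exact add _ _ hx hy) (tmul a b) y) x

end Induction

/-! ### Counits of the reassociator and of the R-matrix -/

section Counits

variable (k : Type u) [Field k] (H : Type v) [Ring H] [Algebra k H] (e : H →ₐ[k] k)

/-- `x ⊗ y ↦ e(x) y`. -/
abbrev eL {H' : Type v} [Ring H'] [Algebra k H'] : H ⊗[k] H' →ₐ[k] H' :=
  (Algebra.TensorProduct.lid k H' : k ⊗[k] H' →ₐ[k] H').comp
    (Algebra.TensorProduct.map e (AlgHom.id k H'))

/-- `x ⊗ y ↦ e(y) x`. -/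
abbrev eR {H' : Type v} [Ring H'] [Algebra k H'] : H' ⊗[k] H →ₐ[k] H' :=
  (Algebra.TensorProduct.rid k k H' : H' ⊗[k] k →ₐ[k] H').comp
    (Algebra.TensorProduct.map (AlgHom.id k H') e)

/-- `x ⊗ y ⊗ z ↦ e(y) x ⊗ z`. -/
abbrev eM {H' : Type v} [Ring H'] [Algebra k H'] : H ⊗[k] (H ⊗[k] H') →ₐ[k] H ⊗[k] H' :=
  Algebra.TensorProduct.map (AlgHom.id k H) (eL k H e)

/-- `x ⊗ y ⊗ z ↦ e(z) x ⊗ y`. -/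
abbrev eRR : H ⊗[k] (H ⊗[k] H) →ₐ[k] H ⊗[k] H :=
  Algebra.TensorProduct.map (AlgHom.id k H) (eR k H e)

variable {k H}
variable {H' : Type v} [Ring H'] [Algebra k H']

theorem eL_tmul (x : H) (y : H') : eL k H e (x ⊗ₜ[k] y) = e x • y := by simp
theorem eR_tmul (x : H) (y : H') : eR k H e (y ⊗ₜ[k] x) = e x • y := by simp
theorem eM_tmul (x y : H) (z : H') : eM k H e (x ⊗ₜ[k] (y ⊗ₜ[k] z)) = e y • x ⊗ₜ[k] z := by simp
theorem eRR_tmul (x y z : H) : eRR k H e (x ⊗ₜ[k] (y ⊗ₜ[k] z)) = e z • x ⊗ₜ[k] y := by simp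

end Counits

end QH

namespace QuasiBialgebra
variable {k : Type u} [Field k] {H : Type v} [Ring H] [Algebra k H] (B : QuasiBialgebra k H)

/-- `(ε ⊗ id ⊗ id)(Φ) = 1 ⊗ 1`. -/
theorem counit_left_Φ : eL k H B.counit (B.Φ : H ⊗[k] (H ⊗[k] H)) = 1 := by
  have h := congrArg (eM k H B.counit) B.cocycle
  rw [map_mul, map_mul, map_mul] at h
  have h1 : eM k H B.counit ((1 : H) ⊗ₜ[k] (B.Φ : H ⊗[k] (H ⊗[k] H))) =
      1 ⊗ₜ eL k H B.counit (B.Φ : H ⊗[k] (H ⊗[k] H)) := rfl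
  have h2 : ∀ x : H ⊗[k] (H ⊗[k] H), eM k H B.counit (Algebra.TensorProduct.map (AlgHom.id k H)
        ((asc k H : (H ⊗[k] H) ⊗[k] H →ₐ[k] H ⊗[k] (H ⊗[k] H)).comp
          (Algebra.TensorProduct.map B.comul (AlgHom.id k H))) x) = x := by
    refine induction₃ (fun x y hx hy => by rw [map_add, map_add, hx, hy]) fun a b c => ?_
    have : ∀ w : H ⊗[k] H, eL k H B.counit (asc k H (w ⊗ₜ c)) = eL k H B.counit w ⊗ₜ c :=
      induction₂ (fun x y hx hy => by
        rw [TensorProduct.add_tmul, map_add, map_add, map_add, hx, hy, TensorProduct.add_tmul])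
        fun a b => by simp [TensorProduct.smul_tmul']
    have h' := this (B.comul b)
    rw [show eL k H B.counit (B.comul b) = b from B.counit_left b] at h'
    exact congrArg (fun y => a ⊗ₜ[k] y) h'
  have h3 : ∀ x : H ⊗[k] (H ⊗[k] H), eM k H B.counit (Algebra.TensorProduct.map (AlgHom.id k H)
        (asc k H : (H ⊗[k] H) ⊗[k] H →ₐ[k] H ⊗[k] (H ⊗[k] H))
        (Algebra.TensorProduct.assoc k k k H (H ⊗[k] H) H (x ⊗ₜ[k] (1 : H)))) =
      leg12 k H (eM k H B.counit x) :=
    induction₃ (fun x y hx hy => by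
      rw [TensorProduct.add_tmul, map_add, map_add, map_add, map_add, map_add, hx, hy])
      fun a b c => by simp
  have h4 : ∀ x : H ⊗[k] (H ⊗[k] H), eM k H B.counit (Algebra.TensorProduct.map (AlgHom.id k H)
        (Algebra.TensorProduct.map (AlgHom.id k H) B.comul) x) =
      Algebra.TensorProduct.map (AlgHom.id k H) B.comul (eM k H B.counit x) :=
    induction₃ (fun x y hx hy => by simp only [map_add, hx, hy])
      fun a b c => by simp
  have h5 : ∀ x : H ⊗[k] (H ⊗[k] H), eM k H B.counit
      (Algebra.TensorProduct.assoc k k k H H (H ⊗[k] H)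
        (Algebra.TensorProduct.map B.comul (AlgHom.id k (H ⊗[k] H)) x)) = x := by
    refine induction₂ (fun x y hx hy => by rw [map_add, map_add, map_add, hx, hy]) fun a c => ?_
    have : ∀ w : H ⊗[k] H, eM k H B.counit
        (Algebra.TensorProduct.assoc k k k H H (H ⊗[k] H) (w ⊗ₜ c)) = eR k H B.counit w ⊗ₜ c :=
      induction₂ (fun x y hx hy => by
        rw [TensorProduct.add_tmul, map_add, map_add, map_add, hx, hy, TensorProduct.add_tmul])
        fun a b => by simp [TensorProduct.smul_tmul']
    have h' := this (B.comul a)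
    rw [show eR k H B.counit (B.comul a) = a from B.counit_right a] at h'
    exact h'
  have h6 : eM k H B.counit (B.Φ : H ⊗[k] (H ⊗[k] H)) = 1 := B.counit_Φ
  rw [h1, h2, h3, h4, h5, h6, map_one, map_one, mul_one, one_mul] at h
  replace h := (Units.mul_left_inj B.Φ).1 (h.trans (one_mul _).symm)
  have h7 := congrArg (eL k H B.counit) h
  rwa [eL_tmul, map_one, map_one, one_smul] at h7

/-- `(id ⊗ id ⊗ ε)(Φ) = 1 ⊗ 1`. -/
theorem counit_right_Φ : eRR k H B.counit (B.Φ : H ⊗[k] (H ⊗[k] H)) = 1 := by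
  set g : H ⊗[k] (H ⊗[k] (H ⊗[k] H)) →ₐ[k] H ⊗[k] (H ⊗[k] H) :=
    Algebra.TensorProduct.map (AlgHom.id k H) (eM k H B.counit) with hg
  have h := congrArg g B.cocycle
  rw [map_mul, map_mul, map_mul] at h
  have h1 : g ((1 : H) ⊗ₜ[k] (B.Φ : H ⊗[k] (H ⊗[k] H))) =
      1 ⊗ₜ eM k H B.counit (B.Φ : H ⊗[k] (H ⊗[k] H)) := rfl
  have h2 : ∀ x : H ⊗[k] (H ⊗[k] H), g (Algebra.TensorProduct.map (AlgHom.id k H)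
        ((asc k H : (H ⊗[k] H) ⊗[k] H →ₐ[k] H ⊗[k] (H ⊗[k] H)).comp
          (Algebra.TensorProduct.map B.comul (AlgHom.id k H))) x) = x := by
    refine induction₃ (fun x y hx hy => by rw [map_add, map_add, hx, hy]) fun a b c => ?_
    have : ∀ w : H ⊗[k] H, eM k H B.counit (asc k H (w ⊗ₜ c)) = eR k H B.counit w ⊗ₜ c :=
      induction₂ (fun x y hx hy => by
        rw [TensorProduct.add_tmul, map_add, map_add, map_add, hx, hy, TensorProduct.add_tmul])
        fun a b => by simp [TensorProduct.smul_tmul']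
    have h' := this (B.comul b)
    rw [show eR k H B.counit (B.comul b) = b from B.counit_right b] at h'
    exact congrArg (fun y => a ⊗ₜ[k] y) h'
  have h3 : ∀ x : H ⊗[k] (H ⊗[k] H), g (Algebra.TensorProduct.map (AlgHom.id k H)
        (asc k H : (H ⊗[k] H) ⊗[k] H →ₐ[k] H ⊗[k] (H ⊗[k] H))
        (Algebra.TensorProduct.assoc k k k H (H ⊗[k] H) H (x ⊗ₜ[k] (1 : H)))) =
      leg12 k H (eRR k H B.counit x) :=
    induction₃ (fun x y hx hy => by
      rw [TensorProduct.add_tmul, map_add, map_add, map_add, map_add, map_add, hx, hy])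
      fun a b c => by simp [hg]
  have h4 : ∀ x : H ⊗[k] (H ⊗[k] H), g (Algebra.TensorProduct.map (AlgHom.id k H)
        (Algebra.TensorProduct.map (AlgHom.id k H) B.comul) x) = x := by
    refine induction₃ (fun x y hx hy => by rw [map_add, map_add, hx, hy]) fun a b c => ?_
    have : eL k H B.counit (B.comul c) = c := B.counit_left c
    exact congrArg (fun y => a ⊗ₜ[k] (b ⊗ₜ[k] y)) this
  have h5 : ∀ x : H ⊗[k] (H ⊗[k] H), g
      (Algebra.TensorProduct.assoc k k k H H (H ⊗[k] H)
        (Algebra.TensorProduct.map B.comul (AlgHom.id k (H ⊗[k] H)) x)) =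
      asc k H (Algebra.TensorProduct.map B.comul (AlgHom.id k H) (eM k H B.counit x)) := by
    refine induction₃ (fun x y hx hy => by simp only [map_add, hx, hy]) fun a b c => ?_
    rw [eM_tmul, Algebra.TensorProduct.map_tmul, map_smul, map_smul,
      Algebra.TensorProduct.map_tmul]
    generalize B.comul a = w
    revert w
    exact induction₂ (fun x y hx hy => by
        rw [TensorProduct.add_tmul, map_add, map_add, TensorProduct.add_tmul, map_add, smul_add,
          hx, hy])
        fun x y => by simp [hg]
  have h6 : eM k H B.counit (B.Φ : H ⊗[k] (H ⊗[k] H)) = 1 := B.counit_Φ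
  rw [h1, h2, h3, h4, h5, h6, map_one, map_one, mul_one,
    ← Algebra.TensorProduct.one_def, one_mul] at h
  replace h := (Units.mul_right_inj B.Φ).1 (h.trans (mul_one _).symm)
  have h7 := congrArg (eRR k H B.counit) h
  rw [map_one] at h7
  rw [← h7]
  generalize eRR k H B.counit (B.Φ : H ⊗[k] (H ⊗[k] H)) = w
  revert w
  exact induction₂ (fun x y hx hy => by rw [map_add, map_add, ← hx, ← hy]) fun x y => by simp

end QuasiBialgebra

namespace QTQuasiHopfAlgebra
variable {k : Type u} [Field k] {H : Type v} [Ring H] [Algebra k H] (T : QTQuasiHopfAlgebra k H)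

theorem counit_left_R : eL k H T.counit (T.R : H ⊗[k] H) = 1 := by
  have h := congrArg (eL k H T.counit) T.comul_left_R
  simp only [map_mul] at h
  have h1 : ∀ x : H ⊗[k] H, eL k H T.counit
      (asc k H (Algebra.TensorProduct.map T.comul (AlgHom.id k H) x)) = x := by
    refine induction₂ (fun x y hx hy => by rw [map_add, map_add, map_add, hx, hy]) fun a b => ?_
    have : ∀ w : H ⊗[k] H, eL k H T.counit (asc k H (w ⊗ₜ b)) = eL k H T.counit w ⊗ₜ b :=
      induction₂ (fun x y hx hy => by
        rw [TensorProduct.add_tmul, map_add, map_add, map_add, hx, hy, TensorProduct.add_tmul])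
        fun a b => by simp [TensorProduct.smul_tmul']
    have h' := this (T.comul a)
    rw [show eL k H T.counit (T.comul a) = a from T.counit_left a] at h'
    exact h'
  have h2 : ∀ x : H ⊗[k] (H ⊗[k] H), eL k H T.counit (perm312 k H x) =
      flip₂ k H (eM k H T.counit x) :=
    induction₃ (fun x y hx hy => by simp only [map_add, hx, hy]) fun a b c => by simp
  have h3 : ∀ x : H ⊗[k] (H ⊗[k] H), eL k H T.counit (perm132 k H x) =
      flip₂ k H (eL k H T.counit x) :=
    induction₃ (fun x y hx hy => by simp only [map_add, hx, hy]) fun a b c => by simp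
  have h4 : ∀ x : H ⊗[k] H, eL k H T.counit (leg13 k H x) = 1 ⊗ₜ eL k H T.counit x :=
    induction₂ (fun x y hx hy => by simp only [map_add, hx, hy, TensorProduct.tmul_add])
      fun a b => by simp
  have h5 : ∀ x : H ⊗[k] H, eL k H T.counit (leg23 k H x) = x :=
    induction₂ (fun x y hx hy => by rw [map_add, map_add, hx, hy])
      fun a b => by simp
  have h6 : eL k H T.counit (↑T.Φ⁻¹ : H ⊗[k] (H ⊗[k] H)) = 1 := by
    have := congrArg (eL k H T.counit) T.Φ.mul_inv
    rwa [map_mul, T.counit_left_Φ, one_mul, map_one] at this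
  have h7 : eM k H T.counit (T.Φ : H ⊗[k] (H ⊗[k] H)) = 1 := T.counit_Φ
  rw [h1, h2, h3, h4, h5, h6, h7, T.counit_left_Φ, map_one, mul_one, mul_one, one_mul] at h
  have h8 := (Units.mul_left_inj T.R).1 (h.symm.trans (one_mul _).symm)
  have h9 := congrArg (eL k H T.counit) h8
  rwa [eL_tmul, map_one, map_one, one_smul] at h9

theorem counit_right_R : eR k H T.counit (T.R : H ⊗[k] H) = 1 := by
  have h := congrArg (eRR k H T.counit) T.comul_right_R
  simp only [map_mul] at h
  have h1 : ∀ x : H ⊗[k] H, eRR k H T.counit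
      (Algebra.TensorProduct.map (AlgHom.id k H) T.comul x) = x := by
    refine induction₂ (fun x y hx hy => by rw [map_add, map_add, hx, hy]) fun a b => ?_
    have : eR k H T.counit (T.comul b) = b := T.counit_right b
    exact congrArg (fun y => a ⊗ₜ[k] y) this
  have h2 : ∀ x : H ⊗[k] (H ⊗[k] H), eRR k H T.counit (perm231 k H x) =
      flip₂ k H (eM k H T.counit x) :=
    induction₃ (fun x y hx hy => by simp only [map_add, hx, hy]) fun a b c => by
      simp [TensorProduct.smul_tmul']
  have h3 : ∀ x : H ⊗[k] (H ⊗[k] H), eRR k H T.counit (perm213 k H x) =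
      flip₂ k H (eRR k H T.counit x) :=
    induction₃ (fun x y hx hy => by simp only [map_add, hx, hy]) fun a b c => by
      simp [TensorProduct.smul_tmul']
  have h4 : ∀ x : H ⊗[k] H, eRR k H T.counit (leg13 k H x) = eR k H T.counit x ⊗ₜ 1 :=
    induction₂ (fun x y hx hy => by simp only [map_add, hx, hy, TensorProduct.add_tmul])
      fun a b => by simp [TensorProduct.smul_tmul']
  have h5 : ∀ x : H ⊗[k] H, eRR k H T.counit (leg12 k H x) = x :=
    induction₂ (fun x y hx hy => by rw [map_add, map_add, hx, hy])
      fun a b => by simp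
  have h6 : eRR k H T.counit (↑T.Φ⁻¹ : H ⊗[k] (H ⊗[k] H)) = 1 := by
    have := congrArg (eRR k H T.counit) T.Φ.mul_inv
    rwa [map_mul, T.counit_right_Φ, one_mul, map_one] at this
  have h7 : eM k H T.counit (↑T.Φ⁻¹ : H ⊗[k] (H ⊗[k] H)) = 1 := by
    have := congrArg (eM k H T.counit) T.Φ.mul_inv
    rwa [map_mul, show eM k H T.counit (T.Φ : H ⊗[k] (H ⊗[k] H)) = 1 from T.counit_Φ, one_mul,
      map_one] at this
  rw [h1, h2, h3, h4, h5, h6, h7, T.counit_right_Φ, map_one, mul_one, mul_one, one_mul] at h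
  have h8 := (Units.mul_left_inj T.R).1 (h.symm.trans (one_mul _).symm)
  have h9 := congrArg (eR k H T.counit) h8
  rwa [eR_tmul, map_one, map_one, one_smul] at h9

end QTQuasiHopfAlgebra

namespace QH

/-! ### Dualities relative to an algebra map -/

section Relative

variable {k : Type u} [Field k] {H : Type v} [Ring H] [Algebra k H]
variable {A : Type*} [Ring A] [Algebra k A]

/-- An algebra anti-morphism `τ : H → A`, regarded as a `k`-linear map. -/
noncomputable def opLin (τ : H →ₐ[k] Aᵐᵒᵖ) : H →ₗ[k] A :=
  (MulOpposite.opLinearEquiv k).symm.toLinearMap ∘ₗ τ.toLinearMap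

@[simp] theorem opLin_apply (τ : H →ₐ[k] Aᵐᵒᵖ) (h : H) :
    opLin τ h = MulOpposite.unop (τ h) := rfl

/-- `x ⊗ y ↦ τ(x) c δ(y)`. -/
noncomputable def relLeft (τ : H →ₐ[k] Aᵐᵒᵖ) (c : A) (δ : H →ₐ[k] A) : H ⊗[k] H →ₗ[k] A :=
  LinearMap.mul' k A ∘ₗ
    TensorProduct.map (LinearMap.mulRight k c ∘ₗ opLin τ) δ.toLinearMap

@[simp] theorem relLeft_tmul (τ : H →ₐ[k] Aᵐᵒᵖ) (c : A) (δ : H →ₐ[k] A) (x y : H) :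
    relLeft τ c δ (x ⊗ₜ y) = MulOpposite.unop (τ x) * c * δ y := rfl

/-- `x ⊗ y ↦ δ(x) d τ(y)`. -/
noncomputable def relRight (δ : H →ₐ[k] A) (d : A) (τ : H →ₐ[k] Aᵐᵒᵖ) : H ⊗[k] H →ₗ[k] A :=
  LinearMap.mul' k A ∘ₗ
    TensorProduct.map (LinearMap.mulRight k d ∘ₗ δ.toLinearMap) (opLin τ)

@[simp] theorem relRight_tmul (δ : H →ₐ[k] A) (d : A) (τ : H →ₐ[k] Aᵐᵒᵖ) (x y : H) :
    relRight δ d τ (x ⊗ₜ y) = δ x * d * MulOpposite.unop (τ y) := rfl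

/-- `x ⊗ y ⊗ z ↦ δ(x) d τ(y) c δ(z)`. -/
noncomputable def relZig (δ : H →ₐ[k] A) (d : A) (τ : H →ₐ[k] Aᵐᵒᵖ) (c : A) :
    H ⊗[k] (H ⊗[k] H) →ₗ[k] A :=
  LinearMap.mul' k A ∘ₗ
    TensorProduct.map (LinearMap.mulRight k d ∘ₗ δ.toLinearMap) (relLeft τ c δ)

@[simp] theorem relZig_tmul (δ : H →ₐ[k] A) (d : A) (τ : H →ₐ[k] Aᵐᵒᵖ) (c : A) (x y z : H) :
    relZig δ d τ c (x ⊗ₜ (y ⊗ₜ z)) = δ x * d * (MulOpposite.unop (τ y) * c * δ z) := rfl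

end Relative

end QH

namespace QuasiBialgebra

variable {k : Type u} [Field k] {H : Type v} [Ring H] [Algebra k H] (Q : QuasiBialgebra k H)

section CapFactor

variable {A B Y : Type*} [Ring A] [Algebra k A] [Ring B] [Algebra k B] [AddCommGroup Y] [Module k Y]
  {δ : H →ₐ[k] A} {τ : H →ₐ[k] Aᵐᵒᵖ} {c d : A} (δB : H →ₐ[k] B)

/-- `x¹ ⊗ x² d τ(x³)` in `B ⊗ A`, where `H` maps to `B` by `δB` and to `A` by `δ`. -/
noncomputable def coevVec (δB : H →ₐ[k] B) (δ : H →ₐ[k] A) (d : A) (τ : H →ₐ[k] Aᵐᵒᵖ) : B ⊗[k] A :=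
  TensorProduct.map δB.toLinearMap (relRight δ d τ) (↑Q.Φ⁻¹ : H ⊗[k] (H ⊗[k] H))

theorem map_inv_mul_map {A' : Type*} [Ring A'] [Algebra k A']
    (f : H ⊗[k] (H ⊗[k] H) →ₐ[k] A') :
    f (↑Q.Φ⁻¹ : H ⊗[k] (H ⊗[k] H)) * f (Q.Φ : H ⊗[k] (H ⊗[k] H)) = 1 := by
  rw [← map_mul, Units.inv_mul, map_one]

theorem map_mul_map_inv {A' : Type*} [Ring A'] [Algebra k A']
    (f : H ⊗[k] (H ⊗[k] H) →ₐ[k] A') :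
    f (Q.Φ : H ⊗[k] (H ⊗[k] H)) * f (↑Q.Φ⁻¹ : H ⊗[k] (H ⊗[k] H)) = 1 := by
  rw [← map_mul, Units.mul_inv, map_one]

theorem map_inv_eq_one {A' : Type*} [Ring A'] [Algebra k A']
    (f : H ⊗[k] (H ⊗[k] H) →ₐ[k] A') (h : f (Q.Φ : H ⊗[k] (H ⊗[k] H)) = 1) :
    f (↑Q.Φ⁻¹ : H ⊗[k] (H ⊗[k] H)) = 1 := by
  simpa [h] using Q.map_mul_map_inv f

/-- `id ⊗ Δ ⊗ id`. -/
noncomputable abbrev cMid : H ⊗[k] (H ⊗[k] H) →ₐ[k] H ⊗[k] (H ⊗[k] (H ⊗[k] H)) :=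
  Algebra.TensorProduct.map (AlgHom.id k H)
        ((asc k H : (H ⊗[k] H) ⊗[k] H →ₐ[k] H ⊗[k] (H ⊗[k] H)).comp
          (Algebra.TensorProduct.map Q.comul (AlgHom.id k H)))

/-- `x ↦ x ⊗ 1`. -/
noncomputable abbrev cOne (k : Type u) [Field k] (H : Type v) [Ring H] [Algebra k H] :
    H ⊗[k] (H ⊗[k] H) →ₐ[k] H ⊗[k] (H ⊗[k] (H ⊗[k] H)) :=
  (Algebra.TensorProduct.map (AlgHom.id k H)
        (asc k H : (H ⊗[k] H) ⊗[k] H →ₐ[k] H ⊗[k] (H ⊗[k] H))).comp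
        ((Algebra.TensorProduct.assoc k k k H (H ⊗[k] H) H :
          (H ⊗[k] (H ⊗[k] H)) ⊗[k] H →ₐ[k] H ⊗[k] ((H ⊗[k] H) ⊗[k] H)).comp
          (Algebra.TensorProduct.includeLeft))

/-- `id ⊗ id ⊗ Δ`. -/
noncomputable abbrev cRight : H ⊗[k] (H ⊗[k] H) →ₐ[k] H ⊗[k] (H ⊗[k] (H ⊗[k] H)) :=
  Algebra.TensorProduct.map (AlgHom.id k H)
        (Algebra.TensorProduct.map (AlgHom.id k H) Q.comul)

/-- `Δ ⊗ id ⊗ id`. -/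
noncomputable abbrev cLeft : H ⊗[k] (H ⊗[k] H) →ₐ[k] H ⊗[k] (H ⊗[k] (H ⊗[k] H)) :=
  (Algebra.TensorProduct.assoc k k k H H (H ⊗[k] H) :
    (H ⊗[k] H) ⊗[k] (H ⊗[k] H) →ₐ[k] H ⊗[k] (H ⊗[k] (H ⊗[k] H))).comp
        (Algebra.TensorProduct.map Q.comul (AlgHom.id k (H ⊗[k] H)))

/-- The cocycle condition, in terms of the algebra maps above. -/
theorem cocycle' : (1 : H) ⊗ₜ[k] (Q.Φ : H ⊗[k] (H ⊗[k] H)) * Q.cMid (Q.Φ : H ⊗[k] (H ⊗[k] H)) *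
      cOne k H (Q.Φ : H ⊗[k] (H ⊗[k] H)) =
    Q.cRight (Q.Φ : H ⊗[k] (H ⊗[k] H)) * Q.cLeft (Q.Φ : H ⊗[k] (H ⊗[k] H)) := Q.cocycle

/-- `x ⊗ y ↦ x ⊗ y ⊗ 1 ⊗ 1`. -/
noncomputable abbrev emb12 (k : Type u) [Field k] (H : Type v) [Ring H] [Algebra k H] :
    H ⊗[k] H →ₐ[k] H ⊗[k] (H ⊗[k] (H ⊗[k] H)) :=
  Algebra.TensorProduct.map (AlgHom.id k H) Algebra.TensorProduct.includeLeft

/-- `x ⊗ y ↦ x ⊗ 1 ⊗ 1 ⊗ y`. -/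
noncomputable abbrev emb14 (k : Type u) [Field k] (H : Type v) [Ring H] [Algebra k H] :
    H ⊗[k] H →ₐ[k] H ⊗[k] (H ⊗[k] (H ⊗[k] H)) :=
  Algebra.TensorProduct.map (AlgHom.id k H)
    (Algebra.TensorProduct.includeRight.comp Algebra.TensorProduct.includeRight)

/-- `x ⊗ y ↦ 1 ⊗ 1 ⊗ x ⊗ y`. -/
noncomputable abbrev emb34 (k : Type u) [Field k] (H : Type v) [Ring H] [Algebra k H] :
    H ⊗[k] H →ₐ[k] H ⊗[k] (H ⊗[k] (H ⊗[k] H)) :=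
  Algebra.TensorProduct.includeRight.comp Algebra.TensorProduct.includeRight

theorem relLeft_mul (w : H ⊗[k] H) (x y : H) :
    relLeft τ c δ (w * (x ⊗ₜ y)) = MulOpposite.unop (τ x) * relLeft τ c δ w * δ y := by
  revert w
  exact induction₂ (fun a b ha hb => by rw [add_mul, map_add, map_add, ha, hb]; noncomm_ring)
    fun a b => by simp [mul_assoc]

theorem relRight_mul (w : H ⊗[k] H) (x y : H) :
    relRight δ d τ ((x ⊗ₜ y) * w) = δ x * relRight δ d τ w * MulOpposite.unop (τ y) := by
  revert w
  exact induction₂ (fun a b ha hb => by rw [mul_add, map_add, map_add, ha, hb]; noncomm_ring)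
    fun a b => by simp [mul_assoc]

variable (hc : ∀ h, relLeft τ c δ (Q.comul h) = Q.counit h • c)
  (hd : ∀ h, relRight δ d τ (Q.comul h) = Q.counit h • d)

include hc in
theorem zig_cRight (x : H ⊗[k] (H ⊗[k] H)) (s : H ⊗[k] (H ⊗[k] (H ⊗[k] H))) :
    TensorProduct.map δB.toLinearMap (relZig δ d τ c) (Q.cRight x * s) =
      TensorProduct.map δB.toLinearMap (relZig δ d τ c) (emb12 k H (eRR k H Q.counit x) * s) := by
  revert x
  refine induction₃ (fun x y hx hy => by simp only [map_add, add_mul, hx, hy]) fun x y z => ?_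
  revert s
  refine induction₄ (fun x y hx hy => by simp only [map_add, mul_add, hx, hy]) fun p q r s => ?_
  have h : ∀ w : H ⊗[k] H, relZig δ d τ c ((y ⊗ₜ w) * (q ⊗ₜ[k] (r ⊗ₜ[k] s))) =
      δ (y * q) * d * (MulOpposite.unop (τ r) * relLeft τ c δ w * δ s) := fun w => by
    rw [← relLeft_mul, Algebra.TensorProduct.tmul_mul_tmul]; rfl
  have h' := h (Q.comul z)
  rw [hc] at h'
  rw [eRR_tmul, TensorProduct.smul_tmul',
    show Q.cRight (x ⊗ₜ (y ⊗ₜ z)) = x ⊗ₜ (y ⊗ₜ Q.comul z) from rfl,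
    Algebra.TensorProduct.tmul_mul_tmul, TensorProduct.map_tmul, h']
  simp [mul_assoc, TensorProduct.smul_tmul']

include hd in
theorem zig_cMid (x : H ⊗[k] (H ⊗[k] H)) (s : H ⊗[k] (H ⊗[k] (H ⊗[k] H))) :
    TensorProduct.map δB.toLinearMap (relZig δ d τ c) (s * Q.cMid x) =
      TensorProduct.map δB.toLinearMap (relZig δ d τ c) (s * emb14 k H (eM k H Q.counit x)) := by
  revert x
  refine induction₃ (fun x y hx hy => by simp only [map_add, mul_add, hx, hy]) fun x y z => ?_
  revert s
  refine induction₄ (fun x y hx hy => by simp only [map_add, add_mul, hx, hy]) fun p q r s => ?_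
  have h : ∀ w : H ⊗[k] H, relZig δ d τ c ((q ⊗ₜ[k] (r ⊗ₜ[k] s)) * asc k H (w ⊗ₜ z)) =
      δ q * relRight δ d τ w * (MulOpposite.unop (τ r) * c * δ (s * z)) :=
    induction₂ (fun a b ha hb => by
      rw [TensorProduct.add_tmul, map_add, mul_add, map_add, map_add, ha, hb]; noncomm_ring)
      fun a b => by simp [mul_assoc]
  have h' := h (Q.comul y)
  rw [hd] at h'
  rw [eM_tmul, TensorProduct.smul_tmul',
    show Q.cMid (x ⊗ₜ (y ⊗ₜ z)) = x ⊗ₜ (asc k H (Q.comul y ⊗ₜ z)) from rfl,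
    Algebra.TensorProduct.tmul_mul_tmul, TensorProduct.map_tmul, h']
  simp [mul_assoc, TensorProduct.smul_tmul']

variable {E : B ⊗[k] A →ₗ[k] Y}
  (hE : ∀ h t, E (Algebra.TensorProduct.map δB δ (Q.comul h) * t) = Q.counit h • E t)

include hE in
theorem cap_cLeft (x : H ⊗[k] (H ⊗[k] H)) (s : H ⊗[k] (H ⊗[k] (H ⊗[k] H))) (t : B ⊗[k] A) :
    E (TensorProduct.map δB.toLinearMap (relZig δ d τ c) (Q.cLeft x * s) * t) =
      E (TensorProduct.map δB.toLinearMap (relZig δ d τ c)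
        (emb34 k H (eL k H Q.counit x) * s) * t) := by
  revert x
  refine induction₃ (fun x y hx hy => by simp only [map_add, add_mul, hx, hy]) fun x y z => ?_
  revert s
  refine induction₄ (fun x y hx hy => by simp only [map_add, mul_add, add_mul, hx, hy])
    fun p q r s => ?_
  have h : ∀ w : H ⊗[k] H, TensorProduct.map δB.toLinearMap (relZig δ d τ c)
        (Algebra.TensorProduct.assoc k k k H H (H ⊗[k] H) (w ⊗ₜ[k] (y ⊗ₜ[k] z)) *
        (p ⊗ₜ[k] (q ⊗ₜ[k] (r ⊗ₜ[k] s)))) =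
      Algebra.TensorProduct.map δB δ w *
        (δB p ⊗ₜ relZig δ d τ c (q ⊗ₜ[k] ((y * r) ⊗ₜ[k] (z * s)))) :=
    induction₂ (fun a b ha hb => by
      rw [TensorProduct.add_tmul, map_add, add_mul, map_add, map_add, ha, hb, add_mul])
      fun a b => by simp [mul_assoc]
  have h' := h (Q.comul x)
  rw [eL_tmul, TensorProduct.smul_tmul']
  change E (TensorProduct.map δB.toLinearMap (relZig δ d τ c)
        (Algebra.TensorProduct.assoc k k k H H (H ⊗[k] H) (Q.comul x ⊗ₜ[k] (y ⊗ₜ[k] z)) *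
        (p ⊗ₜ[k] (q ⊗ₜ[k] (r ⊗ₜ[k] s)))) * t) = _
  rw [h', mul_assoc, hE]
  simp

include hE hc hd in
/-- An invariant map `E` on `B ⊗ A` factors through the evaluation `c` of the relative antipode
`(τ, c, d)`: this is the pentagon axiom, applied to the `(B, A, A*, A)`-strands. -/
theorem cap_factor (hz : relZig δ d τ c (Q.Φ : H ⊗[k] (H ⊗[k] H)) = 1) (t : B ⊗[k] A) :
    E (Q.coevVec δB δ d τ * ((1 ⊗ₜ c) * t)) = E t := by
  set V := TensorProduct.map δB.toLinearMap (relZig δ d τ c) with hV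
  have hOne : ∀ x : H ⊗[k] (H ⊗[k] H), V (cOne k H x) =
      TensorProduct.map δB.toLinearMap (relRight δ d τ) x * (1 ⊗ₜ c) :=
    induction₃ (fun x y hx hy => by simp only [map_add, add_mul, hx, hy])
      fun x y z => by simp [hV, mul_assoc]
  have hco : Q.cLeft (Q.Φ : H ⊗[k] (H ⊗[k] H)) * cOne k H (↑Q.Φ⁻¹ : H ⊗[k] (H ⊗[k] H)) =
      Q.cRight (↑Q.Φ⁻¹ : H ⊗[k] (H ⊗[k] H)) * ((1 : H) ⊗ₜ[k] (Q.Φ : H ⊗[k] (H ⊗[k] H)) *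
        Q.cMid (Q.Φ : H ⊗[k] (H ⊗[k] H))) := by
    calc _ = Q.cRight (↑Q.Φ⁻¹ : H ⊗[k] (H ⊗[k] H)) * (Q.cRight (Q.Φ : H ⊗[k] (H ⊗[k] H)) *
        Q.cLeft (Q.Φ : H ⊗[k] (H ⊗[k] H))) * cOne k H (↑Q.Φ⁻¹ : H ⊗[k] (H ⊗[k] H)) := by
          rw [← mul_assoc, Q.map_inv_mul_map, one_mul]
      _ = _ := by
          rw [← Q.cocycle', mul_assoc, mul_assoc _ (cOne k H _), Q.map_mul_map_inv, mul_one]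
  have h := Q.cap_cLeft (τ := τ) (c := c) (d := d) δB hE (Q.Φ : H ⊗[k] (H ⊗[k] H))
    (cOne k H (↑Q.Φ⁻¹ : H ⊗[k] (H ⊗[k] H))) t
  rw [Q.counit_left_Φ, map_one, one_mul, hco, Q.zig_cRight δB hc,
    Q.map_inv_eq_one (eRR k H Q.counit) Q.counit_right_Φ, map_one, one_mul, Q.zig_cMid δB hd,
    show eM k H Q.counit (Q.Φ : H ⊗[k] (H ⊗[k] H)) = 1 from Q.counit_Φ, map_one, mul_one, ← hV,
    hOne, TensorProduct.map_tmul, hz, mul_assoc, AlgHom.toLinearMap_apply] at h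
  rw [coevVec, ← h, map_one, ← Algebra.TensorProduct.one_def, one_mul]

include hd in
theorem coevVec_mul (h : H) (s : H ⊗[k] (H ⊗[k] H)) :
    TensorProduct.map δB.toLinearMap (relRight δ d τ)
      (s * Algebra.TensorProduct.map (AlgHom.id k H) Q.comul (Q.comul h)) =
    TensorProduct.map δB.toLinearMap (relRight δ d τ) s * (δB h ⊗ₜ 1) := by
  have h1 : ∀ w : H ⊗[k] H, TensorProduct.map δB.toLinearMap (relRight δ d τ)
      (s * Algebra.TensorProduct.map (AlgHom.id k H) Q.comul w) =
    TensorProduct.map δB.toLinearMap (relRight δ d τ) s * (δB (eR k H Q.counit w) ⊗ₜ 1) := by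
    refine induction₂ (fun a b ha hb => by
      rw [map_add, mul_add, map_add, ha, hb, map_add, map_add, TensorProduct.add_tmul, mul_add])
      fun a b => ?_
    revert s
    refine induction₃ (fun x y hx hy => by simp only [map_add, add_mul, hx, hy]) fun x y z => ?_
    have h' := relRight_mul (δ := δ) (τ := τ) (d := d) (Q.comul b) y z
    rw [hd] at h'
    rw [Algebra.TensorProduct.map_tmul, Algebra.TensorProduct.tmul_mul_tmul,
      TensorProduct.map_tmul, h', eR_tmul]
    simp [mul_assoc, TensorProduct.smul_tmul']
  rw [h1, show eR k H Q.counit (Q.comul h) = h from Q.counit_right h]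

include hE in
theorem cap_coevVec_mul (h : H) (s : H ⊗[k] (H ⊗[k] H)) (t : B ⊗[k] A) :
    E (TensorProduct.map δB.toLinearMap (relRight δ d τ)
      (asc k H (Algebra.TensorProduct.map Q.comul (AlgHom.id k H) (Q.comul h)) * s) * t) =
    E (TensorProduct.map δB.toLinearMap (relRight δ d τ) s *
      ((1 ⊗ₜ MulOpposite.unop (τ h)) * t)) := by
  have h1 : ∀ w : H ⊗[k] H, E (TensorProduct.map δB.toLinearMap (relRight δ d τ)
      (asc k H (Algebra.TensorProduct.map Q.comul (AlgHom.id k H) w) * s) * t) =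
    E (TensorProduct.map δB.toLinearMap (relRight δ d τ) s *
      ((1 ⊗ₜ MulOpposite.unop (τ (eL k H Q.counit w))) * t)) := by
    refine induction₂ (fun a b ha hb => by
      rw [map_add, map_add, add_mul, map_add, add_mul, map_add, ha, hb, map_add, map_add,
        MulOpposite.unop_add, TensorProduct.tmul_add, add_mul, mul_add, map_add])
      fun a b => ?_
    revert s
    refine induction₃ (fun x y hx hy => by simp only [map_add, mul_add, add_mul, hx, hy])
      fun x y z => ?_
    have h' : ∀ w : H ⊗[k] H, TensorProduct.map δB.toLinearMap (relRight δ d τ)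
        (asc k H (w ⊗ₜ b) * (x ⊗ₜ[k] (y ⊗ₜ[k] z))) =
      Algebra.TensorProduct.map δB δ w * (δB x ⊗ₜ relRight δ d τ (y ⊗ₜ (b * z))) :=
      induction₂ (fun a b ha hb => by
        rw [TensorProduct.add_tmul, map_add, add_mul, map_add, map_add, ha, hb, add_mul])
        fun a b => by simp [mul_assoc]
    rw [Algebra.TensorProduct.map_tmul, AlgHom.id_apply, h', mul_assoc, hE, eL_tmul]
    simp only [map_smul, MulOpposite.unop_smul, TensorProduct.tmul_smul, smul_mul_assoc,
      mul_smul_comm]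
    rw [← mul_assoc]
    simp [mul_assoc]
  rw [h1, show eL k H Q.counit (Q.comul h) = h from Q.counit_left h]

include hE hd in
/-- The factorization of `cap_factor` turns the action of `H` on `B` into the action of `H` on the
dual of `A`. -/
theorem cap_coevVec (h : H) (t : B ⊗[k] A) :
    E (Q.coevVec δB δ d τ * ((δB h ⊗ₜ 1) * t)) =
      E (Q.coevVec δB δ d τ * ((1 ⊗ₜ MulOpposite.unop (τ h)) * t)) := by
  have h1 : asc k H (Algebra.TensorProduct.map Q.comul (AlgHom.id k H) (Q.comul h)) *
      (↑Q.Φ⁻¹ : H ⊗[k] (H ⊗[k] H)) = (↑Q.Φ⁻¹ : H ⊗[k] (H ⊗[k] H)) *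
      Algebra.TensorProduct.map (AlgHom.id k H) Q.comul (Q.comul h) := by
    rw [Q.quasi_coassoc, ← mul_assoc, ← mul_assoc, Units.inv_mul, one_mul]
  rw [coevVec, ← mul_assoc, ← Q.coevVec_mul δB hd, ← h1, Q.cap_coevVec_mul δB hE]

end CapFactor

end QuasiBialgebra

/-! ### Uniqueness of the coevaluation -/

namespace QuasiHopfAlgebra

variable {k : Type u} [Field k] {H : Type v} [Ring H] [Algebra k H] (Q : QuasiHopfAlgebra k H)

open QuasiBialgebra

theorem leftMap_mul (S : H →ₐ[k] Hᵐᵒᵖ) (a : H) (w : H ⊗[k] H) (x y : H) :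
    leftMap S a (w * (x ⊗ₜ y)) = MulOpposite.unop (S x) * leftMap S a w * y := by
  revert w
  exact induction₂ (fun a b ha hb => by rw [add_mul, map_add, map_add, ha, hb]; noncomm_ring)
    fun a b => by simp [mul_assoc]

theorem rightMap_mul (S : H →ₐ[k] Hᵐᵒᵖ) (b : H) (w : H ⊗[k] H) (x y : H) :
    rightMap S b ((x ⊗ₜ y) * w) = x * rightMap S b w * MulOpposite.unop (S y) := by
  revert w
  exact induction₂ (fun a b ha hb => by rw [mul_add, map_add, map_add, ha, hb]; noncomm_ring)
    fun a b => by simp [mul_assoc]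

/-- A coevaluation `g` is `β` multiplied by the zigzag of `ev` with `g`: apply
`p ⊗ q ⊗ r ⊗ s ↦ p β S(q) α r g S(s)` to the pentagon axiom. -/
theorem eq_β_mul_zagMap (g : H) (hg : ∀ h, rightMap Q.S g (Q.comul h) = Q.counit h • g) :
    g = Q.β * zagMap Q.S Q.α g (↑Q.Φ⁻¹ : H ⊗[k] (H ⊗[k] H)) := by
  set W : H ⊗[k] (H ⊗[k] (H ⊗[k] H)) →ₗ[k] H :=
    LinearMap.mul' k H ∘ₗ TensorProduct.map (LinearMap.mulRight k Q.β) (zagMap Q.S Q.α g) with hW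
  have hWt : ∀ x y z w : H, W (x ⊗ₜ (y ⊗ₜ (z ⊗ₜ w))) = x * Q.β * (MulOpposite.unop (Q.S y) *
      Q.α * (z * g * MulOpposite.unop (Q.S w))) := fun _ _ _ _ => rfl
  have hW' : ∀ x y, W (x ⊗ₜ y) = x * Q.β * zagMap Q.S Q.α g y := fun _ _ => rfl
  have hZ : ∀ x y, zagMap Q.S Q.α g (x ⊗ₜ y) = MulOpposite.unop (Q.S x) * Q.α *
    rightMap Q.S g y := fun _ _ => rfl
  have hOne : ∀ x : H ⊗[k] (H ⊗[k] H), W (cOne k H x) = zigMap Q.S Q.α Q.β x * g :=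
    induction₃ (fun x y hx hy => by simp only [map_add, add_mul, hx, hy])
      fun x y z => by simp [hWt, mul_assoc]
  have hMid : ∀ (x : H ⊗[k] (H ⊗[k] H)) (s : H ⊗[k] (H ⊗[k] (H ⊗[k] H))),
      W (Q.cMid x * s) = W (emb14 k H (eM k H Q.counit x) * s) := by
    intro x s
    revert x
    refine induction₃ (fun x y hx hy => by simp only [map_add, add_mul, hx, hy]) fun x y z => ?_
    revert s
    refine induction₄ (fun x y hx hy => by simp only [map_add, mul_add, hx, hy])
      fun p q r s => ?_
    have h : ∀ w : H ⊗[k] H, zagMap Q.S Q.α g (asc k H (w ⊗ₜ z) * (q ⊗ₜ[k] (r ⊗ₜ[k] s))) =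
        MulOpposite.unop (Q.S q) * leftMap Q.S Q.α w * (r * g * MulOpposite.unop (Q.S (z * s))) :=
      induction₂ (fun a b ha hb => by
        rw [TensorProduct.add_tmul, map_add, add_mul, map_add, map_add, ha, hb]; noncomm_ring)
        fun a b => by simp [mul_assoc]
    have h' := h (Q.comul y)
    rw [Q.antipode_left] at h'
    rw [eM_tmul, TensorProduct.smul_tmul',
      show Q.cMid (x ⊗ₜ (y ⊗ₜ z)) = x ⊗ₜ (asc k H (Q.comul y ⊗ₜ z)) from rfl,
      Algebra.TensorProduct.tmul_mul_tmul, hW', h']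
    simp [mul_assoc, hWt]
  have hRight : ∀ (x : H ⊗[k] (H ⊗[k] H)) (s : H ⊗[k] (H ⊗[k] (H ⊗[k] H))),
      W (s * Q.cRight x) = W (s * emb12 k H (eRR k H Q.counit x)) := by
    intro x s
    revert x
    refine induction₃ (fun x y hx hy => by simp only [map_add, mul_add, hx, hy]) fun x y z => ?_
    revert s
    refine induction₄ (fun x y hx hy => by simp only [map_add, add_mul, hx, hy])
      fun p q r s => ?_
    have h' := rightMap_mul Q.S g (Q.comul z) r s
    rw [hg] at h'
    rw [eRR_tmul, TensorProduct.smul_tmul',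
      show Q.cRight (x ⊗ₜ (y ⊗ₜ z)) = x ⊗ₜ (y ⊗ₜ Q.comul z) from rfl,
      Algebra.TensorProduct.tmul_mul_tmul, hW', Algebra.TensorProduct.tmul_mul_tmul, hZ, h']
    simp [mul_assoc, hWt]
  have hLeft : ∀ (x : H ⊗[k] (H ⊗[k] H)) (s : H ⊗[k] (H ⊗[k] (H ⊗[k] H))),
      W (s * Q.cLeft x) = W (s * emb34 k H (eL k H Q.counit x)) := by
    intro x s
    revert x
    refine induction₃ (fun x y hx hy => by simp only [map_add, mul_add, hx, hy]) fun x y z => ?_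
    revert s
    refine induction₄ (fun x y hx hy => by simp only [map_add, add_mul, hx, hy])
      fun p q r s => ?_
    have h : ∀ w : H ⊗[k] H, W ((p ⊗ₜ[k] (q ⊗ₜ[k] (r ⊗ₜ[k] s))) *
        Algebra.TensorProduct.assoc k k k H H (H ⊗[k] H) (w ⊗ₜ[k] (y ⊗ₜ[k] z))) =
        p * rightMap Q.S Q.β w * (MulOpposite.unop (Q.S q) * Q.α *
          (r * y * g * MulOpposite.unop (Q.S (s * z)))) :=
      induction₂ (fun a b ha hb => by
        rw [TensorProduct.add_tmul, map_add, mul_add, map_add, map_add, ha, hb]; noncomm_ring)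
        fun a b => by simp [mul_assoc, hWt]
    have h' := h (Q.comul x)
    rw [Q.antipode_right] at h'
    rw [eL_tmul, TensorProduct.smul_tmul']
    change W ((p ⊗ₜ[k] (q ⊗ₜ[k] (r ⊗ₜ[k] s))) *
        Algebra.TensorProduct.assoc k k k H H (H ⊗[k] H) (Q.comul x ⊗ₜ[k] (y ⊗ₜ[k] z))) = _
    rw [h']
    simp [mul_assoc, hWt]
  have hco : Q.cMid (Q.Φ : H ⊗[k] (H ⊗[k] H)) * (cOne k H (Q.Φ : H ⊗[k] (H ⊗[k] H)) *
      Q.cLeft (↑Q.Φ⁻¹ : H ⊗[k] (H ⊗[k] H))) =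
      (1 : H) ⊗ₜ[k] (↑Q.Φ⁻¹ : H ⊗[k] (H ⊗[k] H)) * Q.cRight (Q.Φ : H ⊗[k] (H ⊗[k] H)) := by
    have h1 : (1 : H) ⊗ₜ[k] (↑Q.Φ⁻¹ : H ⊗[k] (H ⊗[k] H)) *
        (1 : H) ⊗ₜ[k] (Q.Φ : H ⊗[k] (H ⊗[k] H)) = 1 := by
      simp [Algebra.TensorProduct.one_def]
    calc _ = (1 : H) ⊗ₜ[k] (↑Q.Φ⁻¹ : H ⊗[k] (H ⊗[k] H)) *
        ((1 : H) ⊗ₜ[k] (Q.Φ : H ⊗[k] (H ⊗[k] H)) * Q.cMid (Q.Φ : H ⊗[k] (H ⊗[k] H)) *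
        cOne k H (Q.Φ : H ⊗[k] (H ⊗[k] H))) * Q.cLeft (↑Q.Φ⁻¹ : H ⊗[k] (H ⊗[k] H)) := by
          rw [← mul_assoc, ← mul_assoc, ← mul_assoc, h1, one_mul, mul_assoc]
      _ = _ := by
          rw [Q.cocycle', mul_assoc, mul_assoc, Q.map_mul_map_inv Q.cLeft, mul_one]
  have h := hMid (Q.Φ : H ⊗[k] (H ⊗[k] H)) (cOne k H (Q.Φ : H ⊗[k] (H ⊗[k] H)) *
      Q.cLeft (↑Q.Φ⁻¹ : H ⊗[k] (H ⊗[k] H)))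
  rw [show eM k H Q.counit (Q.Φ : H ⊗[k] (H ⊗[k] H)) = 1 from Q.counit_Φ, map_one, one_mul,
    hco, hRight, Q.counit_right_Φ, map_one, mul_one, hLeft,
    Q.map_inv_eq_one (eL k H Q.counit) Q.counit_left_Φ, map_one, mul_one, hOne, Q.antipode_Φ,
    one_mul, hW', one_mul] at h
  exact h.symm

end QuasiHopfAlgebra

/-! ### Invariant maps as caps -/

namespace QuasiHopfAlgebra

variable {k : Type u} [Field k] {H : Type v} [Ring H] [Algebra k H] (Q : QuasiHopfAlgebra k H)

open QuasiBialgebra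

theorem leftMap_comul_mul (h : H) (t : H ⊗[k] H) :
    leftMap Q.S Q.α (Q.comul h * t) = Q.counit h • leftMap Q.S Q.α t := by
  revert t
  refine induction₂ (fun a b ha hb => by rw [mul_add, map_add, map_add, ha, hb, smul_add])
    fun a b => ?_
  rw [leftMap_mul, Q.antipode_left, leftMap_tmul]
  simp

theorem rightMap_mul_comul (h : H) (t : H ⊗[k] H) :
    rightMap Q.S Q.β (t * Q.comul h) = Q.counit h • rightMap Q.S Q.β t := by
  revert t
  refine induction₂ (fun a b ha hb => by rw [add_mul, map_add, map_add, ha, hb, smul_add])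
    fun a b => ?_
  rw [rightMap_mul, Q.antipode_right, rightMap_tmul]
  simp

theorem zagMap_comul_mul (w : H ⊗[k] H) (t : H ⊗[k] (H ⊗[k] H)) :
    zagMap Q.S Q.α Q.β (asc k H (Algebra.TensorProduct.map Q.comul (AlgHom.id k H) w) * t) =
      zagMap Q.S Q.α Q.β (1 ⊗ₜ (1 ⊗ₜ eL k H Q.counit w) * t) := by
  revert w
  refine induction₂ (fun a b ha hb => by
    simp only [map_add, add_mul, ha, hb, TensorProduct.tmul_add]) fun a b => ?_
  revert t
  refine induction₃ (fun x y hx hy => by simp only [map_add, mul_add, hx, hy]) fun x y z => ?_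
  have h : ∀ w : H ⊗[k] H, zagMap Q.S Q.α Q.β (asc k H (w ⊗ₜ b) * (x ⊗ₜ[k] (y ⊗ₜ[k] z))) =
      MulOpposite.unop (Q.S x) * leftMap Q.S Q.α w * (y * Q.β * MulOpposite.unop (Q.S (b * z))) :=
    induction₂ (fun a b ha hb => by
      rw [TensorProduct.add_tmul, map_add, add_mul, map_add, map_add, ha, hb]; noncomm_ring)
      fun a b => by simp [mul_assoc]
  rw [Algebra.TensorProduct.map_tmul, AlgHom.id_apply, h, Q.antipode_left, eL_tmul]
  simp [mul_assoc]

theorem zagMap_mul_comul (w : H ⊗[k] H) (t : H ⊗[k] (H ⊗[k] H)) :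
    zagMap Q.S Q.α Q.β (t * Algebra.TensorProduct.map (AlgHom.id k H) Q.comul w) =
      zagMap Q.S Q.α Q.β (t * (eR k H Q.counit w ⊗ₜ 1)) := by
  revert w
  refine induction₂ (fun a b ha hb => by
    simp only [map_add, mul_add, ha, hb, TensorProduct.add_tmul]) fun a b => ?_
  revert t
  refine induction₃ (fun x y hx hy => by simp only [map_add, add_mul, hx, hy]) fun x y z => ?_
  have hZ : ∀ x y, zagMap Q.S Q.α Q.β (x ⊗ₜ y) = MulOpposite.unop (Q.S x) * Q.α *
    rightMap Q.S Q.β y := fun _ _ => rfl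
  rw [Algebra.TensorProduct.map_tmul, AlgHom.id_apply, Algebra.TensorProduct.tmul_mul_tmul, hZ,
    rightMap_mul, Q.antipode_right, eR_tmul]
  simp [mul_assoc]

section Relative

variable {A : Type*} [Ring A] [Algebra k A] (δ : H →ₐ[k] A)

/-- The anti-morphism `δ ∘ S : H → A`. -/
abbrev relS : H →ₐ[k] Aᵐᵒᵖ := (AlgHom.op δ).comp Q.S

theorem relLeft_relS (w : H ⊗[k] H) :
    relLeft (Q.relS δ) (δ Q.α) δ w = δ (leftMap Q.S Q.α w) := by
  revert w
  exact induction₂ (fun a b ha hb => by simp only [map_add, ha, hb]) fun a b => by simp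

theorem relRight_relS (w : H ⊗[k] H) :
    relRight δ (δ Q.β) (Q.relS δ) w = δ (rightMap Q.S Q.β w) := by
  revert w
  exact induction₂ (fun a b ha hb => by simp only [map_add, ha, hb]) fun a b => by simp

theorem relZig_relS (w : H ⊗[k] (H ⊗[k] H)) :
    relZig δ (δ Q.β) (Q.relS δ) (δ Q.α) w = δ (zigMap Q.S Q.α Q.β w) := by
  revert w
  exact induction₃ (fun a b ha hb => by simp only [map_add, ha, hb]) fun a b c => by simp

variable {B Y : Type*} [Ring B] [Algebra k B] [AddCommGroup Y] [Module k Y] (δB : H →ₐ[k] B)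

/-- `x¹ ⊗ x² β S(x³)`, in `B ⊗ A`. -/
noncomputable abbrev stdVec : B ⊗[k] A := Q.coevVec δB δ (δ Q.β) (Q.relS δ)

variable {E : B ⊗[k] A →ₗ[k] Y}
  (hE : ∀ h t, E (Algebra.TensorProduct.map δB δ (Q.comul h) * t) = Q.counit h • E t)

include hE in
theorem cap_stdVec (t : B ⊗[k] A) : E (Q.stdVec δ δB * ((1 ⊗ₜ δ Q.α) * t)) = E t :=
  Q.cap_factor δB (fun h => by rw [relLeft_relS, Q.antipode_left, map_smul])
    (fun h => by rw [relRight_relS, Q.antipode_right, map_smul]) hE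
    (by rw [relZig_relS, Q.antipode_Φ, map_one]) t

include hE in
theorem cap_stdVec_slide (h : H) (t : B ⊗[k] A) :
    E (Q.stdVec δ δB * ((δB h ⊗ₜ 1) * t)) =
      E (Q.stdVec δ δB * ((1 ⊗ₜ δ (MulOpposite.unop (Q.S h))) * t)) :=
  Q.cap_coevVec δB (fun h => by rw [relRight_relS, Q.antipode_right, map_smul]) hE h t

include hE in
/-- Precomposing an invariant map with `w ∈ H ⊗ H` amounts to acting by any `z` with
`S(w¹) α w² = z α`. -/
theorem cap_mul_eq (w : H ⊗[k] H) (z : H) (hw : leftMap Q.S Q.α w = z * Q.α)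
    (hz : ∀ h, z * h = h * z) (t : B ⊗[k] A) :
    E (Algebra.TensorProduct.map δB δ w * t) = E ((1 ⊗ₜ δ z) * t) := by
  have h1 : ∀ w : H ⊗[k] H, E (Algebra.TensorProduct.map δB δ w * t) =
      E (Q.stdVec δ δB * ((1 ⊗ₜ δ (leftMap Q.S Q.α w)) * t)) := by
    refine induction₂ (fun a b ha hb => by
      rw [map_add, add_mul, map_add, ha, hb, map_add, map_add, TensorProduct.tmul_add, add_mul,
        mul_add, map_add]) fun a b => ?_
    have h2 : (1 ⊗ₜ δ Q.α) * (Algebra.TensorProduct.map δB δ (a ⊗ₜ[k] b) * t) =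
        (δB a ⊗ₜ 1) * ((1 ⊗ₜ δ (Q.α * b)) * t) := by
      simp [← mul_assoc]
    rw [← Q.cap_stdVec δ δB hE (Algebra.TensorProduct.map δB δ (a ⊗ₜ[k] b) * t), h2,
      Q.cap_stdVec_slide δ δB hE, leftMap_tmul, ← mul_assoc (1 ⊗ₜ _) (1 ⊗ₜ _) t,
      Algebra.TensorProduct.tmul_mul_tmul, ← map_mul, mul_one, mul_assoc]
  rw [h1, hw, ← Q.cap_stdVec δ δB hE (_ * t), ← mul_assoc (1 ⊗ₜ _) (1 ⊗ₜ _) t,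
      Algebra.TensorProduct.tmul_mul_tmul, ← map_mul, mul_one, hz]

end Relative

end QuasiHopfAlgebra

namespace QTQuasiHopfAlgebra

variable {k : Type u} [Field k] {H : Type v} [Ring H] [Algebra k H] (T : QTQuasiHopfAlgebra k H)

open QuasiHopfAlgebra QuasiBialgebra

/-- `R₂₁`. -/
noncomputable abbrev R21 : (H ⊗[k] H)ˣ := Units.map (flip₂ k H : H ⊗[k] H →* H ⊗[k] H) T.R

theorem R21_val : (T.R21 : H ⊗[k] H) = flip₂ k H (T.R : H ⊗[k] H) := rfl

theorem R21_inv_val : (↑T.R21⁻¹ : H ⊗[k] H) = flip₂ k H (↑T.R⁻¹ : H ⊗[k] H) := rfl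

theorem flip₂_flip₂ (x : H ⊗[k] H) : flip₂ k H (flip₂ k H x) = x := by
  revert x
  exact induction₂ (fun a b ha hb => by simp only [map_add, ha, hb]) fun a b => by simp

theorem comul_mul_R21 (h : H) : T.comul h * (T.R21 : H ⊗[k] H) =
    (T.R21 : H ⊗[k] H) * flip₂ k H (T.comul h) := by
  have := congrArg (flip₂ k H) (T.cop_mul_R h)
  rwa [map_mul, map_mul, flip₂_flip₂] at this

theorem comul_mul_R_inv (h : H) : T.comul h * (↑T.R⁻¹ : H ⊗[k] H) =
    (↑T.R⁻¹ : H ⊗[k] H) * flip₂ k H (T.comul h) := by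
  rw [Units.mul_inv_eq_iff_eq_mul, mul_assoc, T.cop_mul_R, Units.inv_mul_cancel_left]

/-! ### Permutations of tensor legs -/

section Perm

theorem perm312_comul (x : H ⊗[k] H) :
    perm312 k H (Algebra.TensorProduct.map (AlgHom.id k H) T.comul x) =
      asc k H (Algebra.TensorProduct.map T.comul (AlgHom.id k H) (flip₂ k H x)) := by
  revert x
  exact induction₂ (fun a b ha hb => by simp only [map_add, ha, hb]) fun a b => by simp

theorem perm231_comul (x : H ⊗[k] H) :
    perm231 k H (asc k H (Algebra.TensorProduct.map T.comul (AlgHom.id k H) x)) =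
      Algebra.TensorProduct.map (AlgHom.id k H) T.comul (flip₂ k H x) := by
  revert x
  exact induction₂ (fun a b ha hb => by simp only [map_add, ha, hb]) fun a b => by simp

theorem perm312_leg13' (x : H ⊗[k] H) :
    perm312 k H (leg13 k H x) = leg23 k H (flip₂ k H x) := by
  revert x
  exact induction₂ (fun a b ha hb => by simp only [map_add, ha, hb]) fun a b => by simp

theorem perm312_leg12' (x : H ⊗[k] H) :
    perm312 k H (leg12 k H x) = leg13 k H (flip₂ k H x) := by
  revert x
  exact induction₂ (fun a b ha hb => by simp only [map_add, ha, hb]) fun a b => by simp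

theorem perm312_leg23 (x : H ⊗[k] H) : perm312 k H (leg23 k H x) = leg12 k H x := by
  revert x
  exact induction₂ (fun a b ha hb => by simp only [map_add, ha, hb]) fun a b => by simp

theorem perm231_leg13' (x : H ⊗[k] H) :
    perm231 k H (leg13 k H x) = leg12 k H (flip₂ k H x) := by
  revert x
  exact induction₂ (fun a b ha hb => by simp only [map_add, ha, hb]) fun a b => by simp

theorem perm231_leg23' (x : H ⊗[k] H) :
    perm231 k H (leg23 k H x) = leg13 k H (flip₂ k H x) := by
  revert x
  exact induction₂ (fun a b ha hb => by simp only [map_add, ha, hb]) fun a b => by simp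

theorem perm213_leg23 (x : H ⊗[k] H) : perm213 k H (leg23 k H x) = leg13 k H x := by
  revert x
  exact induction₂ (fun a b ha hb => by simp only [map_add, ha, hb]) fun a b => by simp

theorem perm213_leg13 (x : H ⊗[k] H) : perm213 k H (leg13 k H x) = leg23 k H x := by
  revert x
  exact induction₂ (fun a b ha hb => by simp only [map_add, ha, hb]) fun a b => by simp

theorem perm213_leg12 (x : H ⊗[k] H) : perm213 k H (leg12 k H x) = leg12 k H (flip₂ k H x) := by
  revert x
  exact induction₂ (fun a b ha hb => by simp only [map_add, ha, hb]) fun a b => by simp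

theorem perm132_leg23 (x : H ⊗[k] H) : perm132 k H (leg23 k H x) = leg23 k H (flip₂ k H x) := by
  revert x
  exact induction₂ (fun a b ha hb => by simp only [map_add, ha, hb]) fun a b => by simp

theorem perm213_perm132 (x : H ⊗[k] (H ⊗[k] H)) :
    perm213 k H (perm132 k H x) = perm231 k H x := by
  revert x
  exact induction₃ (fun a b ha hb => by simp only [map_add, ha, hb]) fun a b c => by simp

end Perm

/-! ### The evaluation twisted by the braiding -/

/-- `(Δ ⊗ id)(R₂₁)`. -/
theorem comul_left_R21 :
    asc k H (Algebra.TensorProduct.map T.comul (AlgHom.id k H) (T.R21 : H ⊗[k] H)) =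
      (↑T.Φ⁻¹ : H ⊗[k] (H ⊗[k] H)) * leg23 k H (T.R21 : H ⊗[k] H) *
        perm132 k H (T.Φ : H ⊗[k] (H ⊗[k] H)) * leg13 k H (T.R21 : H ⊗[k] H) *
        perm312 k H (↑T.Φ⁻¹ : H ⊗[k] (H ⊗[k] H)) := by
  have h := congrArg (perm312 k H) T.comul_right_R
  rwa [perm312_comul, map_mul, map_mul, map_mul, map_mul, perm312_perm231, perm312_leg13',
    perm312_perm213, perm312_leg12'] at h

/-- `(id ⊗ Δ)(R₂₁)`. -/
theorem comul_right_R21 :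
    Algebra.TensorProduct.map (AlgHom.id k H) T.comul (T.R21 : H ⊗[k] H) =
      (T.Φ : H ⊗[k] (H ⊗[k] H)) * leg12 k H (T.R21 : H ⊗[k] H) *
        perm213 k H (↑T.Φ⁻¹ : H ⊗[k] (H ⊗[k] H)) * leg13 k H (T.R21 : H ⊗[k] H) *
        perm231 k H (T.Φ : H ⊗[k] (H ⊗[k] H)) := by
  have h := congrArg (perm231 k H) T.comul_left_R
  rwa [perm231_comul, map_mul, map_mul, map_mul, map_mul, perm231_perm312, perm231_leg13',
    perm231_perm132, perm231_leg23'] at h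

/-- A form of the Yang–Baxter equation for `R₂₁`. -/
theorem yangBaxter_R21 :
    asc k H (Algebra.TensorProduct.map T.comul (AlgHom.id k H) (T.R21 : H ⊗[k] H)) *
      leg12 k H (T.R21 : H ⊗[k] H) * perm213 k H (perm312 k H (T.Φ : H ⊗[k] (H ⊗[k] H))) =
    (↑T.Φ⁻¹ : H ⊗[k] (H ⊗[k] H)) *
      Algebra.TensorProduct.map (AlgHom.id k H) T.comul (T.R21 : H ⊗[k] H) *
      leg23 k H (T.R21 : H ⊗[k] H) := by
  have h1 : ∀ x : H ⊗[k] H,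
      asc k H (Algebra.TensorProduct.map T.comul (AlgHom.id k H) x) *
        leg12 k H (T.R21 : H ⊗[k] H) = leg12 k H (T.R21 : H ⊗[k] H) *
      perm213 k H (asc k H (Algebra.TensorProduct.map T.comul (AlgHom.id k H) x)) := by
    refine induction₂ (fun a b ha hb => by simp only [map_add, add_mul, mul_add, ha, hb])
      fun a b => ?_
    have h2 : ∀ w : H ⊗[k] H, perm213 k H (asc k H (w ⊗ₜ b)) = asc k H (flip₂ k H w ⊗ₜ b) :=
      induction₂ (fun a b ha hb => by simp only [map_add, TensorProduct.add_tmul, ha, hb])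
        fun a b => by simp
    rw [Algebra.TensorProduct.map_tmul, AlgHom.id_apply, h2, ← asc_tmul_one, ← map_mul, ← map_mul,
      Algebra.TensorProduct.tmul_mul_tmul, Algebra.TensorProduct.tmul_mul_tmul, T.comul_mul_R21,
      mul_one, one_mul]
  have h3 : perm213 k H (perm312 k H (↑T.Φ⁻¹ : H ⊗[k] (H ⊗[k] H))) *
      perm213 k H (perm312 k H (T.Φ : H ⊗[k] (H ⊗[k] H))) = 1 := by
    rw [← map_mul, ← map_mul, Units.inv_mul, map_one, map_one]
  rw [h1, comul_left_R21, comul_right_R21]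
  simp only [map_mul, perm213_leg23, perm213_leg13, perm213_perm132]
  simp only [mul_assoc, h3, mul_one, Units.inv_mul_cancel_left]

/-- The anti-morphism `H → Hᵒᵖ` given by the identity map. -/
abbrev opId (k : Type u) [Field k] (H : Type v) [Ring H] [Algebra k H] : H →ₐ[k] Hᵐᵒᵖᵐᵒᵖ :=
  (AlgEquiv.opOp k H : H →ₐ[k] Hᵐᵒᵖᵐᵒᵖ)

/-- `S(R²) α R¹`: the evaluation of the dual on the other side, obtained with the braiding. -/
noncomputable abbrev evR : H := leftMap T.S T.α (T.R21 : H ⊗[k] H)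

/-- `R̄² β S(R̄¹)` with `R⁻¹ = R̄¹ ⊗ R̄²`. -/
noncomputable abbrev coevR : H := rightMap T.S T.β (↑T.R21⁻¹ : H ⊗[k] H)

theorem relLeft_evR (h : H) :
    relLeft (opId k H) (MulOpposite.op T.evR) T.S (T.comul h) =
      T.counit h • MulOpposite.op T.evR := by
  have h1 : ∀ w : H ⊗[k] H, relLeft (opId k H) (MulOpposite.op T.evR) T.S w =
      MulOpposite.op (leftMap T.S T.α ((T.R21 : H ⊗[k] H) * flip₂ k H w)) := by
    refine induction₂ (fun a b ha hb => by simp only [map_add, mul_add, ha, hb, MulOpposite.op_add])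
      fun a b => ?_
    rw [Algebra.TensorProduct.comm_tmul, leftMap_mul, relLeft_tmul]
    apply MulOpposite.unop_injective
    simp [mul_assoc, evR]
  rw [h1, ← comul_mul_R21, leftMap_comul_mul, MulOpposite.op_smul]

theorem relRight_coevR (h : H) :
    relRight T.S (MulOpposite.op T.coevR) (opId k H) (T.comul h) =
      T.counit h • MulOpposite.op T.coevR := by
  have h1 : ∀ w : H ⊗[k] H, relRight T.S (MulOpposite.op T.coevR) (opId k H) w =
      MulOpposite.op (rightMap T.S T.β (flip₂ k H w * (↑T.R21⁻¹ : H ⊗[k] H))) := by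
    refine induction₂ (fun a b ha hb => by simp only [map_add, add_mul, ha, hb, MulOpposite.op_add])
      fun a b => ?_
    rw [Algebra.TensorProduct.comm_tmul, rightMap_mul, relRight_tmul]
    apply MulOpposite.unop_injective
    simp [mul_assoc, coevR]
  have h2 : flip₂ k H (T.comul h) * (↑T.R21⁻¹ : H ⊗[k] H) =
      (↑T.R21⁻¹ : H ⊗[k] H) * T.comul h := by
    have := congrArg (flip₂ k H) (T.comul_mul_R_inv h)
    rwa [map_mul, map_mul, flip₂_flip₂] at this
  rw [h1, h2, rightMap_mul_comul, MulOpposite.op_smul]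

theorem eL_flip₂ (w : H ⊗[k] H) : eL k H T.counit (flip₂ k H w) = eR k H T.counit w := by
  revert w
  exact induction₂ (fun a b ha hb => by simp only [map_add, ha, hb]) fun a b => by simp

theorem eR_flip₂ (w : H ⊗[k] H) : eR k H T.counit (flip₂ k H w) = eL k H T.counit w := by
  revert w
  exact induction₂ (fun a b ha hb => by simp only [map_add, ha, hb]) fun a b => by simp

/-- One triangle identity for the evaluation and coevaluation twisted by the braiding. -/
theorem relZig_evR_coevR :
    relZig T.S (MulOpposite.op T.coevR) (opId k H) (MulOpposite.op T.evR)
      (T.Φ : H ⊗[k] (H ⊗[k] H)) = 1 := by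
  have h1 : ∀ x : H ⊗[k] (H ⊗[k] H), relZig T.S (MulOpposite.op T.coevR) (opId k H)
      (MulOpposite.op T.evR) x = MulOpposite.op (zagMap T.S T.α T.β
        (leg12 k H (T.R21 : H ⊗[k] H) * perm213 k H (perm312 k H x) *
          leg23 k H (↑T.R21⁻¹ : H ⊗[k] H))) := by
    refine induction₃ (fun a b ha hb => by
      simp only [map_add, add_mul, mul_add, ha, hb, MulOpposite.op_add]) fun a b c => ?_
    rw [evR, coevR]
    generalize (T.R21 : H ⊗[k] H) = r
    generalize (↑T.R21⁻¹ : H ⊗[k] H) = s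
    revert r
    refine induction₂ (fun x y hx hy => by
      simp only [map_add, add_mul, MulOpposite.op_add, relZig_tmul] at hx hy ⊢
      rw [← hx, ← hy]; noncomm_ring) fun p q => ?_
    revert s
    refine induction₂ (fun x y hx hy => by
      simp only [map_add, mul_add, MulOpposite.op_add, relZig_tmul] at hx hy ⊢
      rw [← hx, ← hy]; noncomm_ring) fun r s => ?_
    apply MulOpposite.unop_injective
    simp [mul_assoc]
  have h2 : leg12 k H (T.R21 : H ⊗[k] H) * perm213 k H (perm312 k H (T.Φ : H ⊗[k] (H ⊗[k] H))) *
          leg23 k H (↑T.R21⁻¹ : H ⊗[k] H) =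
      asc k H (Algebra.TensorProduct.map T.comul (AlgHom.id k H) (↑T.R21⁻¹ : H ⊗[k] H)) *
      ((↑T.Φ⁻¹ : H ⊗[k] (H ⊗[k] H)) *
      Algebra.TensorProduct.map (AlgHom.id k H) T.comul (T.R21 : H ⊗[k] H)) := by
    have h3 := T.yangBaxter_R21
    have h4 : asc k H (Algebra.TensorProduct.map T.comul (AlgHom.id k H) (↑T.R21⁻¹ : H ⊗[k] H)) *
        asc k H (Algebra.TensorProduct.map T.comul (AlgHom.id k H) (T.R21 : H ⊗[k] H)) = 1 := by
      rw [← map_mul, ← map_mul, Units.inv_mul, map_one, map_one]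
    have h5 : leg23 k H (T.R21 : H ⊗[k] H) * leg23 k H (↑T.R21⁻¹ : H ⊗[k] H) = 1 := by
      rw [← map_mul, Units.mul_inv, map_one]
    calc _ = (asc k H (Algebra.TensorProduct.map T.comul (AlgHom.id k H)
        (↑T.R21⁻¹ : H ⊗[k] H)) *
        asc k H (Algebra.TensorProduct.map T.comul (AlgHom.id k H) (T.R21 : H ⊗[k] H))) *
        (leg12 k H (T.R21 : H ⊗[k] H) *
        perm213 k H (perm312 k H (T.Φ : H ⊗[k] (H ⊗[k] H))) *
          leg23 k H (↑T.R21⁻¹ : H ⊗[k] H)) := by rw [h4, one_mul]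
      _ = asc k H (Algebra.TensorProduct.map T.comul (AlgHom.id k H) (↑T.R21⁻¹ : H ⊗[k] H)) *
        (asc k H (Algebra.TensorProduct.map T.comul (AlgHom.id k H) (T.R21 : H ⊗[k] H)) *
      leg12 k H (T.R21 : H ⊗[k] H) * perm213 k H (perm312 k H (T.Φ : H ⊗[k] (H ⊗[k] H)))) *
          leg23 k H (↑T.R21⁻¹ : H ⊗[k] H) := by simp only [mul_assoc]
      _ = _ := by rw [h3, mul_assoc, mul_assoc _ (leg23 k H _), h5, mul_one]
  have h6 : eL k H T.counit (↑T.R21⁻¹ : H ⊗[k] H) = 1 := by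
    have h8 := congrArg (eR k H T.counit) T.R.mul_inv
    rw [map_mul, T.counit_right_R, one_mul, map_one] at h8
    rw [R21_inv_val, eL_flip₂, h8]
  have h9 : eR k H T.counit (T.R21 : H ⊗[k] H) = 1 := by
    rw [R21_val, eR_flip₂, T.counit_left_R]
  rw [h1, h2, zagMap_comul_mul, h6, ← Algebra.TensorProduct.one_def,
    ← Algebra.TensorProduct.one_def, one_mul, zagMap_mul_comul, h9,
    ← Algebra.TensorProduct.one_def, mul_one, T.antipode_Φ_inv, MulOpposite.op_one]

/-! ### The element `u` -/

/-- `a ⊗ y ↦ y c σ(a)` on `H ⊗ Hᵒᵖ`, for an endomorphism `σ` of `H`. -/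
noncomputable def opCap (σ : H →ₗ[k] H) (c : H) : H ⊗[k] Hᵐᵒᵖ →ₗ[k] H :=
  LinearMap.mul' k H ∘ₗ
    (TensorProduct.comm k H H).toLinearMap ∘ₗ
      TensorProduct.map (LinearMap.mulLeft k c ∘ₗ σ)
        (MulOpposite.opLinearEquiv k).symm.toLinearMap

@[simp] theorem opCap_tmul (σ : H →ₗ[k] H) (c a : H) (y : Hᵐᵒᵖ) :
    opCap σ c (a ⊗ₜ[k] y) = MulOpposite.unop y * (c * σ a) := rfl

theorem opCap_mul_right (σ : H →ₗ[k] H) (c : H) (t : H ⊗[k] Hᵐᵒᵖ) (y : H) :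
    opCap σ c (t * (1 ⊗ₜ MulOpposite.op y)) = y * opCap σ c t := by
  revert t
  exact induction₂ (fun a b ha hb => by simp only [map_add, add_mul, mul_add, ha, hb])
    fun a b => by simp [mul_assoc]

theorem opCap_mul_left (σ : H →ₐ[k] H) (c : H) (t : H ⊗[k] Hᵐᵒᵖ) (a : H) :
    opCap σ.toLinearMap c (t * (a ⊗ₜ 1)) = opCap σ.toLinearMap c t * σ a := by
  revert t
  exact induction₂ (fun a b ha hb => by simp only [map_add, add_mul, ha, hb])
    fun a b => by simp [mul_assoc]

/-- Invariance of the cap `a ⊗ y ↦ y S(R²) α R¹ a`. -/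
theorem opCap_evR (h : H) (t : H ⊗[k] Hᵐᵒᵖ) :
    opCap (AlgHom.id k H).toLinearMap T.evR
      (Algebra.TensorProduct.map (AlgHom.id k H) T.S (T.comul h) * t) =
      T.counit h • opCap (AlgHom.id k H).toLinearMap T.evR t := by
  revert t
  refine induction₂ (fun a b ha hb => by rw [mul_add, map_add, map_add, ha, hb, smul_add])
    fun a b => ?_
  have h1 : ∀ w : H ⊗[k] H, opCap (AlgHom.id k H).toLinearMap T.evR
      (Algebra.TensorProduct.map (AlgHom.id k H) T.S w * (a ⊗ₜ b)) =
      MulOpposite.unop b *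
        MulOpposite.unop (relLeft (opId k H) (MulOpposite.op T.evR) T.S w) * a :=
    induction₂ (fun a b ha hb => by
      rw [map_add, add_mul, map_add, map_add, ha, hb, MulOpposite.unop_add]; noncomm_ring)
      fun a b => by simp [mul_assoc]
  rw [h1, relLeft_evR]
  simp [mul_assoc]

/-- Invariance of the cap `a ⊗ y ↦ y S(α) S²(a)`. -/
theorem opCap_S (h : H) (t : H ⊗[k] Hᵐᵒᵖ) :
    opCap (antiLin T.S ∘ₗ antiLin T.S) (antiLin T.S T.α)
      (Algebra.TensorProduct.map (AlgHom.id k H) T.S (T.comul h) * t) =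
      T.counit h • opCap (antiLin T.S ∘ₗ antiLin T.S) (antiLin T.S T.α) t := by
  revert t
  refine induction₂ (fun a b ha hb => by rw [mul_add, map_add, map_add, ha, hb, smul_add])
    fun a b => ?_
  have h1 : ∀ w : H ⊗[k] H, opCap (antiLin T.S ∘ₗ antiLin T.S) (antiLin T.S T.α)
      (Algebra.TensorProduct.map (AlgHom.id k H) T.S w * (a ⊗ₜ b)) =
      MulOpposite.unop b * antiLin T.S (leftMap T.S T.α w) * antiLin T.S (antiLin T.S a) :=
    induction₂ (fun a b ha hb => by
      rw [map_add, add_mul, map_add, map_add, map_add, ha, hb]; noncomm_ring)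
      fun a b => by simp [mul_assoc]
  rw [h1, T.antipode_left]
  simp [mul_assoc]

/-- `u`, expressed through the cap `a ⊗ y ↦ y S(R²) α R¹ a`. -/
theorem elemU_eq : opCap (AlgHom.id k H).toLinearMap T.evR
    (T.stdVec T.S (AlgHom.id k H)) = T.elemU := by
  have h1 : ∀ x : H ⊗[k] (H ⊗[k] H), opCap (AlgHom.id k H).toLinearMap T.evR
      (TensorProduct.map (AlgHom.id k H).toLinearMap (relRight T.S (T.S T.β) (T.relS T.S)) x) =
      uMap T.S T.α T.β (leg12 k H (T.R : H ⊗[k] H) * x) := by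
    rw [evR, R21_val]
    generalize (T.R : H ⊗[k] H) = r
    refine induction₃ (fun a b ha hb => by simp only [map_add, mul_add, ha, hb]) fun a b c => ?_
    revert r
    refine induction₂ (fun x y hx hy => ?_) fun p q => by simp [mul_assoc]
    rw [map_add (leg12 k H), add_mul, map_add (uMap _ _ _), ← hx, ← hy]
    simp only [map_add, TensorProduct.map_tmul, opCap_tmul]
    noncomm_ring
  exact h1 _

/-- `S²(h) u = u h`: slide `h` through the cap that defines `u`. -/
theorem elemU_mul (h : H) : MulOpposite.unop (T.S (MulOpposite.unop (T.S h))) * T.elemU =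
    T.elemU * h := by
  have h1 := T.cap_stdVec_slide T.S (AlgHom.id k H) T.opCap_evR h 1
  rw [mul_one, mul_one, AlgHom.id_apply, opCap_mul_left (AlgHom.id k H), elemU_eq] at h1
  rw [← MulOpposite.op_unop (T.S (MulOpposite.unop (T.S h))), opCap_mul_right, elemU_eq] at h1
  exact h1.symm

/-- `S(R²) α R¹ = S(α) u`. -/
theorem evR_eq : T.evR = MulOpposite.unop (T.S T.α) * T.elemU := by
  have h1 := T.cap_stdVec T.S (AlgHom.id k H) T.opCap_evR 1
  rw [mul_one, ← MulOpposite.op_unop (T.S T.α), opCap_mul_right, elemU_eq,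
    Algebra.TensorProduct.one_def, opCap_tmul] at h1
  simpa using h1.symm

/-- The evaluation `y S(α) S²(a)` paired with the coevaluation of the braided duality gives the
element `g` that inverts `u`. -/
theorem exists_elemU_inv : ∃ g : H, T.evR * g = MulOpposite.unop (T.S T.α) ∧
    ∀ h, g * MulOpposite.unop (T.S (MulOpposite.unop (T.S h))) = h * g := by
  set σ : H →ₐ[k] H := (AlgHom.opComm T.S).comp T.S with hσ
  have hσa : ∀ a, σ a = MulOpposite.unop (T.S (MulOpposite.unop (T.S a))) := fun _ => rfl
  have hσ' : antiLin T.S ∘ₗ antiLin T.S = σ.toLinearMap := rfl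
  refine ⟨opCap (antiLin T.S ∘ₗ antiLin T.S) (antiLin T.S T.α)
    (T.coevVec (AlgHom.id k H) T.S (MulOpposite.op T.coevR) (opId k H)), ?_, fun h => ?_⟩
  · have h1 := T.cap_factor (AlgHom.id k H) T.relLeft_evR T.relRight_coevR T.opCap_S
      T.relZig_evR_coevR 1
    rw [mul_one, opCap_mul_right, Algebra.TensorProduct.one_def, opCap_tmul] at h1
    rw [h1]
    simp
  · have h1 := T.cap_coevVec (AlgHom.id k H) T.relRight_coevR T.opCap_S h 1
    rw [mul_one, mul_one, AlgHom.id_apply, hσ', opCap_mul_left] at h1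
    rw [hσ', ← hσa, h1]
    exact opCap_mul_right _ _ _ h

/-- An element that fixes `S(α)` and commutes with `S²(H)` is `1`, since
`S(S(x¹) α x² β S(x³)) = 1`. -/
theorem eq_one_of_S_α_mul (x : H)
    (h : MulOpposite.unop (T.S T.α) * x = MulOpposite.unop (T.S T.α))
    (hx : ∀ a, x * MulOpposite.unop (T.S (MulOpposite.unop (T.S a))) =
      MulOpposite.unop (T.S (MulOpposite.unop (T.S a))) * x) : x = 1 := by
  have h1 : ∀ t : H ⊗[k] (H ⊗[k] H), MulOpposite.unop (T.S (zagMap T.S T.α T.β t)) * x =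
      MulOpposite.unop (T.S (zagMap T.S T.α T.β t)) := by
    refine induction₃ (fun a b ha hb => by
      simp only [map_add, MulOpposite.unop_add, add_mul, ha, hb]) fun a b c => ?_
    simp only [zagMap_tmul, map_mul, MulOpposite.unop_mul, mul_assoc, ← hx]
    simp only [← mul_assoc _ x, h]
  have h2 := h1 (↑T.Φ⁻¹ : H ⊗[k] (H ⊗[k] H))
  rw [T.antipode_Φ_inv] at h2
  simpa using h2

theorem isUnit_elemU : IsUnit T.elemU := by
  obtain ⟨g, hg1, hg2⟩ := T.exists_elemU_inv
  have h1 : T.elemU * g = 1 := by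
    apply T.eq_one_of_S_α_mul
    · rw [← mul_assoc, ← evR_eq, hg1]
    · intro a
      rw [mul_assoc, hg2, ← mul_assoc, ← mul_assoc, elemU_mul]
  -- `g u` is a central idempotent that fixes the right invertible element `u`.
  have h2 : ∀ a, g * T.elemU * a = a * (g * T.elemU) := fun a => by
    rw [mul_assoc, ← elemU_mul, ← mul_assoc, hg2, mul_assoc]
  have h3 : g * T.elemU = 1 := by
    calc g * T.elemU = g * T.elemU * (T.elemU * g) := by rw [h1, mul_one]
      _ = T.elemU * (g * T.elemU) * g := by rw [← mul_assoc, h2]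
      _ = 1 := by rw [← mul_assoc, h1, one_mul, h1]
  exact ⟨⟨T.elemU, g, h1, h3⟩, rfl⟩

/-- The element `u S(u)`. -/
noncomputable def zU : H := T.elemU * MulOpposite.unop (T.S T.elemU)

theorem S_S_elemU : MulOpposite.unop (T.S (MulOpposite.unop (T.S T.elemU))) = T.elemU := by
  have h := T.elemU_mul T.elemU
  exact T.isUnit_elemU.mul_right_cancel h

theorem S_elemU_mul_central (h : H) : MulOpposite.unop (T.S T.elemU) * T.elemU * h =
    h * (MulOpposite.unop (T.S T.elemU) * T.elemU) := by
  obtain ⟨u, hu⟩ := T.isUnit_elemU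
  -- `S` is surjective, since `S²` is conjugation by `u`.
  obtain ⟨a, rfl⟩ : ∃ a, MulOpposite.unop (T.S a) = h := by
    refine ⟨MulOpposite.unop (T.S (↑u⁻¹ * h * u)), ?_⟩
    apply T.isUnit_elemU.mul_right_cancel
    rw [elemU_mul, ← hu]
    simp [← mul_assoc]
  have h1 : MulOpposite.unop (T.S T.elemU) * MulOpposite.unop (T.S (MulOpposite.unop
      (T.S (MulOpposite.unop (T.S a))))) =
      MulOpposite.unop (T.S a) * MulOpposite.unop (T.S T.elemU) := by
    rw [← MulOpposite.unop_mul, ← map_mul, elemU_mul, map_mul, MulOpposite.unop_mul]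
  rw [mul_assoc, ← elemU_mul, ← mul_assoc, h1, mul_assoc]

theorem zU_eq : T.zU = MulOpposite.unop (T.S T.elemU) * T.elemU := by
  apply T.isUnit_elemU.mul_right_cancel
  rw [S_elemU_mul_central, zU, mul_assoc]

theorem zU_central (h : H) : T.zU * h = h * T.zU := by
  rw [zU_eq, S_elemU_mul_central]

theorem isUnit_zU : IsUnit T.zU :=
  T.isUnit_elemU.mul ((T.isUnit_elemU.map T.S).unop)

theorem S_zU : MulOpposite.unop (T.S T.zU) = T.zU := by
  rw [zU, map_mul, MulOpposite.unop_mul, S_S_elemU]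

/-- `S(M¹) α M² = u S(u) α` for `M = R₂₁R`. -/
theorem leftMap_R21R : leftMap T.S T.α (T.R21R : H ⊗[k] H) = T.zU * T.α := by
  have h1 : ∀ w : H ⊗[k] H, leftMap T.S T.α ((T.R21 : H ⊗[k] H) * w) =
      MulOpposite.unop (T.S (leftMap T.S T.α (flip₂ k H w))) * T.elemU := by
    refine induction₂ (fun a b ha hb => by
      simp only [map_add, mul_add, add_mul, ha, hb, MulOpposite.unop_add]) fun a b => ?_
    rw [leftMap_mul, show leftMap T.S T.α (T.R21 : H ⊗[k] H) = T.evR from rfl, evR_eq]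
    simp only [Algebra.TensorProduct.comm_tmul, leftMap_tmul, map_mul, MulOpposite.unop_mul,
      mul_assoc, elemU_mul]
  have h2 : (T.R21R : H ⊗[k] H) = (T.R21 : H ⊗[k] H) * (T.R : H ⊗[k] H) := rfl
  rw [h2, h1, ← R21_val, show leftMap T.S T.α (T.R21 : H ⊗[k] H) = T.evR from rfl, evR_eq,
    map_mul, MulOpposite.unop_mul, mul_assoc, elemU_mul, zU_eq, mul_assoc]

/-! ### Braids on three strands -/

/-- The braiding of the last two strands, on the regular module `H ⊗ (H ⊗ H)`. -/
noncomputable def b₂ : H ⊗[k] (H ⊗[k] H) →ₗ[k] H ⊗[k] (H ⊗[k] H) :=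
  (perm132 k H).toLinearMap ∘ₗ LinearMap.mulLeft k (leg23 k H (T.R : H ⊗[k] H))

/-- The braiding of the first two strands, on the regular module `H ⊗ (H ⊗ H)`. -/
noncomputable def b₁ : H ⊗[k] (H ⊗[k] H) →ₗ[k] H ⊗[k] (H ⊗[k] H) :=
  LinearMap.mulLeft k (T.Φ : H ⊗[k] (H ⊗[k] H)) ∘ₗ (perm213 k H).toLinearMap ∘ₗ
    LinearMap.mulLeft k (leg12 k H (T.R : H ⊗[k] H)) ∘ₗ
    LinearMap.mulLeft k (↑T.Φ⁻¹ : H ⊗[k] (H ⊗[k] H))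

/-- The inverse of `b₂`. -/
noncomputable def b₂inv : H ⊗[k] (H ⊗[k] H) →ₗ[k] H ⊗[k] (H ⊗[k] H) :=
  LinearMap.mulLeft k (leg23 k H (↑T.R⁻¹ : H ⊗[k] H)) ∘ₗ (perm132 k H).toLinearMap

theorem b₂_apply (t : H ⊗[k] (H ⊗[k] H)) :
    T.b₂ t = perm132 k H (leg23 k H (T.R : H ⊗[k] H) * t) := rfl

theorem b₁_apply (t : H ⊗[k] (H ⊗[k] H)) :
    T.b₁ t = (T.Φ : H ⊗[k] (H ⊗[k] H)) * perm213 k H (leg12 k H (T.R : H ⊗[k] H) *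
      ((↑T.Φ⁻¹ : H ⊗[k] (H ⊗[k] H)) * t)) := rfl

theorem b₂inv_apply (t : H ⊗[k] (H ⊗[k] H)) :
    T.b₂inv t = leg23 k H (↑T.R⁻¹ : H ⊗[k] H) * perm132 k H t := rfl

theorem perm132_perm132 (x : H ⊗[k] (H ⊗[k] H)) : perm132 k H (perm132 k H x) = x := by
  revert x
  exact induction₃ (fun a b ha hb => by simp only [map_add, ha, hb]) fun a b c => by simp

theorem perm312_perm132 (x : H ⊗[k] (H ⊗[k] H)) :
    perm312 k H (perm132 k H x) = perm213 k H (perm312 k H x) := by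
  revert x
  exact induction₃ (fun a b ha hb => by simp only [map_add, ha, hb]) fun a b c => by simp

theorem perm213_perm213 (x : H ⊗[k] (H ⊗[k] H)) : perm213 k H (perm213 k H x) = x := by
  revert x
  exact induction₃ (fun a b ha hb => by simp only [map_add, ha, hb]) fun a b c => by simp

theorem b₂inv_b₂ (t : H ⊗[k] (H ⊗[k] H)) : T.b₂inv (T.b₂ t) = t := by
  rw [b₂inv_apply, b₂_apply, perm132_perm132, ← mul_assoc, ← map_mul, Units.inv_mul, map_one,
    one_mul]

/-- The hexagon axiom for `c_{1,23}`. -/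
theorem hexagon_right (t : H ⊗[k] (H ⊗[k] H)) :
    (T.Φ : H ⊗[k] (H ⊗[k] H)) * perm312 k H
      (Algebra.TensorProduct.map (AlgHom.id k H) T.comul (T.R : H ⊗[k] H) * t) =
    T.b₂ (T.b₁ t) := by
  rw [b₂_apply, b₁_apply, T.comul_right_R]
  simp only [map_mul, perm312_perm231, perm312_leg13, perm312_perm213, mul_assoc,
    Units.mul_inv_cancel_left]
  simp only [← perm312_perm213, ← map_mul, perm213_perm213]

/-- The hexagon axiom for `c_{12,3}`. -/
theorem hexagon_left (t : H ⊗[k] (H ⊗[k] H)) :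
    perm231 k H (asc k H (Algebra.TensorProduct.map T.comul (AlgHom.id k H) (T.R : H ⊗[k] H)) *
      ((↑T.Φ⁻¹ : H ⊗[k] (H ⊗[k] H)) * t)) =
    T.b₁ (T.b₂ t) := by
  rw [b₂_apply, b₁_apply, T.comul_left_R]
  simp only [map_mul, perm231_perm312, perm231_leg13, perm231_perm132, mul_assoc]
  simp only [← perm213_perm132, ← map_mul, Units.mul_inv_cancel_left]

/-- The braid relation: naturality of `c_{1,23}` with respect to the braiding of the last two
strands. -/
theorem yangBaxter (t : H ⊗[k] (H ⊗[k] H)) :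
    T.b₁ (T.b₂ (T.b₁ t)) = T.b₂ (T.b₁ (T.b₂ t)) := by
  have h1 : ∀ x : H ⊗[k] H, Algebra.TensorProduct.map (AlgHom.id k H) T.comul x *
      perm132 k H (leg23 k H (T.R : H ⊗[k] H)) =
      perm132 k H (leg23 k H (T.R : H ⊗[k] H)) *
        perm132 k H (Algebra.TensorProduct.map (AlgHom.id k H) T.comul x) := by
    refine induction₂ (fun a b ha hb => by simp only [map_add, add_mul, mul_add, ha, hb])
      fun a b => ?_
    have h2 : ∀ w : H ⊗[k] H, perm132 k H (a ⊗ₜ w) = a ⊗ₜ flip₂ k H w := fun _ => rfl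
    rw [Algebra.TensorProduct.map_tmul, AlgHom.id_apply, h2, perm132_leg23,
      Algebra.TensorProduct.includeRight_apply, Algebra.TensorProduct.tmul_mul_tmul,
      Algebra.TensorProduct.tmul_mul_tmul, mul_one, one_mul]
    exact congrArg _ (T.comul_mul_R21 b)
  rw [← hexagon_right, ← hexagon_right, b₂_apply,
    map_mul (perm132 k H) (leg23 k H (T.R : H ⊗[k] H)), ← mul_assoc, h1, mul_assoc,
    ← map_mul (perm132 k H), ← map_mul (perm132 k H), perm312_perm132,
    map_mul (perm312 k H) (leg23 k H (T.R : H ⊗[k] H)), perm312_leg23, b₁_apply,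
    Units.inv_mul_cancel_left]

/-- The full twist on three strands, in two ways. -/
theorem fullTwist (t : H ⊗[k] (H ⊗[k] H)) :
    T.b₁ (T.b₂ (T.b₂ (T.b₁ (T.b₂ (T.b₂ t))))) = T.b₂ (T.b₁ (T.b₁ (T.b₂ (T.b₁ (T.b₁ t))))) := by
  rw [← yangBaxter T (T.b₂ t), yangBaxter T (T.b₂ (T.b₁ (T.b₂ t))), ← yangBaxter T t,
    ← yangBaxter T (T.b₁ t)]

theorem R21R_val : (T.R21R : H ⊗[k] H) = (T.R21 : H ⊗[k] H) * (T.R : H ⊗[k] H) := rfl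

/-- The monodromy of the first strand around the other two is a pure braid. -/
theorem monodromy_right (t : H ⊗[k] (H ⊗[k] H)) :
    Algebra.TensorProduct.map (AlgHom.id k H) T.comul (T.R21R : H ⊗[k] H) * t =
      T.b₁ (T.b₂ (T.b₂ (T.b₁ t))) := by
  rw [← hexagon_right, ← hexagon_left, Units.inv_mul_cancel_left, map_mul, perm231_perm312,
    perm231_comul, R21R_val, map_mul, mul_assoc, R21_val]

/-- The monodromy of the last strand around the other two is a pure braid. -/
theorem monodromy_left (t : H ⊗[k] (H ⊗[k] H)) :
    (T.Φ : H ⊗[k] (H ⊗[k] H)) *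
      (asc k H (Algebra.TensorProduct.map T.comul (AlgHom.id k H) (T.R21R : H ⊗[k] H)) *
        ((↑T.Φ⁻¹ : H ⊗[k] (H ⊗[k] H)) * t)) =
      T.b₂ (T.b₁ (T.b₁ (T.b₂ t))) := by
  rw [← hexagon_left, ← hexagon_right, map_mul (perm312 k H), perm312_perm231, perm312_comul,
    R21R_val, map_mul, map_mul, mul_assoc, R21_val]

theorem b₂_b₂ (t : H ⊗[k] (H ⊗[k] H)) :
    T.b₂ (T.b₂ t) = leg23 k H (T.R21R : H ⊗[k] H) * t := by
  rw [b₂_apply, b₂_apply, map_mul, perm132_perm132, perm132_leg23, R21R_val, map_mul, mul_assoc,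
    R21_val]

theorem b₁_b₁ (t : H ⊗[k] (H ⊗[k] H)) :
    T.b₁ (T.b₁ t) = (T.Φ : H ⊗[k] (H ⊗[k] H)) * (leg12 k H (T.R21R : H ⊗[k] H) *
      ((↑T.Φ⁻¹ : H ⊗[k] (H ⊗[k] H)) * t)) := by
  rw [b₁_apply, b₁_apply, Units.inv_mul_cancel_left, map_mul (perm213 k H), perm213_perm213,
    perm213_leg12, R21R_val, map_mul, mul_assoc, R21_val]

/-- For `M = R₂₁R`: `(id ⊗ Δ)(M) M₂₃ = Φ (Δ ⊗ id)(M) M₁₂ Φ⁻¹`. -/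
theorem fullTwist_eq (t : H ⊗[k] (H ⊗[k] H)) :
    Algebra.TensorProduct.map (AlgHom.id k H) T.comul (T.R21R : H ⊗[k] H) *
      (leg23 k H (T.R21R : H ⊗[k] H) * t) =
    (T.Φ : H ⊗[k] (H ⊗[k] H)) *
      (asc k H (Algebra.TensorProduct.map T.comul (AlgHom.id k H) (T.R21R : H ⊗[k] H)) *
        (leg12 k H (T.R21R : H ⊗[k] H) * ((↑T.Φ⁻¹ : H ⊗[k] (H ⊗[k] H)) * t))) := by
  have h := T.monodromy_left (T.b₁ (T.b₁ t))
  rw [b₁_b₁, Units.inv_mul_cancel_left] at h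
  rw [h, ← b₁_b₁, monodromy_right, ← b₂_b₂, fullTwist]

theorem comul_mul_R21R (h : H) : T.comul h * (T.R21R : H ⊗[k] H) =
    (T.R21R : H ⊗[k] H) * T.comul h := by
  rw [R21R_val, ← mul_assoc, comul_mul_R21, mul_assoc, T.cop_mul_R, mul_assoc]

theorem comul_mul_R21R_inv (h : H) : T.comul h * (↑T.R21R⁻¹ : H ⊗[k] H) =
    (↑T.R21R⁻¹ : H ⊗[k] H) * T.comul h := by
  rw [Units.mul_inv_eq_iff_eq_mul, mul_assoc, comul_mul_R21R, Units.inv_mul_cancel_left]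

/-! ### The comultiplication of `u S(u)` -/

/-- `1 ⊗ 1 ⊗ z` with `z = u S(u)`. -/
noncomputable abbrev z₃ : H ⊗[k] (H ⊗[k] H) := 1 ⊗ₜ (1 ⊗ₜ T.zU)

/-- `1 ⊗ z ⊗ 1` with `z = u S(u)`. -/
noncomputable abbrev z₂ : H ⊗[k] (H ⊗[k] H) := 1 ⊗ₜ (T.zU ⊗ₜ 1)

theorem z₃_central (t : H ⊗[k] (H ⊗[k] H)) : T.z₃ * t = t * T.z₃ := by
  revert t
  exact induction₃ (fun a b ha hb => by simp only [add_mul, mul_add, ha, hb])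
    fun a b c => by simp [zU_central]

theorem z₂_central (t : H ⊗[k] (H ⊗[k] H)) : T.z₂ * t = t * T.z₂ := by
  revert t
  exact induction₃ (fun a b ha hb => by simp only [add_mul, mul_add, ha, hb])
    fun a b c => by simp [zU_central]

theorem b₁_z₃ (t : H ⊗[k] (H ⊗[k] H)) : T.b₁ (T.z₃ * t) = T.z₃ * T.b₁ t := by
  have h : perm213 k H T.z₃ = T.z₃ := by simp
  rw [b₁_apply, b₁_apply, ← mul_assoc _ T.z₃ t, ← z₃_central, mul_assoc,
    ← mul_assoc _ T.z₃ _, ← z₃_central, mul_assoc, map_mul (perm213 k H), h, ← mul_assoc _ T.z₃ _,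
    ← z₃_central, mul_assoc]

theorem b₂inv_z₃ (t : H ⊗[k] (H ⊗[k] H)) : T.b₂inv (T.z₃ * t) = T.z₂ * T.b₂inv t := by
  have h : perm132 k H T.z₃ = T.z₂ := by simp
  rw [b₂inv_apply, b₂inv_apply, map_mul, h, ← mul_assoc, ← z₂_central, mul_assoc]

/-- Under an invariant map on three strands, the monodromy of the last strand around the first two
becomes the action of `u S(u)` on the last strand. -/
theorem cap_left {Y : Type*} [AddCommGroup Y] [Module k Y] (G : H ⊗[k] (H ⊗[k] H) →ₗ[k] Y)
    (hG : ∀ h t, G (asc k H (Algebra.TensorProduct.map T.comul (AlgHom.id k H) (T.comul h)) * t) =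
      T.counit h • G t) (t : H ⊗[k] (H ⊗[k] H)) :
    G (asc k H (Algebra.TensorProduct.map T.comul (AlgHom.id k H) (T.R21R : H ⊗[k] H)) * t) =
      G (T.z₃ * t) := by
  have h := T.cap_mul_eq (AlgHom.id k H) T.comul (E := G ∘ₗ (asc k H).toLinearMap)
    (fun h t => by
      have := hG h (asc k H t)
      rw [← map_mul] at this
      exact this) (T.R21R : H ⊗[k] H) T.zU T.leftMap_R21R T.zU_central ((asc k H).symm t)
  have h2 : ∀ x, (G ∘ₗ (asc k H).toLinearMap) (x * (asc k H).symm t) = G (asc k H x * t) := by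
    intro x
    change G (asc k H (x * (asc k H).symm t)) = _
    rw [map_mul, AlgEquiv.apply_symm_apply]
  rw [h2, h2] at h
  exact h

/-- `a ⊗ y ↦ Δ(S(a) α) y`. -/
noncomputable def comulCap : H ⊗[k] (H ⊗[k] H) →ₗ[k] H ⊗[k] H :=
  LinearMap.mul' k (H ⊗[k] H) ∘ₗ
    TensorProduct.map (T.comul.toLinearMap ∘ₗ LinearMap.mulRight k T.α ∘ₗ antiLin T.S)
      LinearMap.id

@[simp] theorem comulCap_tmul (a : H) (y : H ⊗[k] H) :
    T.comulCap (a ⊗ₜ y) = T.comul (MulOpposite.unop (T.S a) * T.α) * y := rfl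

theorem comulCap_comul (h : H) (t : H ⊗[k] (H ⊗[k] H)) :
    T.comulCap (Algebra.TensorProduct.map (AlgHom.id k H) T.comul (T.comul h) * t) =
      T.counit h • T.comulCap t := by
  revert t
  refine induction₂ (fun a b ha hb => by rw [mul_add, map_add, map_add, ha, hb, smul_add])
    fun a y => ?_
  have h1 : ∀ w : H ⊗[k] H,
      T.comulCap (Algebra.TensorProduct.map (AlgHom.id k H) T.comul w * (a ⊗ₜ y)) =
      T.comul (MulOpposite.unop (T.S a) * leftMap T.S T.α w) * y :=
    induction₂ (fun a b ha hb => by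
      rw [map_add, add_mul, map_add, map_add, ha, hb, mul_add, map_add, add_mul])
      fun a b => by simp [mul_assoc]
  rw [h1, T.antipode_left]
  simp

/-- The cap `a ⊗ y ↦ Δ(S(a) α) y` is nondegenerate on elements commuting with `Δ(H)`. -/
theorem eq_of_comulCap (x y : H ⊗[k] H) (hx : ∀ h, T.comul h * x = x * T.comul h)
    (hy : ∀ h, T.comul h * y = y * T.comul h)
    (h : ∀ t, T.comulCap (leg23 k H x * t) = T.comulCap (leg23 k H y * t)) : x = y := by
  have h1 : ∀ x : H ⊗[k] H, (∀ h, T.comul h * x = x * T.comul h) →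
      ∀ t : H ⊗[k] (H ⊗[k] H),
      T.comulCap (leg23 k H x * TensorProduct.map LinearMap.id
        (T.comul.toLinearMap ∘ₗ rightMap T.S T.β) t) = T.comul (zagMap T.S T.α T.β t) * x := by
    intro x hx
    refine induction₃ (fun a b ha hb => by simp only [map_add, mul_add, add_mul, ha, hb])
      fun a b c => ?_
    rw [TensorProduct.map_tmul, Algebra.TensorProduct.includeRight_apply,
      Algebra.TensorProduct.tmul_mul_tmul, comulCap_tmul, LinearMap.comp_apply,
      AlgHom.toLinearMap_apply, ← hx, ← mul_assoc, ← map_mul]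
    simp
  have h2 := h1 x hx (↑T.Φ⁻¹ : H ⊗[k] (H ⊗[k] H))
  rw [h, h1 y hy, T.antipode_Φ_inv, map_one, one_mul, one_mul] at h2
  exact h2.symm

/-- `Δ(uS(u)) = (uS(u) ⊗ uS(u)) (R₂₁R)⁻²`. Both sides are compared under the cap of `H ⊗ H` with
its dual, where the pure braid relations on three strands become relations between the central
elements by which the monodromies act. -/
theorem comul_zU : T.comul T.zU =
    (T.zU ⊗ₜ T.zU) * ((↑T.R21R⁻¹ : H ⊗[k] H) * (↑T.R21R⁻¹ : H ⊗[k] H)) := by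
  -- Strand 1 around strands 2 and 3: `Δ(z)` acts on these two.
  have hP : ∀ t, T.comulCap (T.b₁ (T.b₂ (T.b₂ (T.b₁ t)))) =
      T.comulCap (leg23 k H (T.comul T.zU) * t) := by
    intro t
    rw [← monodromy_right]
    exact T.cap_mul_eq T.comul (AlgHom.id k H) T.comulCap_comul _ T.zU T.leftMap_R21R
      T.zU_central t
  have hΦ : ∀ h, (T.Φ : H ⊗[k] (H ⊗[k] H)) *
      asc k H (Algebra.TensorProduct.map T.comul (AlgHom.id k H) (T.comul h)) =
      Algebra.TensorProduct.map (AlgHom.id k H) T.comul (T.comul h) *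
        (T.Φ : H ⊗[k] (H ⊗[k] H)) := fun h => by
    rw [T.quasi_coassoc, mul_assoc, Units.inv_mul, mul_one]
  -- Strands 1 and 2 around strand 3: `z` acts on the latter.
  have hQ : ∀ t, T.comulCap (T.b₂ (T.b₁ (T.b₁ (T.b₂ t)))) = T.comulCap (T.z₃ * t) := by
    intro t
    rw [← monodromy_left]
    have h := T.cap_left (T.comulCap ∘ₗ LinearMap.mulLeft k (T.Φ : H ⊗[k] (H ⊗[k] H)))
      (fun h t => by
        simp only [LinearMap.comp_apply, LinearMap.mulLeft_apply]
        rw [← mul_assoc, hΦ, mul_assoc, comulCap_comul]) ((↑T.Φ⁻¹ : H ⊗[k] (H ⊗[k] H)) * t)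
    simp only [LinearMap.comp_apply, LinearMap.mulLeft_apply] at h
    rw [h, ← mul_assoc _ T.z₃, ← z₃_central, mul_assoc, Units.mul_inv_cancel_left]
  -- Conjugating the preceding case by the braiding of the last two strands, `z` acts on strand 2.
  have hN : ∀ t, T.comulCap (T.b₁ (T.b₁ (T.b₂ (T.b₂ t)))) = T.comulCap (T.z₂ * t) := by
    intro t
    have hb : ∀ x : H ⊗[k] H, ∀ t, T.b₂inv
        (Algebra.TensorProduct.map (AlgHom.id k H) T.comul x * t) =
        Algebra.TensorProduct.map (AlgHom.id k H) T.comul x * T.b₂inv t := by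
      intro x t
      have : leg23 k H (↑T.R⁻¹ : H ⊗[k] H) *
          perm132 k H (Algebra.TensorProduct.map (AlgHom.id k H) T.comul x) =
          Algebra.TensorProduct.map (AlgHom.id k H) T.comul x *
            leg23 k H (↑T.R⁻¹ : H ⊗[k] H) := by
        revert x
        refine induction₂ (fun a b ha hb => by simp only [map_add, add_mul, mul_add, ha, hb])
          fun a b => ?_
        have h2 : ∀ w : H ⊗[k] H, perm132 k H (a ⊗ₜ w) = a ⊗ₜ flip₂ k H w := fun _ => rfl
        rw [Algebra.TensorProduct.map_tmul, AlgHom.id_apply, h2,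
          Algebra.TensorProduct.includeRight_apply, Algebra.TensorProduct.tmul_mul_tmul,
          Algebra.TensorProduct.tmul_mul_tmul, mul_one, one_mul, comul_mul_R_inv]
      rw [b₂inv_apply, b₂inv_apply, map_mul, ← mul_assoc, this, mul_assoc]
    have h := T.cap_left (T.comulCap ∘ₗ T.b₂inv ∘ₗ
        LinearMap.mulLeft k (T.Φ : H ⊗[k] (H ⊗[k] H)))
      (fun h t => by
        simp only [LinearMap.comp_apply, LinearMap.mulLeft_apply]
        rw [← mul_assoc, hΦ, mul_assoc, hb, comulCap_comul])
      ((↑T.Φ⁻¹ : H ⊗[k] (H ⊗[k] H)) * T.b₂ t)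
    simp only [LinearMap.comp_apply, LinearMap.mulLeft_apply] at h
    rw [monodromy_left, b₂inv_b₂, ← mul_assoc _ T.z₃, ← z₃_central, mul_assoc,
      Units.mul_inv_cancel_left, b₂inv_z₃, b₂inv_b₂] at h
    exact h
  have hM : ∀ t : H ⊗[k] (H ⊗[k] H), leg23 k H (T.R21R : H ⊗[k] H) *
      (leg23 k H (↑T.R21R⁻¹ : H ⊗[k] H) * t) = t := fun t => by
    rw [← mul_assoc, ← map_mul, Units.mul_inv, map_one, one_mul]
  have hzz : ∀ x : H ⊗[k] H, (T.zU ⊗ₜ T.zU) * x = x * (T.zU ⊗ₜ T.zU) :=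
    induction₂ (fun a b ha hb => by simp only [add_mul, mul_add, ha, hb])
      fun a b => by simp [zU_central]
  refine T.eq_of_comulCap _ _ (fun h => ?_) (fun h => ?_) fun t => ?_
  · rw [← map_mul, ← map_mul, zU_central]
  · rw [← mul_assoc, ← hzz, mul_assoc, ← mul_assoc (T.comul h), comul_mul_R21R_inv, mul_assoc,
      comul_mul_R21R_inv, mul_assoc, mul_assoc]
  · have hz : leg23 k H (T.zU ⊗ₜ[k] T.zU) = T.z₂ * T.z₃ := by simp
    have h1 : leg23 k H ((T.zU ⊗ₜ[k] T.zU) *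
        ((↑T.R21R⁻¹ : H ⊗[k] H) * (↑T.R21R⁻¹ : H ⊗[k] H))) * t =
        T.z₂ * (leg23 k H (↑T.R21R⁻¹ : H ⊗[k] H) *
          (leg23 k H (↑T.R21R⁻¹ : H ⊗[k] H) * (T.z₃ * t))) := by
      rw [map_mul, hz, map_mul, T.z₃_central t]
      simp only [mul_assoc]
      rw [z₃_central]
      simp only [mul_assoc]
    -- The full twist relates the three actions.
    rw [h1, ← hN, b₂_b₂, hM, ← mul_assoc _ T.z₃, ← z₃_central, mul_assoc, b₁_z₃,
      b₁_z₃, ← hQ, ← fullTwist, hP, b₂_b₂, hM]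

/-! ### The monodromy against evaluation and coevaluation -/

theorem counit_left_R21R : eL k H T.counit (T.R21R : H ⊗[k] H) = 1 := by
  rw [R21R_val, map_mul, R21_val, eL_flip₂, counit_right_R, counit_left_R, one_mul]

theorem counit_right_R21R : eR k H T.counit (T.R21R : H ⊗[k] H) = 1 := by
  rw [R21R_val, map_mul, R21_val, eR_flip₂, counit_right_R, counit_left_R, one_mul]

theorem counit_left_R21R_inv : eL k H T.counit (↑T.R21R⁻¹ : H ⊗[k] H) = 1 := by
  have h := congrArg (eL k H T.counit) T.R21R.mul_inv
  rwa [map_mul, counit_left_R21R, one_mul, map_one] at h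

theorem counit_right_R21R_inv : eR k H T.counit (↑T.R21R⁻¹ : H ⊗[k] H) = 1 := by
  have h := congrArg (eR k H T.counit) T.R21R.mul_inv
  rwa [map_mul, counit_right_R21R, one_mul, map_one] at h

theorem counit_zU : T.counit T.zU = 1 := by
  have h := congrArg (eL k H T.counit) T.comul_zU
  rw [show eL k H T.counit (T.comul T.zU) = T.zU from T.counit_left _, map_mul, map_mul,
    counit_left_R21R_inv, mul_one, mul_one, eL_tmul] at h
  have h2 := congrArg T.counit h
  rw [map_smul, smul_eq_mul] at h2
  exact ((T.isUnit_zU.map T.counit).mul_eq_left.1 h2.symm)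

/-- `u S(u) S(m¹) α m² = α`, where `m¹ ⊗ m² = (R₂₁R)⁻¹`: apply `x ⊗ y ↦ S(x) α y` to
`Δ(uS(u)) R₂₁R = (uS(u) ⊗ uS(u)) (R₂₁R)⁻¹`. -/
theorem zU_mul_leftMap_R21R_inv : T.zU * leftMap T.S T.α (↑T.R21R⁻¹ : H ⊗[k] H) = T.α := by
  have h1 : ∀ w : H ⊗[k] H, leftMap T.S T.α ((T.zU ⊗ₜ T.zU) * w) =
      T.zU * (T.zU * leftMap T.S T.α w) :=
    induction₂ (fun a b ha hb => by simp only [map_add, mul_add, ha, hb]) fun a b => by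
      simp only [Algebra.TensorProduct.tmul_mul_tmul, leftMap_tmul, map_mul, MulOpposite.unop_mul,
        S_zU]
      rw [← T.zU_central (MulOpposite.unop (T.S a)), ← mul_assoc (_ * T.α) T.zU, ← T.zU_central]
      simp only [mul_assoc]
  have h2 := T.leftMap_comul_mul T.zU (T.R21R : H ⊗[k] H)
  rw [counit_zU, one_smul, leftMap_R21R, comul_zU, mul_assoc, mul_assoc, Units.inv_mul, mul_one,
    h1] at h2
  exact T.isUnit_zU.mul_left_cancel h2

/-- `M¹ β S(M²) = u S(u) β` for `M = R₂₁R`. The left side is a coevaluation, hence determined by its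
zigzag with `α`, in which the full twist relation moves `M` over to the evaluation. -/
theorem rightMap_R21R : rightMap T.S T.β (T.R21R : H ⊗[k] H) = T.zU * T.β := by
  have h1 : ∀ v w : H ⊗[k] H, rightMap T.S (rightMap T.S T.β w) v = rightMap T.S T.β (v * w) := by
    intro v w
    revert v
    exact induction₂ (fun a b ha hb => by simp only [map_add, add_mul, ha, hb]) fun a b => by
      rw [rightMap_mul, rightMap_tmul]
  have h2 : ∀ (w : H ⊗[k] H) (t : H ⊗[k] (H ⊗[k] H)), zagMap T.S T.α (rightMap T.S T.β w) t =
      zagMap T.S T.α T.β (t * leg23 k H w) := by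
    intro w
    refine induction₃ (fun a b ha hb => by simp only [map_add, add_mul, ha, hb]) fun a b c => ?_
    rw [Algebra.TensorProduct.includeRight_apply, Algebra.TensorProduct.tmul_mul_tmul, mul_one]
    have := h1 (b ⊗ₜ c) w
    rw [rightMap_tmul] at this
    rw [zagMap_tmul, this]
    rfl
  have h3 : ∀ t : H ⊗[k] (H ⊗[k] H), zagMap T.S T.α T.β (leg12 k H (T.R21R : H ⊗[k] H) * t) =
      T.zU * zagMap T.S T.α T.β t := by
    refine induction₃ (fun a b ha hb => by simp only [map_add, mul_add, ha, hb]) fun a b c => ?_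
    have : ∀ w : H ⊗[k] H, zagMap T.S T.α T.β (leg12 k H w * (a ⊗ₜ[k] (b ⊗ₜ[k] c))) =
        MulOpposite.unop (T.S a) * leftMap T.S T.α w * (b * T.β * MulOpposite.unop (T.S c)) :=
      induction₂ (fun a b ha hb => by simp only [map_add, mul_add, add_mul, ha, hb]) fun a b => by
        simp [mul_assoc]
    rw [this, leftMap_R21R, zagMap_tmul, ← mul_assoc _ T.zU, ← zU_central]
    simp only [mul_assoc]
  have h4 : ∀ w : H ⊗[k] H, leg23 k H (T.R21R : H ⊗[k] H) *
      Algebra.TensorProduct.map (AlgHom.id k H) T.comul w =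
      Algebra.TensorProduct.map (AlgHom.id k H) T.comul w * leg23 k H (T.R21R : H ⊗[k] H) :=
    induction₂ (fun a b ha hb => by simp only [map_add, mul_add, add_mul, ha, hb]) fun a b => by
      rw [Algebra.TensorProduct.map_tmul, Algebra.TensorProduct.includeRight_apply,
        Algebra.TensorProduct.tmul_mul_tmul, Algebra.TensorProduct.tmul_mul_tmul, mul_one, one_mul,
        comul_mul_R21R]
  have h5 := T.eq_β_mul_zagMap (rightMap T.S T.β (T.R21R : H ⊗[k] H)) fun h => by
    rw [h1, comul_mul_R21R, T.rightMap_mul_comul]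
  have h6 := T.zagMap_mul_comul (T.R21R : H ⊗[k] H)
    ((↑T.Φ⁻¹ : H ⊗[k] (H ⊗[k] H)) * leg23 k H (T.R21R : H ⊗[k] H))
  have h7 := T.fullTwist_eq 1
  rw [mul_one, mul_one] at h7
  rw [counit_right_R21R, ← Algebra.TensorProduct.one_def (A := H) (B := H ⊗[k] H), mul_one,
    mul_assoc, h4, h7, Units.inv_mul_cancel_left, zagMap_comul_mul, counit_left_R21R,
    ← Algebra.TensorProduct.one_def (A := H) (B := H),
    ← Algebra.TensorProduct.one_def (A := H) (B := H ⊗[k] H), one_mul, h3, T.antipode_Φ_inv,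
    mul_one] at h6
  rw [h5, h2, ← h6, zU_central]

/-- `u S(u) m¹ β S(m²) = β`, where `m¹ ⊗ m² = (R₂₁R)⁻¹`. -/
theorem zU_mul_rightMap_R21R_inv : T.zU * rightMap T.S T.β (↑T.R21R⁻¹ : H ⊗[k] H) = T.β := by
  have h1 : ∀ w : H ⊗[k] H, rightMap T.S T.β ((T.zU ⊗ₜ T.zU) * w) =
      T.zU * (T.zU * rightMap T.S T.β w) :=
    induction₂ (fun a b ha hb => by simp only [map_add, mul_add, ha, hb]) fun a b => by
      rw [rightMap_mul, S_zU, rightMap_tmul, ← T.zU_central, ← mul_assoc]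
  have h2 := T.rightMap_mul_comul T.zU (T.R21R : H ⊗[k] H)
  rw [counit_zU, one_smul, rightMap_R21R, ← comul_mul_R21R, comul_zU, mul_assoc, mul_assoc,
    Units.inv_mul, mul_one, h1] at h2
  exact T.isUnit_zU.mul_left_cancel h2

/-! ### The algebra `H(θ)` -/

theorem incl_mul_theta (h : H) : T.incl h * T.theta = T.theta * T.incl h := by
  change RingQuot.mkAlgHom k (ThetaRel T) (Polynomial.C h) * RingQuot.mkAlgHom k (ThetaRel T) _ =
    RingQuot.mkAlgHom k (ThetaRel T) _ * RingQuot.mkAlgHom k (ThetaRel T) (Polynomial.C h)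
  rw [← map_mul, ← map_mul, Polynomial.X_mul_C]

theorem theta_mul_theta : T.theta * T.theta = T.incl T.zU := by
  have h := RingQuot.mkAlgHom_rel k (s := ThetaRel T) ThetaRel.sq
  rw [sq, map_mul] at h
  exact h

/-- `H(θ)` is generated by `H` and `θ`. -/
theorem theta_induction {p : T.Htheta → Prop} (incl : ∀ h, p (T.incl h)) (theta : p T.theta)
    (add : ∀ x y, p x → p y → p (x + y)) (mul : ∀ x y, p x → p y → p (x * y)) (x : T.Htheta) :
    p x := by
  obtain ⟨f, rfl⟩ := RingQuot.mkAlgHom_surjective k (ThetaRel T) x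
  induction f using Polynomial.induction_on with
  | C a => exact incl a
  | add f g hf hg => rw [map_add]; exact add _ _ hf hg
  | monomial n a h =>
    rw [pow_succ, ← mul_assoc, map_mul]
    exact mul _ _ h theta

theorem theta_algHom_ext {A : Type*} [Semiring A] [Algebra k A] {f g : T.Htheta →ₐ[k] A}
    (h1 : ∀ h, f (T.incl h) = g (T.incl h)) (h2 : f T.theta = g T.theta) : f = g :=
  AlgHom.ext <| T.theta_induction h1 h2 (fun x y hx hy => by rw [map_add, map_add, hx, hy])
    (fun x y hx hy => by rw [map_mul, map_mul, hx, hy])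

theorem theta_central (x : T.Htheta) : x * T.theta = T.theta * x :=
  T.theta_induction (p := fun x => x * T.theta = T.theta * x) T.incl_mul_theta rfl
    (fun x y hx hy => by rw [add_mul, mul_add, hx, hy])
    (fun x y hx hy => by rw [mul_assoc, hy, ← mul_assoc, hx, mul_assoc]) x

/-- The universal property of `H(θ)`. -/
noncomputable def liftTheta {A : Type*} [Ring A] [Algebra k A] (f : H →ₐ[k] A) (a : A)
    (hc : ∀ h, f h * a = a * f h) (hs : a * a = f T.zU) : T.Htheta →ₐ[k] A :=
  RingQuot.liftAlgHom k ⟨Polynomial.eval₂AlgHom f a fun h => hc h, by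
    rintro _ _ ⟨⟩
    rw [sq, map_mul]
    refine Eq.trans ?_ (hs.trans (Polynomial.eval₂_C (f : H →+* A) a).symm)
    exact congrArg₂ _ (Polynomial.eval₂_X _ _) (Polynomial.eval₂_X _ _)⟩

section Lift

variable {A : Type*} [Ring A] [Algebra k A] (f : H →ₐ[k] A) (a : A)
    (hc : ∀ h, f h * a = a * f h) (hs : a * a = f T.zU)

theorem liftTheta_incl (h : H) : T.liftTheta f a hc hs (T.incl h) = f h := by
  change RingQuot.liftAlgHom k _ (RingQuot.mkAlgHom k (ThetaRel T) (Polynomial.C h)) = _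
  rw [RingQuot.liftAlgHom_mkAlgHom_apply]
  exact Polynomial.eval₂_C _ _

theorem liftTheta_theta : T.liftTheta f a hc hs T.theta = a := by
  change RingQuot.liftAlgHom k _ (RingQuot.mkAlgHom k (ThetaRel T) Polynomial.X) = _
  rw [RingQuot.liftAlgHom_mkAlgHom_apply]
  exact Polynomial.eval₂_X _ _

end Lift

/-- `H` embeds into `H(θ)`: the algebra `H(θ)` acts on `H × H = H ⊕ θ H`. -/
theorem incl_injective : Function.Injective T.incl := by
  -- Left multiplication by `θ` on `H ⊕ θ H`, in the coordinates `(x, y) = x + θ y`.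
  let a : Module.End k (H × H) :=
    LinearMap.prod (LinearMap.mulLeft k T.zU ∘ₗ LinearMap.snd k H H) (LinearMap.fst k H H)
  have ha : ∀ x y, a (x, y) = (T.zU * y, x) := fun _ _ => rfl
  let F := T.liftTheta (Algebra.lsmul k k (H × H)) a
    (fun h => LinearMap.ext fun ⟨x, y⟩ => by simp [ha, ← mul_assoc, T.zU_central h])
    (LinearMap.ext fun ⟨x, y⟩ => by simp [ha])
  intro x y hxy
  have h := congrArg (fun g => (F g ((1 : H), (0 : H))).1) hxy
  simpa [F, liftTheta_incl] using h

/-- `θ` as a unit: its inverse is `θ (u S(u))⁻¹`. -/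
noncomputable def thetaUnit : T.Hthetaˣ where
  val := T.theta
  inv := T.theta * T.incl ↑T.isUnit_zU.unit⁻¹
  val_inv := by
    rw [← mul_assoc, theta_mul_theta, ← map_mul, IsUnit.mul_val_inv, map_one]
  inv_val := by
    rw [theta_central, ← mul_assoc, theta_mul_theta, ← map_mul, IsUnit.mul_val_inv, map_one]

theorem incl₂_tmul (a b : H) : T.incl₂ (a ⊗ₜ b) = T.incl a ⊗ₜ T.incl b := rfl

theorem incl₃_tmul (a : H) (b : H ⊗[k] H) : T.incl₃ (a ⊗ₜ b) = T.incl a ⊗ₜ T.incl₂ b := rfl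

/-- `θ ⊗ θ`. -/
noncomputable abbrev theta₂ : T.Htheta ⊗[k] T.Htheta := T.theta ⊗ₜ T.theta

/-- `θ ⊗ θ ⊗ θ`. -/
noncomputable abbrev theta₃ : T.Htheta ⊗[k] (T.Htheta ⊗[k] T.Htheta) := T.theta ⊗ₜ T.theta₂

theorem tmul_central {A B : Type*} [Ring A] [Algebra k A] [Ring B] [Algebra k B] {a : A} {b : B}
    (ha : ∀ x, x * a = a * x) (hb : ∀ y, y * b = b * y) (x : A ⊗[k] B) :
    x * (a ⊗ₜ b) = (a ⊗ₜ b) * x := by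
  revert x
  exact induction₂ (fun a b ha hb => by rw [add_mul, mul_add, ha, hb]) fun x y => by
    rw [Algebra.TensorProduct.tmul_mul_tmul, Algebra.TensorProduct.tmul_mul_tmul, ha, hb]

theorem tmul_tmul_central {A : Type*} [Ring A] [Algebra k A] {a : A} (ha : ∀ x, x * a = a * x)
    (x : A ⊗[k] (A ⊗[k] A)) : x * (a ⊗ₜ (a ⊗ₜ a)) = (a ⊗ₜ (a ⊗ₜ a)) * x :=
  tmul_central ha (tmul_central ha ha) x

theorem theta₂_central (x : T.Htheta ⊗[k] T.Htheta) : x * T.theta₂ = T.theta₂ * x :=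
  tmul_central T.theta_central T.theta_central x

theorem theta₃_central (x : T.Htheta ⊗[k] (T.Htheta ⊗[k] T.Htheta)) :
    x * T.theta₃ = T.theta₃ * x :=
  tmul_tmul_central T.theta_central x

/-- The comultiplication of `H(θ)`. -/
noncomputable def comulTheta : T.Htheta →ₐ[k] T.Htheta ⊗[k] T.Htheta :=
  T.liftTheta (T.incl₂.comp T.comul) (T.theta₂ * T.incl₂ (↑T.R21R⁻¹ : H ⊗[k] H))
    (fun h => by
      rw [AlgHom.comp_apply, ← mul_assoc, theta₂_central, mul_assoc, ← map_mul,
        comul_mul_R21R_inv, map_mul, mul_assoc])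
    (by
      rw [mul_assoc, ← mul_assoc (T.incl₂ _), theta₂_central, mul_assoc, ← map_mul, ← mul_assoc,
        Algebra.TensorProduct.tmul_mul_tmul, theta_mul_theta, ← incl₂_tmul, ← map_mul, ← comul_zU,
        AlgHom.comp_apply])

theorem comulTheta_incl (h : H) : T.comulTheta (T.incl h) = T.incl₂ (T.comul h) :=
  T.liftTheta_incl _ _ _ _ h

theorem comulTheta_theta :
    T.comulTheta T.theta = T.theta₂ * T.incl₂ (↑T.R21R⁻¹ : H ⊗[k] H) :=
  T.liftTheta_theta _ _ _ _

/-- The counit of `H(θ)`. -/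
noncomputable def counitTheta : T.Htheta →ₐ[k] k :=
  T.liftTheta T.counit 1 (fun h => by rw [mul_one, one_mul]) (by rw [mul_one, counit_zU])

theorem counitTheta_incl (h : H) : T.counitTheta (T.incl h) = T.counit h :=
  T.liftTheta_incl _ _ _ _ h

theorem counitTheta_theta : T.counitTheta T.theta = 1 :=
  T.liftTheta_theta _ _ _ _

/-- The antipode of `H(θ)`. -/
noncomputable def antipodeTheta : T.Htheta →ₐ[k] T.Hthetaᵐᵒᵖ :=
  T.liftTheta ((AlgHom.op T.incl).comp T.S) (MulOpposite.op T.theta)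
    (fun h => MulOpposite.unop_injective (T.incl_mul_theta _).symm)
    (MulOpposite.unop_injective (by
      change T.theta * T.theta = T.incl (MulOpposite.unop (T.S T.zU))
      rw [S_zU, theta_mul_theta]))

theorem antipodeTheta_incl (h : H) : MulOpposite.unop (T.antipodeTheta (T.incl h)) =
    T.incl (MulOpposite.unop (T.S h)) :=
  congrArg MulOpposite.unop (T.liftTheta_incl _ _ _ _ h)

theorem antipodeTheta_theta : MulOpposite.unop (T.antipodeTheta T.theta) = T.theta :=
  congrArg MulOpposite.unop (T.liftTheta_theta _ _ _ _)

/-! ### Compatibility of tensor legs with the embedding of `H` -/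

theorem map_id_comulTheta_incl₂ (w : H ⊗[k] H) :
    Algebra.TensorProduct.map (AlgHom.id k T.Htheta) T.comulTheta (T.incl₂ w) =
      T.incl₃ (Algebra.TensorProduct.map (AlgHom.id k H) T.comul w) := by
  revert w
  exact induction₂ (fun a b ha hb => by simp only [map_add, ha, hb]) fun a b => by
    rw [incl₂_tmul, Algebra.TensorProduct.map_tmul, Algebra.TensorProduct.map_tmul, incl₃_tmul,
      comulTheta_incl]
    rfl

theorem asc_incl₂_tmul (w : H ⊗[k] H) (b : H) :
    asc k T.Htheta (T.incl₂ w ⊗ₜ T.incl b) = T.incl₃ (asc k H (w ⊗ₜ b)) := by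
  revert w
  exact induction₂ (fun a b ha hb => by simp only [map_add, TensorProduct.add_tmul, ha, hb])
    fun a b => rfl

theorem asc_map_comulTheta_id_incl₂ (w : H ⊗[k] H) :
    asc k T.Htheta (Algebra.TensorProduct.map T.comulTheta (AlgHom.id k T.Htheta) (T.incl₂ w)) =
      T.incl₃ (asc k H (Algebra.TensorProduct.map T.comul (AlgHom.id k H) w)) := by
  revert w
  exact induction₂ (fun a b ha hb => by simp only [map_add, ha, hb]) fun a b => by
    rw [incl₂_tmul, Algebra.TensorProduct.map_tmul, Algebra.TensorProduct.map_tmul,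
      comulTheta_incl, ← asc_incl₂_tmul]
    rfl

theorem leg12_incl₂ (w : H ⊗[k] H) : leg12 k T.Htheta (T.incl₂ w) = T.incl₃ (leg12 k H w) := by
  revert w
  exact induction₂ (fun a b ha hb => by simp only [map_add, ha, hb]) fun a b => by
    simp [incl₂_tmul, incl₃_tmul]

theorem leg13_incl₂ (w : H ⊗[k] H) : leg13 k T.Htheta (T.incl₂ w) = T.incl₃ (leg13 k H w) := by
  revert w
  exact induction₂ (fun a b ha hb => by simp only [map_add, ha, hb]) fun a b => by
    simp [incl₂_tmul, incl₃_tmul]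

theorem leg23_incl₂ (w : H ⊗[k] H) : leg23 k T.Htheta (T.incl₂ w) = T.incl₃ (leg23 k H w) := by
  rw [Algebra.TensorProduct.includeRight_apply, Algebra.TensorProduct.includeRight_apply,
    incl₃_tmul, map_one]

theorem flip₂_incl₂ (w : H ⊗[k] H) : flip₂ k T.Htheta (T.incl₂ w) = T.incl₂ (flip₂ k H w) := by
  revert w
  exact induction₂ (fun a b ha hb => by simp only [map_add, ha, hb]) fun a b => rfl

theorem perm132_incl₃ (w : H ⊗[k] (H ⊗[k] H)) :
    perm132 k T.Htheta (T.incl₃ w) = T.incl₃ (perm132 k H w) := by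
  revert w
  exact induction₃ (fun a b ha hb => by simp only [map_add, ha, hb]) fun a b c => rfl

theorem perm213_incl₃ (w : H ⊗[k] (H ⊗[k] H)) :
    perm213 k T.Htheta (T.incl₃ w) = T.incl₃ (perm213 k H w) := by
  revert w
  exact induction₃ (fun a b ha hb => by simp only [map_add, ha, hb]) fun a b c => rfl

theorem perm312_incl₃ (w : H ⊗[k] (H ⊗[k] H)) :
    perm312 k T.Htheta (T.incl₃ w) = T.incl₃ (perm312 k H w) := by
  revert w
  exact induction₃ (fun a b ha hb => by simp only [map_add, ha, hb]) fun a b c => rfl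

theorem perm231_incl₃ (w : H ⊗[k] (H ⊗[k] H)) :
    perm231 k T.Htheta (T.incl₃ w) = T.incl₃ (perm231 k H w) := by
  revert w
  exact induction₃ (fun a b ha hb => by simp only [map_add, ha, hb]) fun a b c => rfl

theorem eL_incl₂ (w : H ⊗[k] H) :
    eL k T.Htheta T.counitTheta (T.incl₂ w) = T.incl (eL k H T.counit w) := by
  revert w
  exact induction₂ (fun a b ha hb => by simp only [map_add, ha, hb]) fun a b => by
    rw [incl₂_tmul, eL_tmul, eL_tmul, map_smul, counitTheta_incl]

theorem eR_incl₂ (w : H ⊗[k] H) :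
    eR k T.Htheta T.counitTheta (T.incl₂ w) = T.incl (eR k H T.counit w) := by
  revert w
  exact induction₂ (fun a b ha hb => by simp only [map_add, ha, hb]) fun a b => by
    rw [incl₂_tmul, eR_tmul, eR_tmul, map_smul, counitTheta_incl]

theorem eM_incl₃ (w : H ⊗[k] (H ⊗[k] H)) :
    eM k T.Htheta T.counitTheta (T.incl₃ w) = T.incl₂ (eM k H T.counit w) := by
  revert w
  exact induction₂ (fun a b ha hb => by simp only [map_add, ha, hb]) fun a b => by
    rw [incl₃_tmul, Algebra.TensorProduct.map_tmul, Algebra.TensorProduct.map_tmul, eL_incl₂,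
      incl₂_tmul]
    rfl

theorem leftMap_incl₂ (w : H ⊗[k] H) :
    leftMap T.antipodeTheta (T.incl T.α) (T.incl₂ w) = T.incl (leftMap T.S T.α w) := by
  revert w
  exact induction₂ (fun a b ha hb => by simp only [map_add, ha, hb]) fun a b => by
    rw [incl₂_tmul, leftMap_tmul, leftMap_tmul, antipodeTheta_incl, map_mul, map_mul]

theorem rightMap_incl₂ (w : H ⊗[k] H) :
    rightMap T.antipodeTheta (T.incl T.β) (T.incl₂ w) = T.incl (rightMap T.S T.β w) := by
  revert w
  exact induction₂ (fun a b ha hb => by simp only [map_add, ha, hb]) fun a b => by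
    rw [incl₂_tmul, rightMap_tmul, rightMap_tmul, antipodeTheta_incl, map_mul, map_mul]

theorem zigMap_incl₃ (w : H ⊗[k] (H ⊗[k] H)) :
    zigMap T.antipodeTheta (T.incl T.α) (T.incl T.β) (T.incl₃ w) =
      T.incl (zigMap T.S T.α T.β w) := by
  revert w
  exact induction₃ (fun a b ha hb => by simp only [map_add, ha, hb]) fun a b c => by
    simp [incl₃_tmul, incl₂_tmul, antipodeTheta_incl]

theorem zagMap_incl₃ (w : H ⊗[k] (H ⊗[k] H)) :
    zagMap T.antipodeTheta (T.incl T.α) (T.incl T.β) (T.incl₃ w) =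
      T.incl (zagMap T.S T.α T.β w) := by
  revert w
  exact induction₃ (fun a b ha hb => by simp only [map_add, ha, hb]) fun a b c => by
    simp [incl₃_tmul, incl₂_tmul, antipodeTheta_incl]

/-! ### The quasi-Hopf structure of `H(θ)` -/

/-- The inverse of the full twist on three strands, in two ways. -/
theorem fullTwist_inv_eq : leg23 k H (↑T.R21R⁻¹ : H ⊗[k] H) *
      Algebra.TensorProduct.map (AlgHom.id k H) T.comul (↑T.R21R⁻¹ : H ⊗[k] H) *
        (T.Φ : H ⊗[k] (H ⊗[k] H)) =
    (T.Φ : H ⊗[k] (H ⊗[k] H)) * (leg12 k H (↑T.R21R⁻¹ : H ⊗[k] H) *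
      asc k H (Algebra.TensorProduct.map T.comul (AlgHom.id k H) (↑T.R21R⁻¹ : H ⊗[k] H))) := by
  let a := Units.map (Algebra.TensorProduct.map (AlgHom.id k H) T.comul : _ →* H ⊗[k] (H ⊗[k] H))
    T.R21R
  let b := Units.map (leg23 k H : _ →* H ⊗[k] (H ⊗[k] H)) T.R21R
  let c := Units.map ((asc k H : _ →ₐ[k] H ⊗[k] (H ⊗[k] H)).comp
    (Algebra.TensorProduct.map T.comul (AlgHom.id k H)) : _ →* H ⊗[k] (H ⊗[k] H)) T.R21R
  let d := Units.map (leg12 k H : _ →* H ⊗[k] (H ⊗[k] H)) T.R21R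
  have h : a * b = T.Φ * (c * (d * T.Φ⁻¹)) := by
    have h := T.fullTwist_eq 1
    rw [mul_one, mul_one] at h
    exact Units.ext h
  have h2 : b⁻¹ * a⁻¹ * T.Φ = T.Φ * (d⁻¹ * c⁻¹) := by
    rw [← mul_inv_rev, h]
    group
  exact congrArg Units.val h2

/-- `(R₂₁R)⁻¹` satisfies the same commutation rule with `R` as the elements `Δ(h)`. -/
theorem R21R_inv_cop : flip₂ k H (↑T.R21R⁻¹ : H ⊗[k] H) * (T.R : H ⊗[k] H) =
    (T.R : H ⊗[k] H) * (↑T.R21R⁻¹ : H ⊗[k] H) := by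
  rw [Units.eq_mul_inv_iff_mul_eq, mul_assoc, R21R_val, R21_val]
  have h : flip₂ k H (T.R21R : H ⊗[k] H) = (T.R : H ⊗[k] H) * flip₂ k H (T.R : H ⊗[k] H) := by
    rw [R21R_val, map_mul, R21_val, flip₂_flip₂]
  rw [← mul_assoc (T.R : H ⊗[k] H), ← h, ← mul_assoc, ← map_mul, Units.inv_mul, map_one, one_mul]

section Transport

/-! The algebra `K` below is a variable so that the ring structures on its tensor powers are found
by the instances above. -/

variable {K : Type v} [Ring K] [Algebra k K]

theorem mul_assoc₃ (x y z : K ⊗[k] (K ⊗[k] K)) : x * y * z = x * (y * z) := mul_assoc x y z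

theorem intertwine_add {a b c d p : K ⊗[k] (K ⊗[k] K)} (h1 : a * p = p * b) (h2 : c * p = p * d) :
    (a + c) * p = p * (b + d) := by
  rw [add_mul, mul_add, h1, h2]

theorem intertwine_mul {a b c d p : K ⊗[k] (K ⊗[k] K)} (h1 : a * p = p * b) (h2 : c * p = p * d) :
    (a * c) * p = p * (b * d) := by
  rw [mul_assoc, h2, ← mul_assoc, h1, mul_assoc]

/-- The cocycle condition is preserved by an algebra map compatible with the comultiplications. -/
theorem cocycle_map (B : QuasiBialgebra k H) (f : H →ₐ[k] K) (δ : K →ₐ[k] K ⊗[k] K)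
    (hδ : ∀ h, δ (f h) = Algebra.TensorProduct.map f f (B.comul h)) (φ : K ⊗[k] (K ⊗[k] K))
    (hφ : φ = Algebra.TensorProduct.map f (Algebra.TensorProduct.map f f)
      (B.Φ : H ⊗[k] (H ⊗[k] H))) :
    (1 : K) ⊗ₜ[k] φ *
      Algebra.TensorProduct.map (AlgHom.id k K)
        ((asc k K : (K ⊗[k] K) ⊗[k] K →ₐ[k] K ⊗[k] (K ⊗[k] K)).comp
          (Algebra.TensorProduct.map δ (AlgHom.id k K))) φ *
      Algebra.TensorProduct.map (AlgHom.id k K)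
        (asc k K : (K ⊗[k] K) ⊗[k] K →ₐ[k] K ⊗[k] (K ⊗[k] K))
        (Algebra.TensorProduct.assoc k k k K (K ⊗[k] K) K (φ ⊗ₜ[k] (1 : K))) =
    Algebra.TensorProduct.map (AlgHom.id k K)
        (Algebra.TensorProduct.map (AlgHom.id k K) δ) φ *
      Algebra.TensorProduct.assoc k k k K K (K ⊗[k] K)
        (Algebra.TensorProduct.map δ (AlgHom.id k (K ⊗[k] K)) φ) := by
  subst hφ
  set f₂ := Algebra.TensorProduct.map f f
  set f₃ := Algebra.TensorProduct.map f f₂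
  let f₄ : H ⊗[k] (H ⊗[k] (H ⊗[k] H)) →ₐ[k] K ⊗[k] (K ⊗[k] (K ⊗[k] K)) :=
    Algebra.TensorProduct.map f f₃
  have h := congrArg f₄ B.cocycle'
  rw [map_mul, map_mul, map_mul] at h
  have h1 : ∀ x : H ⊗[k] (H ⊗[k] H), f₄ (B.cMid x) =
      Algebra.TensorProduct.map (AlgHom.id k K)
        ((asc k K : (K ⊗[k] K) ⊗[k] K →ₐ[k] K ⊗[k] (K ⊗[k] K)).comp
          (Algebra.TensorProduct.map δ (AlgHom.id k K))) (f₃ x) := by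
    refine induction₃ (fun a b ha hb => by simp only [map_add, ha, hb]) fun a b c => ?_
    have hw : ∀ w : H ⊗[k] H, f₃ (asc k H (w ⊗ₜ c)) = asc k K (f₂ w ⊗ₜ f c) :=
      induction₂ (fun a b ha hb => by simp only [map_add, TensorProduct.add_tmul, ha, hb])
        fun a b => rfl
    have hb := hw (B.comul b)
    rw [← hδ] at hb
    exact congrArg (f a ⊗ₜ[k] ·) hb
  have h2 : ∀ x : H ⊗[k] (H ⊗[k] H), f₄ (cOne k H x) =
      Algebra.TensorProduct.map (AlgHom.id k K)
        (asc k K : (K ⊗[k] K) ⊗[k] K →ₐ[k] K ⊗[k] (K ⊗[k] K))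
        (Algebra.TensorProduct.assoc k k k K (K ⊗[k] K) K (f₃ x ⊗ₜ[k] (1 : K))) :=
    induction₃ (fun a b ha hb => by simp only [map_add, ha, hb, TensorProduct.add_tmul])
      fun a b c => by
        rw [← map_one f]
        rfl
  have h3 : ∀ x : H ⊗[k] (H ⊗[k] H), f₄ (B.cRight x) =
      Algebra.TensorProduct.map (AlgHom.id k K)
        (Algebra.TensorProduct.map (AlgHom.id k K) δ) (f₃ x) :=
    induction₃ (fun a b ha hb => by simp only [map_add, ha, hb]) fun a b c =>
      congrArg (fun y => f a ⊗ₜ[k] (f b ⊗ₜ[k] y)) (hδ c).symm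
  have h4 : ∀ x : H ⊗[k] (H ⊗[k] H), f₄ (B.cLeft x) =
      Algebra.TensorProduct.assoc k k k K K (K ⊗[k] K)
        (Algebra.TensorProduct.map δ (AlgHom.id k (K ⊗[k] K)) (f₃ x)) := by
    refine induction₂ (fun a b ha hb => by simp only [map_add, ha, hb]) fun a b => ?_
    have hw : ∀ w : H ⊗[k] H, f₄ (Algebra.TensorProduct.assoc k k k H H (H ⊗[k] H) (w ⊗ₜ b)) =
        Algebra.TensorProduct.assoc k k k K K (K ⊗[k] K) (f₂ w ⊗ₜ f₂ b) :=
      induction₂ (fun a b ha hb => by simp only [map_add, ha, hb, TensorProduct.add_tmul])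
        fun a b => rfl
    have hb := hw (B.comul a)
    rw [← hδ] at hb
    exact hb
  rw [h1, h2, h3, h4, show f₄ (1 ⊗ₜ[k] (B.Φ : H ⊗[k] (H ⊗[k] H))) =
    f 1 ⊗ₜ[k] f₃ (B.Φ : H ⊗[k] (H ⊗[k] H)) from rfl, map_one] at h
  exact h

end Transport

theorem theta_quasi_coassoc (x : T.Htheta) :
    Algebra.TensorProduct.map (AlgHom.id k T.Htheta) T.comulTheta (T.comulTheta x) *
        T.incl₃ (T.Φ : H ⊗[k] (H ⊗[k] H)) =
      T.incl₃ (T.Φ : H ⊗[k] (H ⊗[k] H)) *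
        asc k T.Htheta (Algebra.TensorProduct.map T.comulTheta (AlgHom.id k T.Htheta)
          (T.comulTheta x)) := by
  induction x using T.theta_induction with
  | incl h =>
    rw [comulTheta_incl, map_id_comulTheta_incl₂, asc_map_comulTheta_id_incl₂, ← map_mul, ← map_mul,
      T.quasi_coassoc, mul_assoc, Units.inv_mul, mul_one]
  | add x y hx hy =>
    simp only [map_add]
    exact intertwine_add hx hy
  | mul x y hx hy =>
    simp only [map_mul]
    exact intertwine_mul hx hy
  | theta =>
    have h1 : Algebra.TensorProduct.map (AlgHom.id k T.Htheta) T.comulTheta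
        (T.comulTheta T.theta) = T.theta₃ * (T.incl₃ (leg23 k H (↑T.R21R⁻¹ : H ⊗[k] H)) *
          T.incl₃ (Algebra.TensorProduct.map (AlgHom.id k H) T.comul
            (↑T.R21R⁻¹ : H ⊗[k] H))) := by
      rw [comulTheta_theta, map_mul, map_id_comulTheta_incl₂, Algebra.TensorProduct.map_tmul,
        comulTheta_theta, AlgHom.id_apply, ← leg23_incl₂]
      have h3 : T.theta ⊗ₜ[k] (T.theta₂ * T.incl₂ (↑T.R21R⁻¹ : H ⊗[k] H)) =
          T.theta₃ * leg23 k T.Htheta (T.incl₂ (↑T.R21R⁻¹ : H ⊗[k] H)) := by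
        rw [Algebra.TensorProduct.includeRight_apply, Algebra.TensorProduct.tmul_mul_tmul, mul_one]
      rw [h3]
      exact mul_assoc₃ _ _ _
    have h2 : asc k T.Htheta (Algebra.TensorProduct.map T.comulTheta (AlgHom.id k T.Htheta)
        (T.comulTheta T.theta)) = T.theta₃ * (T.incl₃ (leg12 k H (↑T.R21R⁻¹ : H ⊗[k] H)) *
          T.incl₃ (asc k H (Algebra.TensorProduct.map T.comul (AlgHom.id k H)
            (↑T.R21R⁻¹ : H ⊗[k] H)))) := by
      have h3 : (T.theta₂ * T.incl₂ (↑T.R21R⁻¹ : H ⊗[k] H)) ⊗ₜ[k] T.theta =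
          (T.theta₂ ⊗ₜ[k] T.theta) * (T.incl₂ (↑T.R21R⁻¹ : H ⊗[k] H) ⊗ₜ[k] 1) := by
        rw [Algebra.TensorProduct.tmul_mul_tmul, mul_one]
      rw [comulTheta_theta, map_mul, map_mul, asc_map_comulTheta_id_incl₂,
        Algebra.TensorProduct.map_tmul, comulTheta_theta, AlgHom.id_apply, h3, map_mul,
        asc_tmul_one, leg12_incl₂]
      exact mul_assoc₃ _ _ _
    rw [h1, h2, ← map_mul, ← map_mul]
    refine intertwine_mul (T.theta₃_central _).symm ?_
    rw [← map_mul, ← map_mul, fullTwist_inv_eq]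

/-- The quasi-bialgebra structure of `H(θ)`. -/
noncomputable def thetaQuasiBialgebra : QuasiBialgebra k T.Htheta where
  comul := T.comulTheta
  counit := T.counitTheta
  Φ := Units.map (T.incl₃ : H ⊗[k] (H ⊗[k] H) →* _) T.Φ
  quasi_coassoc x := by
    rw [Units.eq_mul_inv_iff_mul_eq]
    exact T.theta_quasi_coassoc x
  counit_right x := by
    change (eR k T.Htheta T.counitTheta).comp T.comulTheta x = AlgHom.id k T.Htheta x
    congr 1
    refine T.theta_algHom_ext (fun h => ?_) ?_
    · rw [AlgHom.comp_apply, comulTheta_incl, eR_incl₂]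
      exact congrArg T.incl (T.counit_right h)
    · rw [AlgHom.comp_apply, comulTheta_theta, map_mul, eR_incl₂, counit_right_R21R_inv, map_one,
        mul_one, eR_tmul, counitTheta_theta, one_smul]
      rfl
  counit_left x := by
    change (eL k T.Htheta T.counitTheta).comp T.comulTheta x = AlgHom.id k T.Htheta x
    congr 1
    refine T.theta_algHom_ext (fun h => ?_) ?_
    · rw [AlgHom.comp_apply, comulTheta_incl, eL_incl₂]
      exact congrArg T.incl (T.counit_left h)
    · rw [AlgHom.comp_apply, comulTheta_theta, map_mul, eL_incl₂, counit_left_R21R_inv, map_one,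
        mul_one, eL_tmul, counitTheta_theta, one_smul]
      rfl
  cocycle :=
    cocycle_map T.toQuasiBialgebra T.incl T.comulTheta T.comulTheta_incl _ rfl
  counit_Φ := by
    have h := T.eM_incl₃ (T.Φ : H ⊗[k] (H ⊗[k] H))
    rw [show eM k H T.counit (T.Φ : H ⊗[k] (H ⊗[k] H)) = 1 from T.counit_Φ, map_one] at h
    exact h

/-- The quasi-Hopf algebra structure of `H(θ)`. -/
noncomputable def thetaQuasiHopf : QuasiHopfAlgebra k T.Htheta where
  toQuasiBialgebra := T.thetaQuasiBialgebra
  S := T.antipodeTheta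
  α := T.incl T.α
  β := T.incl T.β
  antipode_left x := by
    change leftMap T.antipodeTheta (T.incl T.α) (T.comulTheta x) = T.counitTheta x • T.incl T.α
    -- In this form the claim is multiplicative in `x`.
    have key : ∀ t, leftMap T.antipodeTheta (T.incl T.α) (T.comulTheta x * t) =
        T.counitTheta x • leftMap T.antipodeTheta (T.incl T.α) t := by
      -- By linearity, it suffices to know the case `t = 1`.
      have red : ∀ x, leftMap T.antipodeTheta (T.incl T.α) (T.comulTheta x) =
          T.counitTheta x • T.incl T.α →
          ∀ t, leftMap T.antipodeTheta (T.incl T.α) (T.comulTheta x * t) =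
            T.counitTheta x • leftMap T.antipodeTheta (T.incl T.α) t := fun x hx =>
        induction₂ (fun a b ha hb => by rw [mul_add, map_add, map_add, ha, hb, smul_add])
          fun a b => by
            rw [leftMap_mul, hx, leftMap_tmul, mul_smul_comm, smul_mul_assoc]
      induction x using T.theta_induction with
      | incl h =>
        refine red _ ?_
        rw [comulTheta_incl, leftMap_incl₂, T.antipode_left, counitTheta_incl, map_smul]
      | add x y hx hy =>
        intro t
        rw [map_add, add_mul, map_add, hx, hy, map_add, add_smul]
      | mul x y hx hy =>
        intro t
        rw [map_mul T.comulTheta, mul_assoc, hx, hy, map_mul, mul_smul]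
      | theta =>
        refine red _ ?_
        have h1 : ∀ w, leftMap T.antipodeTheta (T.incl T.α) (T.theta₂ * w) =
            T.incl T.zU * leftMap T.antipodeTheta (T.incl T.α) w :=
          induction₂ (fun a b ha hb => by simp only [mul_add, map_add, ha, hb]) fun a b => by
            rw [Algebra.TensorProduct.tmul_mul_tmul, leftMap_tmul, leftMap_tmul, map_mul,
              MulOpposite.unop_mul, antipodeTheta_theta, theta_central, ← mul_assoc _ T.theta,
              theta_central, ← theta_mul_theta]
            simp only [mul_assoc]
        rw [comulTheta_theta, h1, leftMap_incl₂, ← map_mul, zU_mul_leftMap_R21R_inv,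
          counitTheta_theta, one_smul]
    have := key 1
    rw [mul_one, Algebra.TensorProduct.one_def, leftMap_tmul] at this
    simpa using this
  antipode_right x := by
    change rightMap T.antipodeTheta (T.incl T.β) (T.comulTheta x) = T.counitTheta x • T.incl T.β
    -- In this form the claim is multiplicative in `x`.
    have key : ∀ t, rightMap T.antipodeTheta (T.incl T.β) (t * T.comulTheta x) =
        T.counitTheta x • rightMap T.antipodeTheta (T.incl T.β) t := by
      have red : ∀ x, rightMap T.antipodeTheta (T.incl T.β) (T.comulTheta x) =
          T.counitTheta x • T.incl T.β →
          ∀ t, rightMap T.antipodeTheta (T.incl T.β) (t * T.comulTheta x) =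
            T.counitTheta x • rightMap T.antipodeTheta (T.incl T.β) t := fun x hx =>
        induction₂ (fun a b ha hb => by rw [add_mul, map_add, map_add, ha, hb, smul_add])
          fun a b => by
            rw [rightMap_mul, hx, rightMap_tmul, mul_smul_comm, smul_mul_assoc]
      induction x using T.theta_induction with
      | incl h =>
        refine red _ ?_
        rw [comulTheta_incl, rightMap_incl₂, T.antipode_right, counitTheta_incl, map_smul]
      | add x y hx hy =>
        intro t
        rw [map_add, mul_add, map_add, hx, hy, map_add, add_smul]
      | mul x y hx hy =>
        intro t
        rw [map_mul T.comulTheta, ← mul_assoc, hy, hx, map_mul, mul_smul, smul_comm]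
      | theta =>
        refine red _ ?_
        have h1 : ∀ w, rightMap T.antipodeTheta (T.incl T.β) (T.theta₂ * w) =
            T.incl T.zU * rightMap T.antipodeTheta (T.incl T.β) w :=
          induction₂ (fun a b ha hb => by simp only [mul_add, map_add, ha, hb]) fun a b => by
            rw [rightMap_mul, antipodeTheta_theta, theta_central, ← mul_assoc, theta_mul_theta,
              rightMap_tmul]
        rw [comulTheta_theta, h1, rightMap_incl₂, ← map_mul, zU_mul_rightMap_R21R_inv,
          counitTheta_theta, one_smul]
    have := key 1
    rw [one_mul, Algebra.TensorProduct.one_def, rightMap_tmul] at this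
    simpa using this
  antipode_Φ := by
    have h := T.zigMap_incl₃ (T.Φ : H ⊗[k] (H ⊗[k] H))
    rw [T.antipode_Φ, map_one] at h
    exact h
  antipode_Φ_inv := by
    have h := T.zagMap_incl₃ (↑T.Φ⁻¹ : H ⊗[k] (H ⊗[k] H))
    rw [T.antipode_Φ_inv, map_one] at h
    exact h

/-- The quasitriangular quasi-Hopf algebra structure of `H(θ)`. -/
noncomputable def thetaQT : QTQuasiHopfAlgebra k T.Htheta where
  toQuasiHopfAlgebra := T.thetaQuasiHopf
  R := Units.map (T.incl₂ : H ⊗[k] H →* _) T.R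
  comul_left_R := by
    have h := congrArg T.incl₃ T.comul_left_R
    simp only [map_mul] at h
    rw [← asc_map_comulTheta_id_incl₂, ← perm312_incl₃, ← leg13_incl₂, ← perm132_incl₃,
      ← leg23_incl₂] at h
    exact h
  comul_right_R := by
    have h := congrArg T.incl₃ T.comul_right_R
    simp only [map_mul] at h
    rw [← map_id_comulTheta_incl₂, ← perm231_incl₃, ← leg13_incl₂, ← perm213_incl₃,
      ← leg12_incl₂] at h
    exact h
  cop_mul_R x := by
    change flip₂ k T.Htheta (T.comulTheta x) * T.incl₂ (T.R : H ⊗[k] H) =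
      T.incl₂ (T.R : H ⊗[k] H) * T.comulTheta x
    induction x using T.theta_induction with
    | incl h => rw [comulTheta_incl, flip₂_incl₂, ← map_mul, ← map_mul, T.cop_mul_R]
    | add x y hx hy => simp only [map_add, add_mul, mul_add, hx, hy]
    | mul x y hx hy =>
      simp only [map_mul]
      rw [mul_assoc, hy, ← mul_assoc, hx, mul_assoc]
    | theta =>
      rw [comulTheta_theta, map_mul, flip₂_incl₂, Algebra.TensorProduct.comm_tmul, mul_assoc,
        ← map_mul, R21R_inv_cop, map_mul, ← mul_assoc, ← mul_assoc, theta₂_central]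

theorem isThetaStructure_thetaQuasiHopf : T.IsThetaStructure T.thetaQuasiHopf where
  comul_incl := T.comulTheta_incl
  counit_incl := T.counitTheta_incl
  antipode_incl := T.antipodeTheta_incl
  comul_theta := T.comulTheta_theta
  counit_theta := T.counitTheta_theta
  antipode_theta := T.antipodeTheta_theta
  Φ_eq := rfl
  α_eq := rfl
  β_eq := rfl

/-- The structure of `H(θ)` is determined by its values on the generators. -/
theorem IsThetaStructure.unique {Q Q' : QuasiHopfAlgebra k T.Htheta} (h : T.IsThetaStructure Q)
    (h' : T.IsThetaStructure Q') : Q = Q' :=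
  QuasiHopfAlgebra.ext
    (T.theta_algHom_ext (fun a => by rw [h.comul_incl, h'.comul_incl])
      (by rw [h.comul_theta, h'.comul_theta]))
    (T.theta_algHom_ext (fun a => by rw [h.counit_incl, h'.counit_incl])
      (by rw [h.counit_theta, h'.counit_theta]))
    (Units.ext (by rw [h.Φ_eq, h'.Φ_eq]))
    (T.theta_algHom_ext
      (fun a => MulOpposite.unop_injective (by rw [h.antipode_incl, h'.antipode_incl]))
      (MulOpposite.unop_injective (by rw [h.antipode_theta, h'.antipode_theta])))
    (by rw [h.α_eq, h'.α_eq]) (by rw [h.β_eq, h'.β_eq])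

theorem thetaQT_R21R : (T.thetaQT.R21R : T.Htheta ⊗[k] T.Htheta) =
    T.incl₂ (T.R21R : H ⊗[k] H) := by
  rw [R21R_val, R21R_val, map_mul, R21_val, R21_val, ← flip₂_incl₂]
  rfl

theorem theta_inv_central (x : T.Htheta) :
    x * (↑T.thetaUnit⁻¹ : T.Htheta) = (↑T.thetaUnit⁻¹ : T.Htheta) * x := by
  rw [Units.eq_inv_mul_iff_mul_eq, ← mul_assoc, Units.mul_inv_eq_iff_eq_mul]
  exact (T.theta_central x).symm

theorem isRibbonElement_theta_inv : T.thetaQT.IsRibbonElement (↑T.thetaUnit⁻¹ : T.Htheta) where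
  isUnit := Units.isUnit _
  central := T.theta_inv_central
  comul_eq := by
    have h : T.thetaQT.comul T.thetaUnit * ((↑T.thetaUnit⁻¹ : T.Htheta) ⊗ₜ[k]
        (↑T.thetaUnit⁻¹ : T.Htheta) * (T.thetaQT.R21R : T.Htheta ⊗[k] T.Htheta)) = 1 := by
      have h1 : T.thetaQT.comul T.thetaUnit = T.theta₂ * T.incl₂ (↑T.R21R⁻¹ : H ⊗[k] H) :=
        T.comulTheta_theta
      have h2 : T.theta₂ * ((↑T.thetaUnit⁻¹ : T.Htheta) ⊗ₜ[k]
        (↑T.thetaUnit⁻¹ : T.Htheta)) = 1 := by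
        rw [Algebra.TensorProduct.tmul_mul_tmul, show T.theta * (↑T.thetaUnit⁻¹ : T.Htheta) = 1 from
          T.thetaUnit.mul_inv]
        rfl
      have h3 : T.incl₂ (↑T.R21R⁻¹ : H ⊗[k] H) * ((↑T.thetaUnit⁻¹ : T.Htheta) ⊗ₜ[k]
          (↑T.thetaUnit⁻¹ : T.Htheta)) = ((↑T.thetaUnit⁻¹ : T.Htheta) ⊗ₜ[k]
          (↑T.thetaUnit⁻¹ : T.Htheta)) * T.incl₂ (↑T.R21R⁻¹ : H ⊗[k] H) :=
        tmul_central T.theta_inv_central T.theta_inv_central _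
      rw [h1, thetaQT_R21R, mul_assoc, ← mul_assoc (T.incl₂ _), h3, mul_assoc, ← map_mul,
        Units.inv_mul, map_one, mul_one, h2]
    have h4 : T.thetaQT.comul (↑T.thetaUnit⁻¹ : T.Htheta) * T.thetaQT.comul T.thetaUnit = 1 := by
      rw [← map_mul, Units.inv_mul, map_one]
    exact left_inv_eq_right_inv h4 h
  antipode_eq := by
    have h : T.thetaQT.S (↑T.thetaUnit⁻¹ : T.Htheta) * T.thetaQT.S T.thetaUnit = 1 := by
      rw [← map_mul, Units.inv_mul, map_one]
    have h2 := congrArg MulOpposite.unop h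
    rw [MulOpposite.unop_mul, show MulOpposite.unop (T.thetaQT.S T.thetaUnit) = T.thetaUnit from
      T.antipodeTheta_theta] at h2
    exact (Units.mul_eq_one_iff_inv_eq.1 h2).symm

/-! ### The ribbon twist -/

/-- The natural automorphism of the identity functor given by a central unit. -/
noncomputable def centralIso (t : Hˣ) (ht : ∀ h : H, h * t = t * h) : 𝟭 T.FdMod ≅ 𝟭 T.FdMod :=
  NatIso.ofComponents
    (fun V => FdMod.mkIso (V := V) (W := V) (actEquiv V.act t) fun h v => by
      rw [actEquiv_apply, actEquiv_apply, ← Module.End.mul_apply, ← map_mul, ← ht, map_mul,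
        Module.End.mul_apply])
    (fun f => FdMod.hom_ext fun v => (FdMod.Hom.map_act f (t : H) v).symm)

/-- The double braiding is the action of `R₂₁R`. -/
theorem braidEquiv_braidEquiv {U V : Type u} [AddCommGroup U] [Module k U] [AddCommGroup V]
    [Module k V] (ρ : H →ₐ[k] Module.End k U) (σ : H →ₐ[k] Module.End k V) (x : U ⊗[k] V) :
    T.braidEquiv σ ρ (T.braidEquiv ρ σ x) = outer ρ σ (T.R21R : H ⊗[k] H) x := by
  rw [braidEquiv_apply, braidEquiv_apply, outer_comm, TensorProduct.comm_comm, R21R_val, map_mul]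
  rfl

theorem map_dualAct_coevMap {a : H} (ha : ∀ h : H, h * a = a * h)
    (hS : MulOpposite.unop (T.S a) = a) {U : Type u} [AddCommGroup U] [Module k U]
    [FiniteDimensional k U] (ρ : H →ₐ[k] Module.End k U) (c : k) :
    TensorProduct.map LinearMap.id (dualAct ρ T.S a) (T.coevMap ρ c) =
      TensorProduct.map (ρ a) LinearMap.id (T.coevMap ρ c) := by
  have hs : dualAct ρ T.S a = (ρ a).dualMap := by
    change (ρ (MulOpposite.unop (T.S a))).dualMap = _
    rw [hS]
  have h1 : TensorProduct.map LinearMap.id (ρ a).dualMap ∘ₗ TensorProduct.map (ρ T.β)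
        LinearMap.id = TensorProduct.map (ρ T.β) LinearMap.id ∘ₗ
          TensorProduct.map LinearMap.id (ρ a).dualMap := by
    rw [← TensorProduct.map_comp, ← TensorProduct.map_comp]
    rfl
  have h2 : ρ a ∘ₗ ρ T.β = ρ T.β ∘ₗ ρ a := by
    rw [← Module.End.mul_eq_comp, ← Module.End.mul_eq_comp, ← map_mul, ← map_mul, ha]
  have hc : c = c • (1 : k) := by simp
  rw [hc, map_smul, map_smul, map_smul, hs, coevMap, LinearMap.comp_apply,
    ← LinearMap.comp_apply (TensorProduct.map LinearMap.id _), h1, LinearMap.comp_apply,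
    coevaluation_slide, ← LinearMap.comp_apply, ← LinearMap.comp_apply (TensorProduct.map (ρ a) _),
    ← TensorProduct.map_comp, ← TensorProduct.map_comp, h2]

/-- A ribbon element acts as a ribbon twist. -/
theorem IsRibbonElement.isRibbonTwist {t : Hˣ} (h : T.IsRibbonElement (t : H)) :
    IsRibbonTwist (T.centralIso t h.central) where
  tensor V W := FdMod.hom_ext fun (x : V.carrier ⊗[k] W.carrier) => by
    change outer V.act W.act (T.comul t) x = outer V.act W.act ((t : H) ⊗ₜ (t : H))
      (T.braidEquiv W.act V.act (T.braidEquiv V.act W.act x))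
    rw [braidEquiv_braidEquiv, h.comul_eq, map_mul, Module.End.mul_apply]
  dual V := by
    let f : V ⟶ V := (T.centralIso t h.central).hom.app V
    let g : HasRightDual.rightDual V ⟶ HasRightDual.rightDual V :=
      (T.centralIso t h.central).hom.app (HasRightDual.rightDual V)
    -- The two morphisms agree after pairing with the coevaluation.
    have hcoev : η_ V (HasRightDual.rightDual V) ≫ V ◁ g =
        η_ V (HasRightDual.rightDual V) ≫ f ▷ HasRightDual.rightDual V := by
      refine FdMod.hom_ext fun (c : k) => ?_
      change TensorProduct.map LinearMap.id (dualAct V.act T.S t) (T.coevMap V.act c) =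
        TensorProduct.map (V.act t) LinearMap.id (T.coevMap V.act c)
      exact map_dualAct_coevMap T h.central h.antipode_eq V.act c
    have h2 := congrArg (tensorLeftHomEquiv _ V (HasRightDual.rightDual V) _).symm hcoev
    rw [tensorLeftHomEquiv_symm_coevaluation_comp_whiskerLeft,
      tensorLeftHomEquiv_symm_coevaluation_comp_whiskerRight] at h2
    exact (Iso.cancel_iso_hom_left _ _ _).1 h2

end QTQuasiHopfAlgebra

theorem mainTheorem5 {k : Type u} [Field k] {H : Type v} [Ring H] [Algebra k H]
    (T : QTQuasiHopfAlgebra k H) :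
    Function.Injective T.incl ∧
    ∃ T' : QTQuasiHopfAlgebra k T.Htheta,
      T.IsThetaStructure T'.toQuasiHopfAlgebra ∧
      (∀ Q : QuasiHopfAlgebra k T.Htheta, T.IsThetaStructure Q → Q = T'.toQuasiHopfAlgebra) ∧
      (T'.R : T.Htheta ⊗[k] T.Htheta) = T.incl₂ (T.R : H ⊗[k] H) ∧
      ∃ t : (T.Htheta)ˣ, (t : T.Htheta) = T.theta ∧
        T'.IsRibbonElement (↑t⁻¹ : T.Htheta) ∧
        ∃ η : 𝟭 T'.FdMod ≅ 𝟭 T'.FdMod, IsRibbonTwist η ∧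
          ∀ (V : T'.FdMod) (v : V.carrier),
            QTQuasiHopfAlgebra.FdMod.Hom.lin (η.hom.app V) v = V.act (↑t⁻¹ : T.Htheta) v := by
  refine ⟨T.incl_injective, T.thetaQT, T.isThetaStructure_thetaQuasiHopf,
    fun Q hQ => hQ.unique T T.isThetaStructure_thetaQuasiHopf, rfl, T.thetaUnit, rfl,
    T.isRibbonElement_theta_inv, _, T.isRibbonElement_theta_inv.isRibbonTwist, fun V v => rfl⟩
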